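/- Logarithms are to base 2, and $\mathcal E^{t}$ denotes the set of $n$-qubit Pauli operators $i^sX^{u}Z^{v}$ acting nontrivially on at most $t$ qubits. An $[n,k]$ stabilizer code is the $2^k$-dimensional space of states fixed by an abelian subgroup $S$ of order $2^{n-k}$ of the Pauli group, with an encoding $|\psi\rangle\mapsto|\bar\psi\rangle$ of $k$ qubits under which Pauli operators on the $k$ encoded qubits are realized by $n$-qubit Pauli operators. It is an $[n,k,t,L]$-list code if there are a quantum operation $\mathcal D$ and, for each syndrome $s\in\{0,1\}^{n-k}$, Pauli operators $P^s_1,\dots,P^s_L$ on the $k$ encoded qubits such that for every $E\in\mathcal E^t$ and every encoded state, $$\mathcal D(E|\bar\psi\rangle\langle\bar\psi|E^\dagger)=\sum_s\sum_jA^s_j|\psi\rangle\langle\psi|A^{s\dagger}_j\otimes|s\rangle\langle s|,\qquad \sum_{s,j}A^{s\dagger}_jA^s_j=I,$$ where each $A^s_j$ (which may depend on $E$ but not on $\psi$) is a linear combination of elements of the group generated by $P^s_1,\dots,P^s_L$. The adversarial channel $\mathcal N^{\rm adv}_{p,n}$ applies an operation $\rho\mapsto\sum_iA_i\rho A_i^\dagger$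 with $\sum_i A_i^\dagger A_i=I$ and every $A_i$ in the span of $\mathcal E^{pn}$, chosen by an adversary who knows the protocol but not the secret key. A nonempty set $A\subseteq\{0,1\}^m$ is $\eta$-biased if $|\Pr_{a\in A}(e\cdot a=0)-\Pr_{a\in A}(e\cdot a=1)|\le\eta$ for all $0\neq e\in\{0,1\}^m$. **Theorem.** Let $0<\epsilon<1/2$ and $0<\eta\le1/2$, let $\mathcal C$ be an $[n,k,pn,L]$-list code of rate $R$, $k=Rn$, and let $K=\lceil(2L+\log(1/\epsilon))/\log(4/3)\rceil\le k$. (1) For $0\le j<K$ let $A_{j+1}\subseteq\{0,1\}^{2(k-j)}$ be an $\eta$-biased set. Starting from $\mathcal C_0=\mathcal C$, progressively form subcodes: the secret key consists of independent uniformly random elements $a_{j+1}\in A_{j+1}\setminus\{0\}$, and $\mathcal C_{j+1}$ is obtained from $\mathcal C_j$ by adding a stabilizer generator $T_{j+1}$ that acts on the $k-j$ encoded qubits of $\mathcal C_j$, up to a phase, as the Pauli operator $X^uZ^v$ with $(u,v)=a_{j+1}$; the code $\mathcal C_{j+1}$ and its encoding may depend on $a_1,\dots,a_{j+1}$ only.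 Such subcodes exist, and for every way of choosing them there is a decoding operation for each key such that, encoding in $\mathcal C_K$, $nR-K$ qubits are sent over $\mathcal N^{\rm adv}_{p,n}$ with fidelity at least $1-\epsilon$: for every choice of the adversary and every logical pure state $|\psi\rangle$, the decoded state, averaged over the key, has fidelity at least $1-\epsilon$ with $|\psi\rangle$. (2) There is an absolute constant $c$ such that $\eta$-biased sets $A_1,\dots,A_K$ as in (1) can always be chosen so that the key has fewer than $c\,K\log(n^2/\eta)$ bits. (3) For fixed $R$, $L$ and $\epsilon$, $nR-K=n(R-o(1))$ as $n\to\infty$. (4) Consequently, for every $p\in[0,1]$, every $R<1-H(p)-p\log3$ (with $H$ the binary entropy) and every $0<\epsilon<1/2$ there is a constant $c'$ such that for all sufficiently large $n$ at least $Rn$ qubits can be sent over $\mathcal N^{\rm adv}_{p,n}$ with fidelity at least $1-\epsilon$ using a secret key of at most $c'\log n$ bits. -/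

import Mathlib

open scoped Matrix Kronecker BigOperators

/-- Bit strings of length `n`. They label the computational basis of `n` qubits, so the state space
of `n` qubits is `Bits n → ℂ` and its operators are the matrices indexed by `Bits n`. -/
abbrev Bits (n : ℕ) : Type := Fin n → ZMod 2

/-- Operators on `n` qubits. -/
abbrev Op (n : ℕ) : Type := Matrix (Bits n) (Bits n) ℂ

/-- The projector `|ψ⟩⟨ψ|`. -/
def proj {α : Type} (ψ : α → ℂ) : Matrix α α ℂ := Matrix.vecMulVec ψ (star ψ)

/-- `ψ` is a unit vector. -/
def IsUnitVec {α : Type} [Fintype α] (ψ : α → ℂ) : Prop := star ψ ⬝ᵥ ψ = 1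

/-! ### Pauli operators -/

/-- The sign `(-1)^a` of a bit `a`. -/
noncomputable def bitSign (a : ZMod 2) : ℂ := (-1) ^ a.val

/-- The operator `X^u Z^v` on `n` qubits: `X^u Z^v |x⟩ = (-1)^(v·x) |x + u⟩`. -/
noncomputable def pauliXZ {n : ℕ} (u v : Bits n) : Op n :=
  Matrix.of fun y x => if y = x + u then bitSign (v ⬝ᵥ x) else 0

theorem bitSign_add (a b : ZMod 2) : bitSign (a + b) = bitSign a * bitSign b := by
  revert a b
  have h : ∀ a : ZMod 2, a = 0 ∨ a = 1 := by decide
  intro a b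
  have h11 : (1 : ZMod 2) + 1 = 0 := by decide
  have hv : (1 : ZMod 2).val = 1 := rfl
  rcases h a with rfl | rfl <;> rcases h b with rfl | rfl <;> simp [bitSign, h11, hv]

theorem bitSign_eq_I_pow (a : ZMod 2) : bitSign a = Complex.I ^ (2 * a.val) := by
  rw [pow_mul, Complex.I_sq, bitSign]

theorem pauliXZ_mul {n : ℕ} (u v u' v' : Bits n) :
    pauliXZ u v * pauliXZ u' v' = bitSign (v ⬝ᵥ u') • pauliXZ (u + u') (v + v') := by
  ext y x
  rw [Matrix.mul_apply, Finset.sum_eq_single (x + u')]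
  · have hy : (y = x + u' + u) ↔ (y = x + (u + u')) := by rw [add_assoc, add_comm u' u]
    simp only [pauliXZ, Matrix.of_apply, Matrix.smul_apply, smul_eq_mul, if_true, hy]
    split_ifs
    · simp only [dotProduct_add, add_dotProduct, bitSign_add]
      ring
    · simp
  · intro z _ hz
    simp [pauliXZ, hz]
  · simp

theorem pauliXZ_zero {n : ℕ} : pauliXZ (0 : Bits n) 0 = 1 := by
  ext y x
  simp [pauliXZ, Matrix.one_apply, bitSign]

/-- The Pauli group on `n` qubits: all `i^t X^u Z^v`. -/
noncomputable def pauliGroup (n : ℕ) : Subgroup (Op n)ˣ where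
  carrier := {U | ∃ (t : ℕ) (u v : Bits n), (U : Op n) = Complex.I ^ t • pauliXZ u v}
  mul_mem' := by
    rintro U W ⟨t, u, v, hU⟩ ⟨t', u', v', hW⟩
    refine ⟨t + t' + 2 * (v ⬝ᵥ u').val, u + u', v + v', ?_⟩
    rw [Units.val_mul, hU, hW, Matrix.smul_mul, Matrix.mul_smul, pauliXZ_mul, bitSign_eq_I_pow,
      smul_smul, smul_smul, pow_add, pow_add, mul_assoc]
  one_mem' := ⟨0, 0, 0, by simp [pauliXZ_zero]⟩
  inv_mem' := by
    rintro U ⟨t, u, v, hU⟩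
    refine ⟨3 * t + 2 * (v ⬝ᵥ u).val, u, v, ?_⟩
    have h2 : ∀ w : Bits n, w + w = 0 := fun w => by
      ext i
      exact CharTwo.add_self_eq_zero (w i)
    have hs : bitSign (v ⬝ᵥ u) * bitSign (v ⬝ᵥ u) = 1 := by
      rw [← bitSign_add, CharTwo.add_self_eq_zero]
      simp [bitSign]
    have hI : Complex.I ^ t * Complex.I ^ (3 * t) = 1 := by
      rw [← pow_add, show t + 3 * t = 4 * t by ring, pow_mul, Complex.I_pow_four, one_pow]
    apply Units.inv_eq_of_mul_eq_one_right
    rw [hU, Matrix.smul_mul, Matrix.mul_smul, pauliXZ_mul, h2, h2, pauliXZ_zero, pow_add,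
      ← bitSign_eq_I_pow, smul_smul, smul_smul, mul_assoc, mul_assoc, hs, mul_one, hI, one_smul]

/-- The number of qubits on which `X^u Z^v` acts nontrivially. -/
def pauliWeight {n : ℕ} (u v : Bits n) : ℕ :=
  (Finset.univ.filter fun i => u i ≠ 0 ∨ v i ≠ 0).card

/-- The Pauli operators on `n` qubits of weight at most `r`. -/
def errorSet (n : ℕ) (r : ℝ) : Set (Op n) :=
  {E | ∃ (t : ℕ) (u v : Bits n), (pauliWeight u v : ℝ) ≤ r ∧ E = Complex.I ^ t • pauliXZ u v}

/-! ### Quantum channels -/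

/-- A quantum operation from a system with basis `α` to a system with basis `β`, given by finitely
many Kraus operators. -/
structure Channel (α β : Type) [Fintype α] [DecidableEq α] [Fintype β] where
  /-- the number of Kraus operators -/
  r : ℕ
  /-- the Kraus operators -/
  kraus : Fin r → Matrix β α ℂ
  trace_preserving : ∑ i, (kraus i)ᴴ * kraus i = 1

/-- The action `ρ ↦ ∑ i, A i ρ (A i)†` of a quantum operation. -/
def Channel.apply {α β : Type} [Fintype α] [DecidableEq α] [Fintype β] (N : Channel α β)
    (ρ : Matrix α α ℂ) : Matrix β β ℂ :=
  ∑ i, N.kraus i * ρ * (N.kraus i)ᴴ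

/-- The operation `ρ ↦ V ρ V†` for an isometry `V`. -/
def Channel.ofIsometry {α β : Type} [Fintype α] [DecidableEq α] [Fintype β] (V : Matrix β α ℂ)
    (hV : Vᴴ * V = 1) : Channel α β where
  r := 1
  kraus := fun _ => V
  trace_preserving := by simpa using hV

/-- `N` is one of the operations that the `n`-qubit adversarial channel with error rate `p` may
apply: each of its Kraus operators is a linear combination of Pauli operators of weight at
most `p n`. -/
def IsAdversarial {n : ℕ} (p : ℝ) (N : Channel (Bits n) (Bits n)) : Prop :=
  ∀ i, N.kraus i ∈ Submodule.span ℂ (errorSet n (p * n))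

/-! ### Communication with a secret key -/

/-- The fidelity `⟨ψ|ρ|ψ⟩` of `ρ` with the pure state `ψ`. -/
def pureFidelity {α : Type} [Fintype α] (ψ : α → ℂ) (ρ : Matrix α α ℂ) : ℝ :=
  (star ψ ⬝ᵥ (ρ *ᵥ ψ)).re

/-- Sender and receiver share a uniformly random element of `Key`; the sender encodes `m` logical
qubits into `n` qubits by `enc κ`, and the receiver decodes by `dec κ`. This strategy sends `m`
qubits over the adversarial channel of error rate `p` with fidelity at least `f` if the fidelity of
the decoded state (averaged over the key) with the logical state is at least `f`, whatever the
adversary, who knows `enc` and `dec` but not the key, does, and for every logical state. -/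
def SendsWithFidelity {n m : ℕ} {Key : Type} [Fintype Key] (enc : Key → Channel (Bits m) (Bits n))
    (dec : Key → Channel (Bits n) (Bits m)) (p f : ℝ) : Prop :=
  ∀ N : Channel (Bits n) (Bits n), IsAdversarial p N → ∀ ψ : Bits m → ℂ, IsUnitVec ψ →
    f ≤ pureFidelity ψ ((Fintype.card Key : ℂ)⁻¹ •
      ∑ κ, (dec κ).apply (N.apply ((enc κ).apply (proj ψ))))

/-- The number of bits of a key, i.e. the least `b` such that `b` bits can index all its values. -/
def keyBits (Key : Type) [Fintype Key] : ℕ := Nat.clog 2 (Fintype.card Key)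

/-! ### Stabilizer codes and list codes -/

/-- The Pauli operator `X^u Z^v` on `m` qubits described by the string `a = (u, v)` of `2m` bits. -/
noncomputable def pauliOf {m : ℕ} (a : Fin m ⊕ Fin m → ZMod 2) : Op m :=
  pauliXZ (fun i => a (Sum.inl i)) (fun i => a (Sum.inr i))

/-- An `[n, k]` stabilizer code: an abelian subgroup of order `2^(n-k)` of the Pauli group whose
space of simultaneously stabilized states has dimension `2^k`, together with an encoding of `k`
qubits, i.e. an isometry `enc` onto the code under which every Pauli operator on the `k` encoded
qubits is realized by a Pauli operator on the `n` physical qubits. -/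
structure StabilizerCode (n k : ℕ) where
  le : k ≤ n
  stab : Subgroup (Op n)ˣ
  stab_le : stab ≤ pauliGroup n
  stab_comm : ∀ P ∈ stab, ∀ Q ∈ stab, P * Q = Q * P
  card_stab : Nat.card stab = 2 ^ (n - k)
  enc : Matrix (Bits n) (Bits k) ℂ
  enc_isometry : encᴴ * enc = 1
  /-- the range of `enc` is the space of states stabilized by `stab` -/
  range_enc : ∀ φ : Bits n → ℂ,
    (∃ ψ : Bits k → ℂ, enc *ᵥ ψ = φ) ↔ ∀ P ∈ stab, (P : Op n) *ᵥ φ = φ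
  enc_pauli : ∀ a : Fin k ⊕ Fin k → ZMod 2,
    ∃ P ∈ pauliGroup n, (P : Op n) * enc = enc * pauliOf a

/-- The `n`-qubit encoding operation of a stabilizer code. -/
def StabilizerCode.encode {n k : ℕ} (C : StabilizerCode n k) : Channel (Bits k) (Bits n) :=
  Channel.ofIsometry C.enc C.enc_isometry

/-- `C` is an `[n, k, t, L]`-list code: some decoding operation `D` returns, for every Pauli error
`E` of weight at most `t` and every encoded state, a syndrome `s` (a string of `n - k` bits) and the
logical state acted on by linear combinations of elements of the group generated by the list
`P s 1, …, P s L` of logical errors; the list depends on the syndrome only. -/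
def IsListCode {n k : ℕ} (C : StabilizerCode n k) (t : ℝ) (L : ℕ) : Prop :=
  ∃ (D : Channel (Bits n) (Bits k × Bits (n - k))) (P : Bits (n - k) → Fin L → pauliGroup k),
    ∀ E ∈ errorSet n t, ∃ (r : ℕ) (A : Bits (n - k) → Fin r → Op k),
      (∑ s, ∑ j, (A s j)ᴴ * A s j = 1) ∧
      (∀ s j, A s j ∈ Submodule.span ℂ
        ((fun Q : pauliGroup k => ((Q : (Op k)ˣ) : Op k)) ''
          (Subgroup.closure (Set.range (P s)) : Set (pauliGroup k)))) ∧
      ∀ ψ : Bits k → ℂ, IsUnitVec ψ →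
        D.apply (E * proj (C.enc *ᵥ ψ) * Eᴴ) =
          ∑ s, ∑ j, (A s j * proj ψ * (A s j)ᴴ) ⊗ₖ (Matrix.single s s 1)

/-! ### Small-biased sets and the pseudorandom subcode -/

/-- A nonempty set `A` of bit strings is `η`-biased if for every nonzero string `e`, the
probabilities that a uniformly random element of `A` has even and odd parity with `e` differ by at
most `η`. -/
def IsBiased {ι : Type} [Fintype ι] (η : ℝ) (A : Finset (ι → ZMod 2)) : Prop :=
  A.Nonempty ∧ ∀ e : ι → ZMod 2, e ≠ 0 →
    |((A.filter fun a => e ⬝ᵥ a = 0).card : ℝ) / A.card -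
      ((A.filter fun a => e ⬝ᵥ a = 1).card : ℝ) / A.card| ≤ η

/-- The number `(2L + log (1/ε)) / log (4/3)` of extra generators, rounded up to an integer. -/
noncomputable def numGenerators (L : ℕ) (ε : ℝ) : ℕ :=
  ⌈(2 * L + Real.logb 2 (1 / ε)) / Real.logb 2 (4 / 3)⌉₊

/-- Sets `A 0, …, A (K-1)` of bit strings, the strings in `A j` having length `2 (k - j)`. -/
abbrev SetFamily (k K : ℕ) : Type :=
  (j : Fin K) → Finset (Fin (k - (j : ℕ)) ⊕ Fin (k - (j : ℕ)) → ZMod 2)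

/-- The keys: one element of each `A j`. The zero string is left out, since it describes the
identity, which is no new stabilizer generator. -/
abbrev KeyOf {k K : ℕ} (A : SetFamily k K) : Type := (j : Fin K) → {a // a ∈ (A j).erase 0}

/-- `C'` arises from `C` by adding the stabilizer generator `T`, which acts on the encoded qubits
of `C` as the Pauli operator described by `a`, up to a phase. -/
def AddsGenerator {n m m' : ℕ} (C : StabilizerCode n m) (a : Fin m ⊕ Fin m → ZMod 2)
    (C' : StabilizerCode n m') : Prop :=
  ∃ T ∈ pauliGroup n, (∃ t : ℕ, (T : Op n) * C.enc = Complex.I ^ t • (C.enc * pauliOf a)) ∧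
    C'.stab = Subgroup.closure ((C.stab : Set (Op n)ˣ) ∪ {T})

/-- A way of progressively adding `K` generators to `C`, determined by the sets `A j` and the key:
`code j κ` is the code after `j` steps. It depends on the first `j` entries of the key only, encodes
`k - j` qubits, and arises from the previous code by adding a generator that acts on its encoded
qubits as entry `j` of the key prescribes. -/
structure Subcodes {n k K : ℕ} (C : StabilizerCode n k) (A : SetFamily k K) where
  code : (j : ℕ) → j ≤ K → KeyOf A → StabilizerCode n (k - j)
  code_zero : ∀ κ, code 0 (Nat.zero_le K) κ = C
  code_congr : ∀ j (hj : j ≤ K) (κ κ' : KeyOf A), (∀ i : Fin K, (i : ℕ) < j → κ i = κ' i) →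
    code j hj κ = code j hj κ'
  step : ∀ (j : Fin K) (κ : KeyOf A),
    AddsGenerator (code j j.isLt.le κ) (κ j).1 (code (j + 1) j.isLt κ)

/-! Up to phase, Pauli operators are vectors over `ZMod 2` and commutation is a symplectic form, so
a random stabilizer generator is a random linear test on logical errors.

Decoding. For each adversarial Kraus operator, the syndrome-s block of the list decoder acts on the
encoded qubits by an operator in the span of at most 2^L Paulis, those generated by the list. This
passes from Pauli errors to their superpositions because Kraus families with the same action span
the same space (`mem_of_kraus_eq`, `kraus_block_mem`). A fixed nontrivial logical Pauli commutes
with a generator drawn from a biased set with probability at most 3/4, hence remains a nontrivial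
logical operator after K steps with probability at most (3/4)^K (`Subcodes.card_undetected_le`). If
none of the 2^L Paulis remains, products of block operators compress to scalars on the subcode, and
Knill–Laflamme (`exists_recovery`) undoes them. So for each syndrome a fraction at most 2^L (3/4)^K
of the keys is bad. The syndrome distribution depends on the key, but Cauchy–Schwarz
(`nsq_le_of_mem_span`) bounds it by 2^L times the distribution for the maximally mixed encoded state
of the original code, which does not. The total loss is at most 4^L (3/4)^K, and K is chosen to make
this at most ε.

Subcodes exist because every nonzero Pauli has an eigenspace encoding that realizes logical Paulis
by Paulis; it is obtained from that of Z on one qubit by rotations (1 + P)/√2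
(`IsEigenEncoding.transfer`).

Short keys come from the powering construction over a field of characteristic two: a parity is
biased only through the roots of a nonzero polynomial, so a field of size O(n/η) is enough
(`exists_isBiased`).

Good list codes come from averaging: a suitable generator leaves at most a fraction 2^(-L) of the
L-tuples of errors that act as independent logical operators
(`StabilizerCode.exists_addsGenerator_few`). After J generators none is left once 2^(LJ) exceeds the
number of (L+1)-tuples of low-weight errors. Errors with a common syndrome then differ from a
representative by logical operators in a space of dimension at most L, which is the list
(`isListCode_of_not_actsIndependently`). -/

/-! ### Algebra of Pauli operators -/

/-- Symplectic vectors describing Pauli operators on `m` qubits up to phase. -/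
abbrev PVec (m : ℕ) : Type := Fin m ⊕ Fin m → ZMod 2

theorem zmod_two_cases (a : ZMod 2) : a = 0 ∨ a = 1 := by
  revert a; decide

@[simp] theorem bitSign_zero : bitSign 0 = 1 := by simp [bitSign]

@[simp] theorem bitSign_one : bitSign 1 = -1 := by
  have hv : (1 : ZMod 2).val = 1 := rfl
  simp [bitSign, hv]

theorem bitSign_mul_self (a : ZMod 2) : bitSign a * bitSign a = 1 := by
  rcases zmod_two_cases a with rfl | rfl <;> simp

theorem bitSign_ne_zero (a : ZMod 2) : bitSign a ≠ 0 := by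
  rcases zmod_two_cases a with rfl | rfl <;> simp

theorem bitSign_injective : Function.Injective bitSign := by
  have h1 : (1 : ℂ) ≠ -1 := by norm_num
  intro a b h
  rcases zmod_two_cases a with rfl | rfl <;> rcases zmod_two_cases b with rfl | rfl <;>
    simp_all [eq_comm]

@[simp] theorem star_bitSign (a : ZMod 2) : star (bitSign a) = bitSign a := by
  rcases zmod_two_cases a with rfl | rfl <;> simp

theorem add_self_bits {ι : Type} (w : ι → ZMod 2) : w + w = 0 := by
  ext i
  exact CharTwo.add_self_eq_zero (w i)

theorem bits_eq_add_iff {ι : Type} (x y u : ι → ZMod 2) : y = x + u ↔ x = y + u := by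
  constructor <;> rintro rfl <;> rw [add_assoc, add_self_bits, add_zero]

/-- The symplectic form. -/
def symp {m : ℕ} (a b : PVec m) : ZMod 2 := (a ∘ Sum.swap) ⬝ᵥ b

theorem symp_eq {m : ℕ} (a b : PVec m) :
    symp a b = (fun i => a (Sum.inr i)) ⬝ᵥ (fun i => b (Sum.inl i)) +
      (fun i => a (Sum.inl i)) ⬝ᵥ (fun i => b (Sum.inr i)) := by
  simp [symp, dotProduct, Fintype.sum_sum_type]

theorem symp_comm {m : ℕ} (a b : PVec m) : symp a b = symp b a := by
  rw [symp_eq, symp_eq, add_comm, dotProduct_comm, dotProduct_comm (fun i => a (Sum.inr i))]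

theorem symp_add_right {m : ℕ} (a b c : PVec m) : symp a (b + c) = symp a b + symp a c := by
  simp [symp, dotProduct_add]

theorem symp_add_left {m : ℕ} (a b c : PVec m) : symp (a + b) c = symp a c + symp b c := by
  rw [symp_comm, symp_add_right, symp_comm c, symp_comm c]

/-- Nondegeneracy of the form: the unit vector at the swapped index reads off a nonzero coordinate.
-/
theorem exists_symp_eq_one {m : ℕ} {a : PVec m} (ha : a ≠ 0) : ∃ b, symp a b = 1 := by
  obtain ⟨i, hi⟩ := Function.ne_iff.1 ha
  refine ⟨Pi.single i.swap 1, ?_⟩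
  rw [symp, dotProduct_single_one, Function.comp_apply, Sum.swap_swap]
  exact (zmod_two_cases _).resolve_left hi

theorem pauliOf_mul {m : ℕ} (a b : PVec m) :
    pauliOf a * pauliOf b =
      bitSign ((fun i => a (Sum.inr i)) ⬝ᵥ (fun i => b (Sum.inl i))) • pauliOf (a + b) := by
  rw [pauliOf, pauliOf, pauliXZ_mul]; rfl

@[simp] theorem pauliOf_zero {m : ℕ} : pauliOf (0 : PVec m) = 1 := pauliXZ_zero

theorem pauliOf_comm {m : ℕ} (a b : PVec m) :
    pauliOf a * pauliOf b = bitSign (symp a b) • (pauliOf b * pauliOf a) := by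
  rw [pauliOf_mul, pauliOf_mul, smul_smul, symp_eq, bitSign_add, mul_assoc,
    dotProduct_comm (fun i => b (Sum.inr i)), bitSign_mul_self, mul_one, add_comm]

theorem pauliOf_conjTranspose {m : ℕ} (a : PVec m) :
    (pauliOf a)ᴴ =
      bitSign ((fun i => a (Sum.inr i)) ⬝ᵥ (fun i => a (Sum.inl i))) • pauliOf a := by
  ext y x
  simp only [pauliOf, pauliXZ, Matrix.conjTranspose_apply, Matrix.of_apply, Matrix.smul_apply,
    smul_eq_mul]
  by_cases h : y = x + fun i => a (Sum.inl i)
  · rw [if_pos h, if_pos ((bits_eq_add_iff _ _ _).1 h), star_bitSign, h, dotProduct_add,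
      bitSign_add, mul_comm]
  · rw [if_neg h, if_neg (fun h' => h ((bits_eq_add_iff _ _ _).1 h'))]
    simp

theorem pauliOf_mul_self {m : ℕ} (a : PVec m) :
    pauliOf a * pauliOf a =
      bitSign ((fun i => a (Sum.inr i)) ⬝ᵥ (fun i => a (Sum.inl i))) • 1 := by
  rw [pauliOf_mul, add_self_bits, pauliOf_zero]

theorem pauliOf_conjTranspose_mul {m : ℕ} (a : PVec m) : (pauliOf a)ᴴ * pauliOf a = 1 := by
  rw [pauliOf_conjTranspose, Matrix.smul_mul, pauliOf_mul_self, smul_smul, bitSign_mul_self,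
    one_smul]

theorem pauliOf_mul_conjTranspose {m : ℕ} (a : PVec m) : pauliOf a * (pauliOf a)ᴴ = 1 :=
  mul_eq_one_comm.1 (pauliOf_conjTranspose_mul a)

theorem pauliOf_conjTranspose_mul_pauliOf {m : ℕ} (a b : PVec m) :
    ∃ z : ZMod 2, (pauliOf a)ᴴ * pauliOf b = bitSign z • pauliOf (a + b) := by
  simp only [pauliOf_conjTranspose, Matrix.smul_mul, pauliOf_mul, smul_smul, ← bitSign_add]
  exact ⟨_, rfl⟩

/-- Translation by `g` flips every sign, so the sum equals its own negative. -/
theorem sum_bitSign_eq_zero {G : Type*} [AddGroup G] [Fintype G] (φ : G → ZMod 2)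
    (hφ : ∀ x y, φ (x + y) = φ x + φ y) {g : G} (hg : φ g = 1) : ∑ x, bitSign (φ x) = 0 := by
  have h : ∑ x, bitSign (φ x) = ∑ x, bitSign (φ (x + g)) :=
    (Equiv.sum_comp (Equiv.addRight g) fun x => bitSign (φ x)).symm
  simp only [hφ, hg, bitSign_add, bitSign_one, mul_neg, mul_one, Finset.sum_neg_distrib] at h
  have h2 : (2 : ℂ) * ∑ x, bitSign (φ x) = 0 := by linear_combination h
  simpa using h2

/-- A nonzero X-part moves every basis vector and leaves an empty diagonal; otherwise the diagonal
is a nontrivial character, with sum zero. This makes the Paulis orthogonal for the trace form. -/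
theorem trace_pauliOf {m : ℕ} (a : PVec m) :
    (pauliOf a).trace = if a = 0 then (2 : ℂ) ^ m else 0 := by
  split_ifs with h
  · subst h
    simp
  · simp only [Matrix.trace, Matrix.diag, pauliOf, pauliXZ, Matrix.of_apply]
    by_cases hu : (fun i => a (Sum.inl i)) = 0
    · obtain ⟨i, hi⟩ : ∃ i, a (Sum.inr i) ≠ 0 := by
        by_contra hv
        push Not at hv
        apply h
        ext (i | i)
        · exact congrFun hu i
        · exact hv i
      simp only [hu, add_zero, if_true]
      refine sum_bitSign_eq_zero (fun x : Bits m => (fun i => a (Sum.inr i)) ⬝ᵥ x)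
        (fun x y => dotProduct_add _ _ _) (g := Pi.single i 1) ?_
      rw [dotProduct_single_one]
      exact (zmod_two_cases _).resolve_left hi
    · exact Finset.sum_eq_zero fun x _ => if_neg fun hx => hu (by simpa using hx)

theorem trace_pauliOf_conjTranspose_mul {m : ℕ} (a b : PVec m) :
    ((pauliOf a)ᴴ * pauliOf b).trace = if a = b then (2 : ℂ) ^ m else 0 := by
  split_ifs with h
  · subst h
    simp [pauliOf_conjTranspose_mul]
  · obtain ⟨z, hz⟩ := pauliOf_conjTranspose_mul_pauliOf a b
    rw [hz, Matrix.trace_smul, trace_pauliOf, if_neg, smul_zero]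
    intro h0
    apply h
    calc a = a + (b + b) := by rw [add_self_bits, add_zero]
      _ = b := by rw [← add_assoc, h0, zero_add]

theorem eq_of_pauliOf_eq_smul {m : ℕ} {a b : PVec m} {c : ℂ} (h : pauliOf a = c • pauliOf b) :
    a = b := by
  by_contra hab
  have h1 := trace_pauliOf_conjTranspose_mul a a
  nth_rewrite 2 [h] at h1
  rw [Matrix.mul_smul, Matrix.trace_smul, trace_pauliOf_conjTranspose_mul, if_neg hab,
    if_pos rfl, smul_zero] at h1
  exact pow_ne_zero m two_ne_zero h1.symm

theorem pauliOf_ne_zero {m : ℕ} (a : PVec m) : pauliOf a ≠ 0 := fun h => by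
  have := pauliOf_conjTranspose_mul a
  rw [h, Matrix.mul_zero] at this
  exact zero_ne_one this

/-- The Pauli operator `i^t X^u Z^v` as a unit. -/
noncomputable def pauliUnit {n : ℕ} (t : ℕ) (e : PVec n) : (Op n)ˣ :=
  have h : Complex.I ^ t • pauliOf e * (Complex.I ^ t • pauliOf e)ᴴ = 1 := by
    rw [Matrix.conjTranspose_smul, Matrix.smul_mul, Matrix.mul_smul, pauliOf_mul_conjTranspose,
      smul_smul, star_pow, ← mul_pow]
    simp
  ⟨Complex.I ^ t • pauliOf e, (Complex.I ^ t • pauliOf e)ᴴ, h, mul_eq_one_comm.1 h⟩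

@[simp] theorem val_pauliUnit {n : ℕ} (t : ℕ) (e : PVec n) :
    (pauliUnit t e : Op n) = Complex.I ^ t • pauliOf e := rfl

theorem pauliUnit_mem {n : ℕ} (t : ℕ) (e : PVec n) : pauliUnit t e ∈ pauliGroup n :=
  ⟨t, _, _, rfl⟩

theorem mem_pauliGroup_iff {n : ℕ} {P : (Op n)ˣ} :
    P ∈ pauliGroup n ↔ ∃ (t : ℕ) (e : PVec n), (P : Op n) = Complex.I ^ t • pauliOf e := by
  constructor
  · rintro ⟨t, u, v, h⟩
    exact ⟨t, Sum.elim u v, h⟩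
  · rintro ⟨t, e, h⟩
    exact ⟨t, _, _, h⟩

theorem pauliGroup_conjTranspose_mul {n : ℕ} {P : (Op n)ˣ} (h : P ∈ pauliGroup n) :
    (P : Op n)ᴴ * (P : Op n) = 1 := by
  obtain ⟨t, e, he⟩ := mem_pauliGroup_iff.1 h
  rw [show P = pauliUnit t e from Units.ext he]
  exact (pauliUnit t e).inv_mul

theorem pauliXZ_mul_apply {n : ℕ} {β : Type} (u v : Bits n) (M : Matrix (Bits n) β ℂ) (y : Bits n)
    (x : β) : (pauliXZ u v * M) y x = bitSign (v ⬝ᵥ (y + u)) * M (y + u) x := by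
  rw [Matrix.mul_apply, Finset.sum_eq_single (y + u)]
  · simp [pauliXZ, add_assoc, add_self_bits]
  · intro b _ hb
    rw [pauliXZ, Matrix.of_apply, if_neg fun hy => hb ((bits_eq_add_iff _ _ _).1 hy), zero_mul]
  · simp

theorem mul_pauliXZ_apply {n : ℕ} {β : Type} (u v : Bits n) (M : Matrix β (Bits n) ℂ) (y : β)
    (x : Bits n) : (M * pauliXZ u v) y x = M y (x + u) * bitSign (v ⬝ᵥ x) := by
  rw [Matrix.mul_apply, Finset.sum_eq_single (x + u)]
  · simp [pauliXZ]
  · intro b _ hb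
    rw [pauliXZ, Matrix.of_apply, if_neg hb, mul_zero]
  · simp

/-- Commuting with the Z-type operators makes `M` diagonal, and the X-type operators make the
diagonal constant. -/
theorem eq_smul_one_of_commute_pauliOf {m : ℕ} {M : Op m}
    (h : ∀ a : PVec m, pauliOf a * M = M * pauliOf a) : ∃ c : ℂ, M = c • 1 := by
  have h' : ∀ u v : Bits m, pauliXZ u v * M = M * pauliXZ u v := fun u v => h (Sum.elim u v)
  have hX : ∀ w y x : Bits m, M (y + w) x = M y (x + w) := by
    intro w y x
    have := congrFun (congrFun (h' w 0) y) x
    simpa [pauliXZ_mul_apply, mul_pauliXZ_apply] using this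
  have hZ : ∀ (v y x : Bits m), bitSign (v ⬝ᵥ y) * M y x = M y x * bitSign (v ⬝ᵥ x) := by
    intro v y x
    have := congrFun (congrFun (h' 0 v) y) x
    simpa only [pauliXZ_mul_apply, mul_pauliXZ_apply, add_zero] using this
  refine ⟨M 0 0, ?_⟩
  ext y x
  rw [Matrix.smul_apply, Matrix.one_apply]
  split_ifs with hyx
  · subst hyx
    have := hX y y 0
    rw [add_self_bits, zero_add] at this
    simp [this]
  · obtain ⟨i, hi⟩ := Function.ne_iff.1 hyx
    have := hZ (Pi.single i 1) y x
    rw [single_one_dotProduct, single_one_dotProduct, mul_comm] at this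
    by_contra hM
    rw [smul_zero] at hM
    exact hi (bitSign_injective (mul_left_cancel₀ hM this))

theorem exists_symp_eq_of_additive {m : ℕ} (s : PVec m → ZMod 2)
    (hs : ∀ a b, s (a + b) = s a + s b) : ∃ b, ∀ a, s a = symp a b := by
  let f : PVec m →+ ZMod 2 := AddMonoidHom.mk' s hs
  refine ⟨fun i => s (Pi.single i.swap 1), fun a => ?_⟩
  have h := LinearMap.pi_apply_eq_sum_univ (f.toZModLinearMap 2) a
  change s a = _ at h
  rw [h, symp_comm, symp]
  simp only [dotProduct, Function.comp_apply, Sum.swap_swap, smul_eq_mul]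
  refine Finset.sum_congr rfl fun i _ => ?_
  rw [mul_comm]
  congr 1
  change s _ = s _
  congr 1
  ext j
  simp [Pi.single_apply, eq_comm]

/-- An operator commuting up to signs with all Pauli operators is a multiple of one. -/
theorem eq_smul_pauliOf_of_commute {m : ℕ} {M : Op m} (s : PVec m → ZMod 2)
    (h : ∀ a : PVec m, pauliOf a * M = bitSign (s a) • (M * pauliOf a)) :
    ∃ (c : ℂ) (b : PVec m), M = c • pauliOf b := by
  by_cases hM : M = 0
  · exact ⟨0, 0, by simp [hM]⟩
  -- `pauliOf a * pauliOf b` can be moved past `M` one factor at a time or as a single Pauli; since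
  -- `M ≠ 0`, the two signs agree.
  have hs : ∀ a b, s (a + b) = s a + s b := by
    intro a b
    have hne : M * (pauliOf a * pauliOf b) ≠ 0 := by
      intro h0
      apply hM
      have := congrArg (fun X => X * (pauliOf b)ᴴ * (pauliOf a)ᴴ) h0
      simpa [Matrix.mul_assoc, pauliOf_mul_conjTranspose, ← Matrix.mul_assoc (pauliOf b)] using this
    have h1 : pauliOf a * pauliOf b * M = bitSign (s a + s b) • (M * (pauliOf a * pauliOf b)) := by
      rw [Matrix.mul_assoc, h b, Matrix.mul_smul, ← Matrix.mul_assoc, h a, Matrix.smul_mul,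
        smul_smul, bitSign_add, mul_comm, Matrix.mul_assoc]
    have h2 : pauliOf a * pauliOf b * M = bitSign (s (a + b)) • (M * (pauliOf a * pauliOf b)) := by
      rw [pauliOf_mul, Matrix.smul_mul, h (a + b), Matrix.mul_smul, smul_comm]
    exact bitSign_injective (smul_left_injective ℂ hne (h2.symm.trans h1))
  -- The signs are those of a Pauli `b`; dividing it out leaves an operator that commutes exactly
  -- with every Pauli.
  obtain ⟨b, hb⟩ := exists_symp_eq_of_additive s hs
  obtain ⟨c, hc⟩ := eq_smul_one_of_commute_pauliOf (M := (pauliOf b)ᴴ * M) (by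
    intro a
    have : pauliOf a * (pauliOf b)ᴴ = bitSign (symp a b) • ((pauliOf b)ᴴ * pauliOf a) := by
      rw [pauliOf_conjTranspose, Matrix.mul_smul, Matrix.smul_mul, pauliOf_comm a b, smul_comm]
    rw [← Matrix.mul_assoc, this, Matrix.smul_mul, Matrix.mul_assoc, h a, hb, Matrix.mul_smul,
      smul_smul, bitSign_mul_self, one_smul, Matrix.mul_assoc])
  refine ⟨c, b, ?_⟩
  calc M = pauliOf b * ((pauliOf b)ᴴ * M) := by
        rw [← Matrix.mul_assoc, pauliOf_mul_conjTranspose, Matrix.one_mul]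
    _ = c • pauliOf b := by rw [hc, Matrix.mul_smul, Matrix.mul_one]

/-! ### Logical action of physical Pauli operators -/

namespace StabilizerCode

variable {n m m' : ℕ} (C : StabilizerCode n m)

theorem stab_mul_enc {P : (Op n)ˣ} (hP : P ∈ C.stab) : (P : Op n) * C.enc = C.enc := by
  ext i j
  have h := (C.range_enc (C.enc *ᵥ Pi.single j 1)).1 ⟨_, rfl⟩ P hP
  rw [Matrix.mulVec_mulVec, Matrix.mulVec_single_one, Matrix.mulVec_single_one] at h
  exact congrFun h i

/-- Each column of `X` lies in the code space, on which `enc * encᴴ` is the identity. -/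
theorem enc_mul_of_fixed {β : Type} {X : Matrix (Bits n) β ℂ}
    (h : ∀ P ∈ C.stab, (P : Op n) * X = X) : C.enc * (C.encᴴ * X) = X := by
  ext i j
  obtain ⟨ψ, hψ⟩ := (C.range_enc fun i => X i j).2 fun P hP => by
    ext i
    exact congrFun (congrFun (h P hP) i) j
  have : (C.enc * (C.encᴴ * X)) i j = (C.enc *ᵥ (C.encᴴ *ᵥ fun i => X i j)) i := rfl
  rw [this, ← hψ, Matrix.mulVec_mulVec (M := C.encᴴ), C.enc_isometry, Matrix.one_mulVec, hψ]

theorem enc_ne_zero : C.enc ≠ 0 := fun h => by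
  have := C.enc_isometry
  rw [h, Matrix.mul_zero] at this
  exact zero_ne_one this

theorem enc_mul_cancel {β : Type} {X Y : Matrix (Bits m) β ℂ} (h : C.enc * X = C.enc * Y) :
    X = Y := by
  have := congrArg (fun Z => C.encᴴ * Z) h
  simpa [← Matrix.mul_assoc, C.enc_isometry] using this

/-- The physical Pauli operator described by `e` preserves the code, on which it acts up to a scalar
as the logical Pauli operator described by `b`. -/
def Acts (e : PVec n) (b : PVec m) : Prop := ∃ c : ℂ, pauliOf e * C.enc = c • (C.enc * pauliOf b)

variable {C}

theorem Acts.isometry {e : PVec n} {b : PVec m} {c : ℂ}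
    (h : pauliOf e * C.enc = c • (C.enc * pauliOf b)) : star c * c = 1 := by
  have h1 : (pauliOf e * C.enc)ᴴ * (pauliOf e * C.enc) = 1 := by
    rw [Matrix.conjTranspose_mul, Matrix.mul_assoc, ← Matrix.mul_assoc _ (pauliOf e),
      pauliOf_conjTranspose_mul, Matrix.one_mul, C.enc_isometry]
  rw [h, Matrix.conjTranspose_smul, Matrix.conjTranspose_mul, Matrix.smul_mul, Matrix.mul_smul,
    Matrix.mul_assoc, ← Matrix.mul_assoc _ C.enc, C.enc_isometry, Matrix.one_mul,
    pauliOf_conjTranspose_mul, smul_smul] at h1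
  simpa using congrFun (congrFun h1 0) 0

theorem Acts.zero : C.Acts 0 0 := ⟨1, by simp⟩

theorem Acts.add {e e' : PVec n} {b b' : PVec m} (h : C.Acts e b) (h' : C.Acts e' b') :
    C.Acts (e + e') (b + b') := by
  obtain ⟨c, h⟩ := h
  obtain ⟨c', h'⟩ := h'
  have h1 : pauliOf e * pauliOf e' * C.enc = (c' * c) • (C.enc * (pauliOf b * pauliOf b')) := by
    rw [Matrix.mul_assoc, h', Matrix.mul_smul, ← Matrix.mul_assoc, h, Matrix.smul_mul, smul_smul,
      Matrix.mul_assoc]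
  rw [pauliOf_mul, pauliOf_mul, Matrix.smul_mul, Matrix.mul_smul] at h1
  refine ⟨(bitSign ((fun i => e (Sum.inr i)) ⬝ᵥ (fun i => e' (Sum.inl i))))⁻¹ *
    ((c' * c) * bitSign ((fun i => b (Sum.inr i)) ⬝ᵥ (fun i => b' (Sum.inl i)))), ?_⟩
  rw [← smul_smul, ← smul_smul (c' * c), ← h1, smul_smul, inv_mul_cancel₀ (bitSign_ne_zero _),
    one_smul]

theorem Acts.sum {ι : Type} (s : Finset ι) {e : ι → PVec n} {b : ι → PVec m}
    (h : ∀ i ∈ s, C.Acts (e i) (b i)) (g : ι → ZMod 2) :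
    C.Acts (∑ i ∈ s, g i • e i) (∑ i ∈ s, g i • b i) := by
  classical
  induction s using Finset.induction_on with
  | empty => simpa using Acts.zero
  | insert i s hi ih =>
    rw [Finset.sum_insert hi, Finset.sum_insert hi]
    refine Acts.add ?_ (ih fun j hj => h j (Finset.mem_insert_of_mem hj))
    rcases zmod_two_cases (g i) with h0 | h1
    · simpa [h0] using Acts.zero
    · simpa [h1] using h i (Finset.mem_insert_self _ _)

theorem Acts.unique {e : PVec n} {b b' : PVec m} (h : C.Acts e b) (h' : C.Acts e b') : b = b' := by
  obtain ⟨c, h⟩ := h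
  obtain ⟨c', h'⟩ := h'
  have hc : c ≠ 0 := by
    rintro rfl
    simpa using Acts.isometry h
  rw [h, ← Matrix.mul_smul, ← Matrix.mul_smul] at h'
  have h2 := C.enc_mul_cancel h'
  refine eq_of_pauliOf_eq_smul (c := c⁻¹ * c') ?_
  rw [← smul_smul, ← h2, smul_smul, inv_mul_cancel₀ hc, one_smul]

theorem exists_acts (C : StabilizerCode n m) (b : PVec m) : ∃ e, C.Acts e b := by
  obtain ⟨P, hP, h⟩ := C.enc_pauli b
  obtain ⟨t, e, he⟩ := mem_pauliGroup_iff.1 hP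
  refine ⟨e, (Complex.I ^ t)⁻¹, ?_⟩
  rw [← h, he, Matrix.smul_mul, smul_smul, inv_mul_cancel₀ (pow_ne_zero _ Complex.I_ne_zero),
    one_smul]

theorem mul_pauli_comm {P : (Op n)ˣ} (hP : P ∈ pauliGroup n) (e : PVec n) :
    ∃ z : ZMod 2, (P : Op n) * pauliOf e = bitSign z • (pauliOf e * (P : Op n)) := by
  obtain ⟨t, f, hf⟩ := mem_pauliGroup_iff.1 hP
  exact ⟨symp f e, by rw [hf, Matrix.smul_mul, Matrix.mul_smul, pauliOf_comm, smul_comm]⟩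

theorem conjTranspose_enc_mul_stab (C : StabilizerCode n m) {P : (Op n)ˣ} (hP : P ∈ C.stab) :
    C.encᴴ * (P : Op n) = C.encᴴ := by
  have h1 := congrArg Matrix.conjTranspose (C.stab_mul_enc hP)
  rw [Matrix.conjTranspose_mul] at h1
  nth_rewrite 1 [← h1]
  rw [Matrix.mul_assoc, pauliGroup_conjTranspose_mul (C.stab_le hP), Matrix.mul_one]

/-- A Pauli operator commutes with the stabilizer unless its compression to the code vanishes. -/
theorem commute_stab_of_compress_ne_zero {e : PVec n} (h : C.encᴴ * pauliOf e * C.enc ≠ 0)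
    {P : (Op n)ˣ} (hP : P ∈ C.stab) : (P : Op n) * pauliOf e = pauliOf e * (P : Op n) := by
  obtain ⟨z, hz⟩ := mul_pauli_comm (C.stab_le hP) e
  rcases zmod_two_cases z with rfl | rfl
  · simpa using hz
  · exfalso
    apply h
    have h1 : C.encᴴ * pauliOf e * C.enc = -(C.encᴴ * pauliOf e * C.enc) := by
      calc C.encᴴ * pauliOf e * C.enc = C.encᴴ * ((P : Op n) * pauliOf e) * C.enc := by
            rw [← Matrix.mul_assoc, C.conjTranspose_enc_mul_stab hP]
        _ = -(C.encᴴ * pauliOf e * C.enc) := by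
            rw [hz, bitSign_one, neg_smul, one_smul, Matrix.mul_neg, Matrix.neg_mul,
              ← Matrix.mul_assoc, Matrix.mul_assoc (C.encᴴ * pauliOf e), C.stab_mul_enc hP]
    ext i j
    have := congrFun (congrFun h1 i) j
    rw [Matrix.neg_apply] at this
    simpa using self_eq_neg.1 this

theorem mul_enc_of_commute {e : PVec n}
    (h : ∀ P ∈ C.stab, (P : Op n) * pauliOf e = pauliOf e * (P : Op n)) :
    C.enc * (C.encᴴ * pauliOf e * C.enc) = pauliOf e * C.enc := by
  rw [Matrix.mul_assoc]
  refine C.enc_mul_of_fixed fun P hP => ?_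
  rw [← Matrix.mul_assoc, h P hP, Matrix.mul_assoc, C.stab_mul_enc hP]

/-- Logical Paulis are realized by physical Paulis, which commute with `pauliOf e` up to sign. Hence
the compression commutes up to sign with every logical Pauli. -/
theorem compress_eq_smul (C : StabilizerCode n m) (e : PVec n) :
    ∃ (c : ℂ) (b : PVec m), C.encᴴ * pauliOf e * C.enc = c • pauliOf b := by
  have : ∀ a : PVec m, ∃ z : ZMod 2, pauliOf a * (C.encᴴ * pauliOf e * C.enc) =
      bitSign z • (C.encᴴ * pauliOf e * C.enc * pauliOf a) := by
    intro a
    obtain ⟨P, hP, h⟩ := C.enc_pauli a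
    obtain ⟨z, hz⟩ := mul_pauli_comm hP e
    have h1 : C.encᴴ * (P : Op n) = pauliOf a * C.encᴴ := by
      have h2 := congrArg Matrix.conjTranspose h
      rw [Matrix.conjTranspose_mul, Matrix.conjTranspose_mul] at h2
      have h3 := congrArg (fun X => pauliOf a * X * (P : Op n)) h2
      simp only [Matrix.mul_assoc, pauliGroup_conjTranspose_mul hP] at h3
      rwa [Matrix.mul_one, ← Matrix.mul_assoc (pauliOf a) (pauliOf a)ᴴ, pauliOf_mul_conjTranspose,
        Matrix.one_mul, eq_comm] at h3
    refine ⟨z, ?_⟩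
    rw [Matrix.mul_assoc, ← Matrix.mul_assoc (pauliOf a), ← h1, Matrix.mul_assoc C.encᴴ,
      ← Matrix.mul_assoc (P : Op n), hz, Matrix.smul_mul, Matrix.mul_smul, Matrix.mul_assoc,
      h, Matrix.mul_assoc, Matrix.mul_assoc]
  choose s hs using this
  exact eq_smul_pauliOf_of_commute s hs

theorem acts_of_compress_ne_zero {e : PVec n} (h : C.encᴴ * pauliOf e * C.enc ≠ 0) :
    ∃ b, C.Acts e b := by
  obtain ⟨c, b, hcb⟩ := C.compress_eq_smul e
  refine ⟨b, c, ?_⟩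
  rw [← mul_enc_of_commute fun P hP => commute_stab_of_compress_ne_zero h hP, hcb, Matrix.mul_smul]

theorem Acts.compress_ne_zero {e : PVec n} {b : PVec m} (h : C.Acts e b) :
    C.encᴴ * pauliOf e * C.enc ≠ 0 := by
  obtain ⟨c, h⟩ := h
  have hc : c ≠ 0 := by
    rintro rfl
    simpa using Acts.isometry h
  rw [Matrix.mul_assoc, h, Matrix.mul_smul, ← Matrix.mul_assoc, C.enc_isometry, Matrix.one_mul]
  exact smul_ne_zero hc (pauliOf_ne_zero b)

/-! ### Adding a generator -/

variable {C' : StabilizerCode n m'} {a : PVec m}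

theorem AddsGenerator.le (h : AddsGenerator C a C') : C.stab ≤ C'.stab := by
  obtain ⟨T, -, -, hS⟩ := h
  rw [hS]
  exact fun P hP => Subgroup.subset_closure (Or.inl hP)

/-- `C.encᴴ * C'.enc` embeds the logical qubits of the subcode into those of `C`. -/
theorem enc_mul_of_stab_le (h : C.stab ≤ C'.stab) : C.enc * (C.encᴴ * C'.enc) = C'.enc :=
  C.enc_mul_of_fixed fun _ hP => C'.stab_mul_enc (h hP)

theorem compress_of_stab_le (h : C.stab ≤ C'.stab) (M : Op n) :
    C'.encᴴ * M * C'.enc = (C.encᴴ * C'.enc)ᴴ * (C.encᴴ * M * C.enc) * (C.encᴴ * C'.enc) := by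
  nth_rewrite 1 2 [← enc_mul_of_stab_le h]
  rw [Matrix.conjTranspose_mul]
  simp only [Matrix.mul_assoc]

/-- An error that still acts on the subcode must commute with the new generator; seen on the encoded
qubits of `C`, this is orthogonality to `a`. In other words, a logical error anticommuting with the
generator is detected. -/
theorem Acts.of_addsGenerator (h : AddsGenerator C a C') {e : PVec n} {b' : PVec m'}
    (hb : C'.Acts e b') : ∃ b, C.Acts e b ∧ symp a b = 0 := by
  have hne := hb.compress_ne_zero
  have hle := AddsGenerator.le h
  obtain ⟨b, hb⟩ : ∃ b, C.Acts e b := by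
    refine acts_of_compress_ne_zero fun h0 => hne ?_
    rw [compress_of_stab_le hle, h0, Matrix.mul_zero, Matrix.zero_mul]
  refine ⟨b, hb, ?_⟩
  obtain ⟨T, hT, ⟨t, hTa⟩, hS⟩ := h
  have hcomm := commute_stab_of_compress_ne_zero hne
    (show T ∈ C'.stab from hS ▸ Subgroup.subset_closure (Or.inr rfl))
  obtain ⟨c, hc⟩ := hb
  have hc0 : c ≠ 0 := by
    rintro rfl
    simpa using Acts.isometry hc
  have h1 := congrArg (fun X => X * C.enc) hcomm
  simp only [Matrix.mul_assoc, hc, hTa, Matrix.mul_smul] at h1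
  rw [← Matrix.mul_assoc, ← Matrix.mul_assoc, hTa, hc, Matrix.smul_mul, Matrix.smul_mul,
    smul_comm, Matrix.mul_assoc, Matrix.mul_assoc, pauliOf_comm a b] at h1
  have h2 := smul_right_injective _ hc0 (smul_right_injective _
    (pow_ne_zero t Complex.I_ne_zero) h1)
  have h3 := C.enc_mul_cancel h2
  have h4 : pauliOf b * pauliOf a ≠ 0 := by
    rw [pauliOf_mul]
    exact smul_ne_zero (bitSign_ne_zero _) (pauliOf_ne_zero _)
  exact bitSign_injective (smul_left_injective ℂ h4 (by simpa using h3))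

theorem Acts.zero_of_stab_le (hle : C.stab ≤ C'.stab) {e : PVec n} (h : C.Acts e 0) :
    C'.Acts e 0 := by
  obtain ⟨c, h⟩ := h
  refine ⟨c, ?_⟩
  rw [← enc_mul_of_stab_le hle, ← Matrix.mul_assoc, h]
  simp

variable (C) in
/-- The Pauli operators in the family `e` act on the code as independent logical operators. -/
def ActsIndependently {ι : Type} (e : ι → PVec n) : Prop :=
  ∃ b : ι → PVec m, LinearIndependent (ZMod 2) b ∧ ∀ i, C.Acts (e i) (b i)

/-- A dependence among the actions on `C` is a product acting trivially on `C`, hence also on the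
subcode, where it contradicts independence. -/
theorem ActsIndependently.of_addsGenerator {ι : Type} [Fintype ι] (h : AddsGenerator C a C')
    {e : ι → PVec n} (he : C'.ActsIndependently e) :
    ∃ b : ι → PVec m, LinearIndependent (ZMod 2) b ∧ (∀ i, C.Acts (e i) (b i)) ∧
      ∀ i, symp a (b i) = 0 := by
  obtain ⟨b', hli, hb'⟩ := he
  choose b hb hab using fun i => (hb' i).of_addsGenerator h
  refine ⟨b, ?_, hb, hab⟩
  rw [Fintype.linearIndependent_iff] at hli ⊢
  intro g hg
  have h1 := Acts.sum Finset.univ (fun i _ => hb i) g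
  rw [hg] at h1
  exact hli g (Acts.unique (Acts.sum Finset.univ (fun i _ => hb' i) g)
    (h1.zero_of_stab_le (AddsGenerator.le h)))

end StabilizerCode

/-! ### Existence of subcodes -/

/-- `V` encodes `m` qubits into the `+1` eigenspace of `i^t P_a` in such a way that Pauli operators
are realized by Pauli operators. -/
structure IsEigenEncoding {m : ℕ} (a : PVec (m + 1)) (t : ℕ)
    (V : Matrix (Bits (m + 1)) (Bits m) ℂ) : Prop where
  isometry : Vᴴ * V = 1
  range : V * Vᴴ = (2⁻¹ : ℂ) • (1 + Complex.I ^ t • pauliOf a)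
  pauli : ∀ b : PVec m, ∃ (s : ℕ) (b' : PVec (m + 1)),
    Complex.I ^ s • pauliOf b' * V = V * pauliOf b

namespace IsEigenEncoding

variable {m : ℕ} {a g : PVec (m + 1)} {t : ℕ} {V : Matrix (Bits (m + 1)) (Bits m) ℂ}

theorem mul_eq (h : IsEigenEncoding a t V) : Complex.I ^ t • pauliOf a * V = V := by
  have h1 : (2 : ℂ) • (V * Vᴴ * V) = V + Complex.I ^ t • pauliOf a * V := by
    rw [h.range, Matrix.smul_mul, smul_smul, Matrix.add_mul, Matrix.one_mul]
    norm_num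
  rw [Matrix.mul_assoc, h.isometry, Matrix.mul_one, two_smul] at h1
  exact (add_left_cancel h1).symm

theorem mul_self (h : IsEigenEncoding a t V) :
    Complex.I ^ t • pauliOf a * (Complex.I ^ t • pauliOf a) = 1 := by
  have h1 : Complex.I ^ t • pauliOf a * (V * Vᴴ) = V * Vᴴ := by
    rw [← Matrix.mul_assoc, h.mul_eq]
  rw [h.range, Matrix.mul_smul, Matrix.mul_add, Matrix.mul_one] at h1
  have h2 := smul_right_injective _ (inv_ne_zero (two_ne_zero' ℂ)) h1
  exact add_left_cancel (h2.trans (add_comm _ _))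

/-- Prefixing a qubit in state 0 encodes into the +1 eigenspace of Z on that qubit. -/
theorem base : ∃ V, IsEigenEncoding (m := m) (Sum.elim 0 (Pi.single 0 1)) 0 V := by
  let V : Matrix (Bits (m + 1)) (Bits m) ℂ := Matrix.of fun y x => if y = Fin.cons 0 x then 1 else 0
  have hV : ∀ y x, V y x = if y = Fin.cons 0 x then 1 else 0 := fun _ _ => rfl
  have hinj : ∀ x y : Bits m, (Fin.cons 0 x : Bits (m + 1)) = Fin.cons 0 y ↔ x = y := fun x y =>
    ⟨fun h => by simpa using congrArg Fin.tail h, fun h => by rw [h]⟩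
  refine ⟨V, ?_, ?_, ?_⟩
  · ext y x
    rw [Matrix.mul_apply, Finset.sum_eq_single (Fin.cons 0 y)]
    · simp [hV, hinj, Matrix.one_apply, Matrix.conjTranspose_apply]
    · intro b _ hb
      rw [Matrix.conjTranspose_apply, hV, if_neg hb, star_zero, zero_mul]
    · simp
  · ext y x
    have hZ : (pauliOf (Sum.elim 0 (Pi.single 0 1)) : Op (m + 1)) y x =
        if y = x then bitSign (x 0) else 0 := by
      change (pauliXZ 0 (Pi.single 0 1) : Op (m + 1)) y x = _
      simp [pauliXZ]
    rw [Matrix.mul_apply, pow_zero, one_smul, Matrix.smul_apply, Matrix.add_apply, hZ,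
      Matrix.one_apply]
    obtain ⟨y0, z, rfl⟩ : ∃ (y0 : ZMod 2) (z : Bits m), y = Fin.cons y0 z :=
      ⟨_, _, (Fin.cons_self_tail y).symm⟩
    rcases zmod_two_cases y0 with rfl | rfl
    · rw [Finset.sum_eq_single z]
      · simp only [Matrix.conjTranspose_apply, hV, if_true, one_mul, eq_comm (a := x)]
        split_ifs with h
        · rw [← h]
          norm_num
        · simp
      · intro b _ hb
        rw [hV, if_neg fun h => hb ((hinj _ _).1 h).symm, zero_mul]
      · simp
    · rw [Finset.sum_eq_zero]
      · split_ifs with h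
        · rw [← h]
          simp
        · simp
      · intro b _
        rw [hV, if_neg fun h => ?_, zero_mul]
        exact one_ne_zero (congrFun h 0 : (1 : ZMod 2) = 0)
  · intro b
    obtain ⟨u, v, rfl⟩ : ∃ u v, b = Sum.elim u v :=
      ⟨_, _, (Sum.elim_comp_inl_inr b).symm⟩
    refine ⟨0, Sum.elim (Fin.cons 0 u) (Fin.cons 0 v), ?_⟩
    ext y x
    rw [pow_zero, one_smul]
    change (pauliXZ (Fin.cons 0 u) (Fin.cons 0 v) * V) y x = (V * pauliXZ u v) y x
    rw [pauliXZ_mul_apply, mul_pauliXZ_apply, hV, hV]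
    have hc : (Fin.cons 0 (x + u) : Bits (m + 1)) = Fin.cons 0 x + Fin.cons 0 u := by
      ext i
      refine Fin.cases ?_ (fun i => ?_) i <;> simp
    by_cases h : y + Fin.cons 0 u = Fin.cons 0 x
    · rw [if_pos h, if_pos, h]
      · simp [dotProduct, Fin.sum_univ_succ]
      · rw [hc, ← h, add_assoc, add_self_bits, add_zero]
    · rw [if_neg h, if_neg, mul_zero, zero_mul]
      rintro rfl
      rw [hc, add_assoc, add_self_bits, add_zero] at h
      exact h rfl

theorem exists_pow_smul_mul_self (a : PVec m) :
    ∃ t : ℕ, (Complex.I ^ t • pauliOf a) * (Complex.I ^ t • pauliOf a) = 1 := by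
  -- The square of `pauliOf a` is `I ^ (2 * z)`; the phase `I ^ z` contributes another `I ^ (2 *
  -- z)`, for a total exponent of `4 * z`.
  refine ⟨((fun i => a (Sum.inr i)) ⬝ᵥ (fun i => a (Sum.inl i))).val, ?_⟩
  rw [Matrix.smul_mul, Matrix.mul_smul, pauliOf_mul_self, bitSign_eq_I_pow, smul_smul, smul_smul,
    ← pow_add, ← pow_add]
  have h4 : ∀ z : ℕ, z + z + 2 * z = 4 * z := fun z => by ring
  rw [h4, pow_mul, Complex.I_pow_four, one_pow, one_smul]

theorem exists_pow_smul_eq_mul (s t : ℕ) (a b : PVec m) : ∃ r : ℕ,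
    Complex.I ^ r • pauliOf (a + b) =
      (Complex.I ^ s • pauliOf a) * (Complex.I ^ t • pauliOf b) := by
  refine ⟨s + t + 2 * ((fun i => a (Sum.inr i)) ⬝ᵥ (fun i => b (Sum.inl i))).val, ?_⟩
  rw [Matrix.smul_mul, Matrix.mul_smul, pauliOf_mul, bitSign_eq_I_pow, smul_smul, smul_smul,
    pow_add, pow_add, mul_assoc]

theorem smul_pauliOf_comm (c d : ℂ) (a b : PVec m) : (c • pauliOf a) * (d • pauliOf b) =
    bitSign (symp a b) • ((d • pauliOf b) * (c • pauliOf a)) := by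
  rw [Matrix.smul_mul, Matrix.mul_smul, pauliOf_comm, Matrix.smul_mul, Matrix.mul_smul,
    smul_comm d c, smul_comm d, smul_comm c]

section

variable {α β : Type} [Fintype α] [DecidableEq α] {G P : Matrix α α ℂ} {V : Matrix α β ℂ} {r : ℂ}

theorem conjTranspose_smul_one_add_mul (hP : Pᴴ = P) (hr : star r = r) :
    (r • ((1 + P) * V))ᴴ = r • (Vᴴ * (1 + P)) := by
  rw [Matrix.conjTranspose_smul, Matrix.conjTranspose_mul, Matrix.conjTranspose_add, hP,
    Matrix.conjTranspose_one, hr]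

theorem one_add_mul_one_add (hP2 : P * P = 1) : (1 + P) * (1 + P) = (2 : ℂ) • (1 + P) := by
  rw [Matrix.add_mul, Matrix.mul_add, Matrix.mul_add, hP2, Matrix.one_mul, Matrix.mul_one,
    Matrix.one_mul, two_smul]
  abel

/-- `G` fixes the range of `V` and anticommutes with `P`, so `Vᴴ * P * V = 0`; what remains of the
product is `Vᴴ * V`, because (1 + P)² = 2(1 + P). -/
theorem rotated_isometry [DecidableEq β] (hP : Pᴴ = P) (hr : star r = r) (hrr : r * r = 2⁻¹)
    (hP2 : P * P = 1)
    (hV : Vᴴ * V = 1) (hGP : G * P = -(P * G)) (hGV : G * V = V) (hVG : Vᴴ * G = Vᴴ) :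
    (r • ((1 + P) * V))ᴴ * (r • ((1 + P) * V)) = 1 := by
  have hVPV : Vᴴ * P * V = 0 := by
    have h1 : Vᴴ * P * V = -(Vᴴ * P * V) := by
      calc Vᴴ * P * V = Vᴴ * (G * P) * V := by rw [← Matrix.mul_assoc, hVG]
        _ = -(Vᴴ * P * V) := by
          rw [hGP, Matrix.mul_neg, Matrix.neg_mul, ← Matrix.mul_assoc, Matrix.mul_assoc (Vᴴ * P),
            hGV]
    ext i j
    have := congrFun (congrFun h1 i) j
    rw [Matrix.neg_apply] at this
    exact self_eq_neg.1 this
  rw [conjTranspose_smul_one_add_mul hP hr, Matrix.smul_mul, Matrix.mul_smul, smul_smul, hrr,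
    Matrix.mul_assoc, ← Matrix.mul_assoc (1 + P), one_add_mul_one_add hP2, Matrix.smul_mul,
    Matrix.mul_smul, smul_smul, inv_mul_cancel₀ two_ne_zero, one_smul, Matrix.add_mul,
    Matrix.one_mul, Matrix.mul_add, hV, ← Matrix.mul_assoc, hVPV, add_zero]

theorem rotated_range [Fintype β] (hP : Pᴴ = P) (hr : star r = r) (hrr : r * r = 2⁻¹)
    (hP2 : P * P = 1)
    (hV : V * Vᴴ = (2⁻¹ : ℂ) • (1 + G)) (hGP : G * P = -(P * G)) :
    (r • ((1 + P) * V)) * (r • ((1 + P) * V))ᴴ = (2⁻¹ : ℂ) • (1 + P) := by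
  have hGG : (1 + P) * G * (1 + P) = 0 := by
    rw [Matrix.mul_assoc, Matrix.mul_add, hGP, Matrix.mul_one, Matrix.mul_add, Matrix.add_mul,
      Matrix.mul_neg, Matrix.add_mul, ← Matrix.mul_assoc P P, hP2, Matrix.one_mul, Matrix.one_mul]
    abel
  have h : (1 + P) * ((2⁻¹ : ℂ) • (1 + G) * (1 + P)) = 1 + P := by
    rw [Matrix.smul_mul, Matrix.mul_smul, Matrix.add_mul 1 G, Matrix.mul_add (1 + P),
      Matrix.one_mul, ← Matrix.mul_assoc _ G, hGG, add_zero, one_add_mul_one_add hP2,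
      smul_smul, inv_mul_cancel₀ two_ne_zero, one_smul]
  rw [conjTranspose_smul_one_add_mul hP hr, Matrix.smul_mul, Matrix.mul_smul, smul_smul, hrr,
    Matrix.mul_assoc, ← Matrix.mul_assoc V, hV, h]

end

/-- For anticommuting `G` and `P`, the map (1 + P)/√2 carries the +1 eigenspace of `G` isometrically
onto that of `P`. It intertwines every operator commuting with `P`, so the physical Paulis have to
be chosen to do so. -/
theorem transfer (h : IsEigenEncoding g t V) (hga : symp g a = 1) :
    ∃ t' V', IsEigenEncoding a t' V' := by
  obtain ⟨t', hP2⟩ := exists_pow_smul_mul_self a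
  have hPU := pauliGroup_conjTranspose_mul (pauliUnit_mem t' a)
  have hGU := pauliGroup_conjTranspose_mul (pauliUnit_mem t g)
  rw [val_pauliUnit] at hPU hGU
  have hPH : (Complex.I ^ t' • pauliOf a)ᴴ = Complex.I ^ t' • pauliOf a := by
    rw [← Matrix.mul_one (Complex.I ^ t' • pauliOf a)ᴴ, ← hP2, ← Matrix.mul_assoc, hPU,
      Matrix.one_mul]
  have hGP := smul_pauliOf_comm (Complex.I ^ t) (Complex.I ^ t') g a
  rw [hga, bitSign_one, neg_smul, one_smul] at hGP
  have hVG : Vᴴ * (Complex.I ^ t • pauliOf g) = Vᴴ := by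
    have := congrArg Matrix.conjTranspose h.mul_eq
    rw [Matrix.conjTranspose_mul] at this
    nth_rewrite 1 [← this]
    rw [Matrix.mul_assoc, hGU, Matrix.mul_one]
  obtain ⟨r, hr⟩ : ∃ r : ℝ, (r : ℂ) * r = 2⁻¹ :=
    ⟨√(2⁻¹), by rw [← Complex.ofReal_mul, Real.mul_self_sqrt (by norm_num)]; simp⟩
  have hrr : star (r : ℂ) = r := Complex.conj_ofReal r
  refine ⟨t', (r : ℂ) • ((1 + Complex.I ^ t' • pauliOf a) * V),
    rotated_isometry hPH hrr hr hP2 h.isometry hGP h.mul_eq hVG,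
    rotated_range hPH hrr hr hP2 h.range hGP, fun b => ?_⟩
  obtain ⟨s, b', hb⟩ := h.pauli b
  have key : ∀ Q : Op (m + 1), Q * (Complex.I ^ t' • pauliOf a) = (Complex.I ^ t' • pauliOf a) * Q →
      Q * V = V * pauliOf b → Q * ((r : ℂ) • ((1 + Complex.I ^ t' • pauliOf a) * V)) =
        (r : ℂ) • ((1 + Complex.I ^ t' • pauliOf a) * V) * pauliOf b := by
    intro Q hQ hQV
    rw [Matrix.mul_smul, Matrix.smul_mul, ← Matrix.mul_assoc, Matrix.mul_add, hQ, Matrix.mul_one,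
      Matrix.mul_assoc _ V, ← hQV, ← Matrix.mul_assoc, Matrix.add_mul _ _ Q, Matrix.one_mul]
  rcases zmod_two_cases (symp b' a) with h0 | h1
  · refine ⟨s, b', key _ ?_ hb⟩
    rw [smul_pauliOf_comm, h0, bitSign_zero, one_smul]
  -- The representative anticommutes with `P`; multiplying by `G`, which is the identity on the
  -- range of `V`, repairs this without changing its logical action.
  · obtain ⟨s', hs'⟩ := exists_pow_smul_eq_mul t s g b'
    refine ⟨s', g + b', key _ ?_ ?_⟩
    · rw [smul_pauliOf_comm, symp_add_left, hga, h1, CharTwo.add_self_eq_zero, bitSign_zero,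
        one_smul]
    · rw [hs', Matrix.mul_assoc, hb, ← Matrix.mul_assoc, h.mul_eq]

/-- Two hyperplanes do not cover the space: if `x` serves only `a` and `y` only `g`, then `x + y`
serves both. -/
theorem exists_symp_eq_one_both (ha : a ≠ 0) (hg : g ≠ 0) : ∃ h, symp a h = 1 ∧ symp g h = 1 := by
  obtain ⟨x, hx⟩ := exists_symp_eq_one ha
  obtain ⟨y, hy⟩ := exists_symp_eq_one hg
  rcases zmod_two_cases (symp g x) with h1 | h1
  · rcases zmod_two_cases (symp a y) with h2 | h2
    · exact ⟨x + y, by simp [symp_add_right, hx, h2], by simp [symp_add_right, hy, h1]⟩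
    · exact ⟨y, h2, hy⟩
  · exact ⟨x, hx, h1⟩

theorem exists_of_ne_zero (ha : a ≠ 0) : ∃ t V, IsEigenEncoding a t V := by
  have hg : (Sum.elim 0 (Pi.single 0 1) : PVec (m + 1)) ≠ 0 := fun h => by
    simpa using congrFun h (Sum.inr 0)
  -- `a` may commute with the initial Z, so the rotation passes through an intermediate Pauli
  -- anticommuting with both.
  obtain ⟨h, hah, hgh⟩ := exists_symp_eq_one_both ha hg
  obtain ⟨V₀, hV₀⟩ := base (m := m)
  obtain ⟨t, V, hV⟩ := hV₀.transfer hgh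
  exact hV.transfer (by rwa [symp_comm])

end IsEigenEncoding

/-- The subgroup obtained by adding to `S` an involution commuting with it. -/
def adjoinInvolution {G : Type*} [Group G] (S : Subgroup G) (T : G) (hT : T * T = 1)
    (hc : ∀ P ∈ S, T * P = P * T) : Subgroup G where
  carrier := {x | x ∈ S ∨ T * x ∈ S}
  one_mem' := Or.inl S.one_mem
  mul_mem' := by
    rintro x y (hx | hx) (hy | hy)
    · exact Or.inl (S.mul_mem hx hy)
    · right
      rw [← mul_assoc, hc x hx, mul_assoc]
      exact S.mul_mem hx hy
    · right
      rw [← mul_assoc]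
      exact S.mul_mem hx hy
    · left
      have h : x * y = (T * x) * (T * y) := by
        have h1 : T * (T * x) = x := by rw [← mul_assoc, hT, one_mul]
        rw [← mul_assoc _ T, ← hc _ hx, h1]
      rw [h]
      exact S.mul_mem hx hy
  inv_mem' := by
    have hT' : T⁻¹ = T := inv_eq_of_mul_eq_one_right hT
    rintro x (hx | hx)
    · exact Or.inl (S.inv_mem hx)
    · right
      have h1 := S.inv_mem hx
      have h2 : T * x⁻¹ = T * (T * x)⁻¹ * T := by
        rw [mul_inv_rev, hT', mul_assoc, mul_assoc, hT, mul_one]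
      rw [h2, hc _ h1, mul_assoc, hT, mul_one]
      exact h1

theorem closure_union_singleton_eq {G : Type*} [Group G] (S : Subgroup G) (T : G) (hT : T * T = 1)
    (hc : ∀ P ∈ S, T * P = P * T) :
    Subgroup.closure ((S : Set G) ∪ {T}) = adjoinInvolution S T hT hc := by
  apply le_antisymm
  · rw [Subgroup.closure_le]
    rintro x (hx | rfl)
    · exact Or.inl hx
    · right
      rw [hT]
      exact S.one_mem
  · have hTm : T ∈ Subgroup.closure ((S : Set G) ∪ {T}) := Subgroup.subset_closure (Or.inr rfl)
    rintro x (hx | hx)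
    · exact Subgroup.subset_closure (Or.inl hx)
    · have h : x = T * (T * x) := by rw [← mul_assoc, hT, one_mul]
      rw [h]
      exact Subgroup.mul_mem _ hTm (Subgroup.subset_closure (Or.inl hx))

/-- The new subgroup is the disjoint union of `S` and its coset by `T`. -/
theorem card_adjoinInvolution {G : Type*} [Group G] (S : Subgroup G) [Finite S] (T : G)
    (hT : T * T = 1) (hc : ∀ P ∈ S, T * P = P * T) (hTS : T ∉ S) :
    Nat.card (adjoinInvolution S T hT hc) = 2 * Nat.card S := by
  have hset : (adjoinInvolution S T hT hc : Set G) = (S : Set G) ∪ (fun x => T * x) '' S := by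
    ext x
    constructor
    · rintro (hx | hx)
      · exact Or.inl hx
      · exact Or.inr ⟨T * x, hx, by simp [← mul_assoc, hT]⟩
    · rintro (hx | ⟨y, hy, rfl⟩)
      · exact Or.inl hx
      · right
        rw [← mul_assoc, hT, one_mul]
        exact hy
  have hfin : (S : Set G).Finite := Set.toFinite _
  have h1 : Nat.card (adjoinInvolution S T hT hc) = (adjoinInvolution S T hT hc : Set G).ncard :=
    rfl
  have h2 : Nat.card S = (S : Set G).ncard := rfl
  rw [h1, h2, hset, Set.ncard_union_eq _ hfin (hfin.image _),
    Set.ncard_image_of_injective _ (mul_right_injective T), two_mul]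
  rw [Set.disjoint_left]
  rintro x hx ⟨y, hy, rfl⟩
  apply hTS
  have h := S.mul_mem hx (S.inv_mem hy)
  rwa [mul_inv_cancel_right] at h

/-! ### Adding one generator to a stabilizer code -/

namespace StabilizerCode

variable {n m : ℕ}

/-- The trivial code. -/
noncomputable def trivialCode (n : ℕ) : StabilizerCode n n where
  le := le_rfl
  stab := ⊥
  stab_le := bot_le
  stab_comm := by
    intro P hP Q hQ
    rw [Subgroup.mem_bot.1 hP, Subgroup.mem_bot.1 hQ]
  card_stab := by simp
  enc := 1
  enc_isometry := by simp
  range_enc φ := by simp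
  enc_pauli a := ⟨pauliUnit 0 a, pauliUnit_mem 0 a, by simp⟩

/-- The new encoding is that of `C` after an eigenspace encoding for `a`. The generator is a
physical realization of `pauliOf a` whose phase is fixed by that eigenspace. -/
theorem exists_addsGenerator_succ (C : StabilizerCode n (m + 1)) {a : PVec (m + 1)} (ha : a ≠ 0) :
    ∃ C' : StabilizerCode n m, AddsGenerator C a C' := by
  obtain ⟨t, V, hV⟩ := IsEigenEncoding.exists_of_ne_zero ha
  obtain ⟨T₀, hT₀, hT₀a⟩ := C.enc_pauli a
  obtain ⟨t', e, he⟩ := mem_pauliGroup_iff.1 hT₀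
  have hTenc : (pauliUnit (t + t') e : Op n) * C.enc = C.enc * (Complex.I ^ t • pauliOf a) := by
    rw [val_pauliUnit, pow_add, ← smul_smul, ← he, Matrix.smul_mul, hT₀a, Matrix.mul_smul]
  generalize hT : pauliUnit (t + t') e = T at hTenc
  have hTp : T ∈ pauliGroup n := hT ▸ pauliUnit_mem _ _
  -- `T * T` is a scalar, and it is the identity on the nonzero space of code states.
  have hTT : T * T = 1 := by
    have h0 : ∃ c : ℂ, ((T * T : (Op n)ˣ) : Op n) = c • 1 := by
      simp only [Units.val_mul, ← hT, val_pauliUnit, Matrix.smul_mul, Matrix.mul_smul,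
        pauliOf_mul_self, smul_smul]
      exact ⟨_, rfl⟩
    obtain ⟨c, hc⟩ := h0
    have h1 : ((T * T : (Op n)ˣ) : Op n) * C.enc = C.enc := by
      rw [Units.val_mul, Matrix.mul_assoc, hTenc, ← Matrix.mul_assoc, hTenc, Matrix.mul_assoc,
        hV.mul_self, Matrix.mul_one]
    rw [hc, Matrix.smul_mul, Matrix.one_mul] at h1
    have hc1 : c = 1 := smul_left_injective ℂ C.enc_ne_zero (by simpa using h1)
    ext1
    rw [hc, hc1, one_smul, Units.val_one]
  have hTS : T ∉ C.stab := by
    intro hmem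
    have h1 := C.stab_mul_enc hmem
    rw [hTenc] at h1
    have h2 : Complex.I ^ t • pauliOf a = 1 := C.enc_mul_cancel (h1.trans (C.enc.mul_one).symm)
    apply ha
    refine (eq_of_pauliOf_eq_smul (b := a) (a := 0) (c := Complex.I ^ t) ?_).symm
    rw [h2, pauliOf_zero]
  have hcomm : ∀ P ∈ C.stab, T * P = P * T := by
    intro P hP
    have hne : C.encᴴ * pauliOf e * C.enc ≠ 0 := by
      have h1 : C.encᴴ * (T : Op n) * C.enc = Complex.I ^ t • pauliOf a := by
        rw [Matrix.mul_assoc, hTenc, ← Matrix.mul_assoc, C.enc_isometry, Matrix.one_mul]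
      intro h0
      rw [← hT, val_pauliUnit, Matrix.mul_smul, Matrix.smul_mul, h0, smul_zero] at h1
      exact smul_ne_zero (pow_ne_zero _ Complex.I_ne_zero) (pauliOf_ne_zero a) h1.symm
    ext1
    rw [Units.val_mul, Units.val_mul, ← hT, val_pauliUnit, Matrix.smul_mul, Matrix.mul_smul,
      commute_stab_of_compress_ne_zero hne hP]
  have hmn : m + 1 ≤ n := C.le
  have hfin : Finite C.stab :=
    Nat.finite_of_card_ne_zero (by rw [C.card_stab]; exact pow_ne_zero _ two_ne_zero)
  have hTV : (T : Op n) * (C.enc * V) = C.enc * V := by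
    rw [← Matrix.mul_assoc, hTenc, Matrix.mul_assoc, hV.mul_eq]
  have hTmul : ∀ x, T * (T * x) = x := fun x => by rw [← mul_assoc, hTT, one_mul]
  refine ⟨
    { le := by omega
      stab := adjoinInvolution C.stab T hTT hcomm
      stab_le := ?_
      stab_comm := ?_
      card_stab := ?_
      enc := C.enc * V
      enc_isometry := ?_
      range_enc := ?_
      enc_pauli := ?_ }, T, hTp, ⟨t, ?_⟩, (closure_union_singleton_eq _ _ hTT hcomm).symm⟩
  · rintro x (hx | hx)
    · exact C.stab_le hx
    · rw [← hTmul x]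
      exact Subgroup.mul_mem _ hTp (C.stab_le hx)
  · have hTc : ∀ x ∈ adjoinInvolution C.stab T hTT hcomm, T * x = x * T := by
      rintro x (hx | hx)
      · exact hcomm x hx
      · have := hcomm _ hx
        rw [mul_assoc] at this
        exact mul_left_cancel this
    have hS : ∀ x ∈ C.stab, ∀ y ∈ adjoinInvolution C.stab T hTT hcomm, x * y = y * x := by
      rintro x hx y (hy | hy)
      · exact C.stab_comm x hx y hy
      · have := C.stab_comm x hx _ hy
        rw [← mul_assoc, ← hcomm x hx, mul_assoc, mul_assoc] at this
        exact mul_left_cancel this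
    rintro x (hx | hx) y hy
    · exact hS x hx y hy
    · have := hS _ hx y hy
      rw [← mul_assoc, ← hTc y hy, mul_assoc, mul_assoc] at this
      exact mul_left_cancel this
  · rw [card_adjoinInvolution _ _ _ _ hTS, C.card_stab, ← pow_succ']
    congr 1
    omega
  · rw [Matrix.conjTranspose_mul, Matrix.mul_assoc, ← Matrix.mul_assoc C.encᴴ, C.enc_isometry,
      Matrix.one_mul, hV.isometry]
  · intro φ
    constructor
    · have hfix : ∀ P ∈ adjoinInvolution C.stab T hTT hcomm,
          (P : Op n) * (C.enc * V) = C.enc * V := by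
        rintro P (hP | hP)
        · rw [← Matrix.mul_assoc, C.stab_mul_enc hP]
        · rw [← hTmul P, Units.val_mul, Matrix.mul_assoc, ← Matrix.mul_assoc _ C.enc,
            C.stab_mul_enc hP, hTV]
      rintro ⟨ψ, rfl⟩ P hP
      rw [Matrix.mulVec_mulVec, hfix P hP]
    · intro h
      obtain ⟨ψ, rfl⟩ := (C.range_enc φ).2 fun P hP => h P (Or.inl hP)
      have h1 := h T (Or.inr (by rw [hTT]; exact C.stab.one_mem))
      rw [Matrix.mulVec_mulVec, hTenc] at h1
      have h2 : (Complex.I ^ t • pauliOf a) *ᵥ ψ = ψ := by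
        have := congrArg (fun x => C.encᴴ *ᵥ x) h1
        simpa only [Matrix.mulVec_mulVec, ← Matrix.mul_assoc, C.enc_isometry, Matrix.one_mul,
          Matrix.one_mulVec] using this
      refine ⟨Vᴴ *ᵥ ψ, ?_⟩
      rw [Matrix.mulVec_mulVec, Matrix.mul_assoc, hV.range, ← Matrix.mulVec_mulVec,
        Matrix.smul_mulVec, Matrix.add_mulVec, h2, Matrix.one_mulVec, ← two_smul ℂ, smul_smul,
        inv_mul_cancel₀ two_ne_zero, one_smul]
  · intro b
    obtain ⟨s, b', hb⟩ := hV.pauli b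
    obtain ⟨P, hP, hPb⟩ := C.enc_pauli b'
    refine ⟨pauliUnit s 0 * P, Subgroup.mul_mem _ (pauliUnit_mem _ _) hP, ?_⟩
    rw [Units.val_mul, val_pauliUnit, pauliOf_zero, Matrix.smul_mul, Matrix.one_mul,
      ← Matrix.mul_assoc, Matrix.smul_mul, hPb, ← Matrix.mul_smul, Matrix.mul_assoc, hb,
      Matrix.mul_assoc]
  · rw [hTenc, Matrix.mul_smul]

theorem exists_addsGenerator {m' : ℕ} (h : m = m' + 1) (C : StabilizerCode n m) {a : PVec m}
    (ha : a ≠ 0) : ∃ C' : StabilizerCode n m', AddsGenerator C a C' := by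
  subst h
  exact C.exists_addsGenerator_succ ha

end StabilizerCode

/-- The codes obtained by adding the generators prescribed by a key one by one. -/
noncomputable def subcodeSeq {n k K : ℕ} (C : StabilizerCode n k) (A : SetFamily k K) (hK : K ≤ k)
    (κ : KeyOf A) : (j : ℕ) → j ≤ K → StabilizerCode n (k - j)
  | 0, _ => C
  | j + 1, hj => (StabilizerCode.exists_addsGenerator (m' := k - (j + 1)) (by omega)
      (subcodeSeq C A hK κ j (Nat.le_of_succ_le hj)) (Finset.ne_of_mem_erase (κ ⟨j, hj⟩).2)).choose

theorem nonempty_subcodes {n k K : ℕ} (C : StabilizerCode n k) (A : SetFamily k K) (hK : K ≤ k) :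
    Nonempty (Subcodes C A) := by
  refine ⟨⟨fun j hj κ => subcodeSeq C A hK κ j hj, fun _ => rfl, ?_, fun j κ => ?_⟩⟩
  · intro j
    induction j with
    | zero => intros; rfl
    | succ j ih =>
      intro hj κ κ' h
      have h1 := ih (Nat.le_of_succ_le hj) κ κ' fun i hi => h i (Nat.lt_succ_of_lt hi)
      have h2 := h ⟨j, hj⟩ (Nat.lt_succ_self j)
      simp only [subcodeSeq]
      congr!
  · exact (StabilizerCode.exists_addsGenerator (m' := k - (j + 1)) (by omega)
      (subcodeSeq C A hK κ j j.isLt.le) (Finset.ne_of_mem_erase (κ ⟨j, j.isLt⟩).2)).choose_spec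

/-! ### Channels and fidelities -/

section Channels

variable {α β ι : Type} [Fintype α] [Fintype ι]

theorem exists_channel [DecidableEq α] [Fintype β] (A : ι → Matrix β α ℂ)
    (hA : ∑ i, (A i)ᴴ * A i = 1) :
    ∃ N : Channel α β, ∀ ρ, N.apply ρ = ∑ i, A i * ρ * (A i)ᴴ := by
  let e := Fintype.equivFin ι
  refine ⟨⟨Fintype.card ι, fun i => A (e.symm i), ?_⟩, fun ρ => ?_⟩
  · rw [← hA]
    exact Equiv.sum_comp e.symm fun i => (A i)ᴴ * A i
  · exact Equiv.sum_comp e.symm fun i => A i * ρ * (A i)ᴴ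

/-- Kraus operators whose sum of squares is a projector `Q` can be completed by operators vanishing
on the range of `Q`. -/
theorem exists_channel_of_projector [DecidableEq α] [Fintype β] [DecidableEq β] [Nonempty β]
    (A : ι → Matrix β α ℂ)
    {Q : Matrix α α ℂ} (hA : ∑ i, (A i)ᴴ * A i = Q) (hQ : Q * Q = Q) :
    ∃ (N : Channel α β) (B : α → Matrix β α ℂ),
      (∀ ρ, N.apply ρ = ∑ i, A i * ρ * (A i)ᴴ + ∑ x, B x * ρ * (B x)ᴴ) ∧
        ∀ x, ∃ Z : Matrix β α ℂ, B x = Z * (1 - Q) := by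
  obtain ⟨b⟩ := ‹Nonempty β›
  have hQH : Qᴴ = Q := by
    rw [← hA, Matrix.conjTranspose_sum]
    simp [Matrix.conjTranspose_mul]
  -- Whatever lies outside the range of `Q` is sent to an arbitrary basis state `b`.
  let B : α → Matrix β α ℂ := fun x => Matrix.single b x (1 : ℂ) * (1 - Q)
  have hB : ∑ x, (B x)ᴴ * B x = 1 - Q := by
    have h1 : ∀ x, (B x)ᴴ * B x = (1 - Q) * Matrix.single x x (1 : ℂ) * (1 - Q) := by
      intro x
      simp only [B, Matrix.conjTranspose_mul, Matrix.conjTranspose_sub, Matrix.conjTranspose_one,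
        hQH, Matrix.conjTranspose_single, star_one]
      rw [Matrix.mul_assoc, ← Matrix.mul_assoc (Matrix.single x b (1 : ℂ)),
        Matrix.single_mul_single_same, one_mul, Matrix.mul_assoc]
    have h2 : ∑ x : α, Matrix.single x x (1 : ℂ) = 1 := by
      ext i j
      simp [Matrix.sum_apply, Matrix.single_apply, Matrix.one_apply, ite_and]
    rw [Finset.sum_congr rfl fun x _ => h1 x, ← Finset.sum_mul, ← Finset.mul_sum, h2,
      Matrix.mul_one, Matrix.mul_sub, Matrix.sub_mul, Matrix.sub_mul, hQ]
    simp
  obtain ⟨N, hN⟩ := exists_channel (Sum.elim A B) (by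
    rw [Fintype.sum_sum_type]
    simp only [Sum.elim_inl, Sum.elim_inr]
    rw [hA, hB]
    abel)
  refine ⟨N, B, fun ρ => ?_, fun x => ⟨_, rfl⟩⟩
  rw [hN, Fintype.sum_sum_type]
  simp

theorem mul_proj_mul (M : Matrix β α ℂ) (ψ : α → ℂ) : M * proj ψ * Mᴴ = proj (M *ᵥ ψ) := by
  rw [proj, proj, Matrix.mul_vecMulVec, Matrix.vecMulVec_mul, Matrix.star_mulVec]

theorem pureFidelity_proj (ψ φ : α → ℂ) :
    pureFidelity ψ (proj φ) = Complex.normSq (star ψ ⬝ᵥ φ) := by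
  rw [pureFidelity, proj, Matrix.vecMulVec_mulVec, op_smul_eq_smul, dotProduct_smul, smul_eq_mul,
    Matrix.star_dotProduct, Complex.star_def, ← Complex.normSq_eq_conj_mul_self, Complex.ofReal_re]

theorem pureFidelity_sum (ψ : α → ℂ) (ρ : ι → Matrix α α ℂ) :
    pureFidelity ψ (∑ i, ρ i) = ∑ i, pureFidelity ψ (ρ i) := by
  simp [pureFidelity, Matrix.sum_mulVec, dotProduct_sum]

theorem pureFidelity_smul (ψ : α → ℂ) (r : ℝ) (ρ : Matrix α α ℂ) :
    pureFidelity ψ ((r : ℂ) • ρ) = r * pureFidelity ψ ρ := by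
  simp [pureFidelity, Matrix.smul_mulVec]

/-- The squared norm. -/
noncomputable def nsq (v : α → ℂ) : ℝ := (star v ⬝ᵥ v).re

theorem nsq_eq_sum (v : α → ℂ) : nsq v = ∑ i, Complex.normSq (v i) := by
  simp [nsq, dotProduct, Complex.normSq_apply]

theorem nsq_nonneg (v : α → ℂ) : 0 ≤ nsq v := by
  rw [nsq_eq_sum]
  exact Finset.sum_nonneg fun i _ => Complex.normSq_nonneg _

theorem IsUnitVec.nsq_eq_one {v : α → ℂ} (h : IsUnitVec v) : nsq v = 1 := by
  rw [nsq, h, Complex.one_re]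

theorem nsq_mulVec [Fintype β] (M : Matrix β α ℂ) (v : α → ℂ) :
    nsq (M *ᵥ v) = (star v ⬝ᵥ ((Mᴴ * M) *ᵥ v)).re := by
  rw [nsq, Matrix.star_mulVec, ← Matrix.dotProduct_mulVec, Matrix.mulVec_mulVec]

theorem sum_nsq_mulVec [DecidableEq α] [Fintype β] {A : ι → Matrix β α ℂ}
    (hA : ∑ i, (A i)ᴴ * A i = 1) {v : α → ℂ}
    (hv : IsUnitVec v) : ∑ i, nsq (A i *ᵥ v) = 1 := by
  simp only [nsq_mulVec]
  rw [← Complex.re_sum, ← dotProduct_sum, ← Matrix.sum_mulVec, hA, Matrix.one_mulVec, hv,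
    Complex.one_re]

theorem IsUnitVec.mulVec [DecidableEq α] [Fintype β] {M : Matrix β α ℂ}
    (hM : Mᴴ * M = 1) {v : α → ℂ} (hv : IsUnitVec v) :
    IsUnitVec (M *ᵥ v) := by
  rw [IsUnitVec, Matrix.star_mulVec, ← Matrix.dotProduct_mulVec, Matrix.mulVec_mulVec, hM,
    Matrix.one_mulVec, hv]

open scoped ComplexOrder in
/-- The Knill–Laflamme theorem: a space of operators any two of which have scalar product
`Xᴴ Y ∈ ℂ 1` can be undone by one recovery operation. -/
theorem exists_recovery [DecidableEq α] [Fintype β] [DecidableEq β] [Nonempty β]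
    (U : Submodule ℂ (Matrix α β ℂ))
    (hU : ∀ X ∈ U, ∀ Y ∈ U, ∃ c : ℂ, Xᴴ * Y = c • 1) :
    ∃ R : Channel α β, ∀ X ∈ U, ∀ ψ : β → ℂ, IsUnitVec ψ →
      nsq (X *ᵥ ψ) ≤ ∑ i, Complex.normSq (star ψ ⬝ᵥ ((R.kraus i * X) *ᵥ ψ)) := by
  obtain ⟨b⟩ := ‹Nonempty β›
  -- As `Xᴴ * Y` is scalar, a single column determines it, so `F` is injective on `U`. An
  -- orthonormal basis of its range then lifts to operators `R i` with `(R i)ᴴ * R j` equal to 1 or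
  -- 0.
  let F : U →ₗ[ℂ] EuclideanSpace ℂ α :=
    { toFun := fun X => WithLp.toLp 2 fun i => X.1 i b
      map_add' := fun X Y => rfl
      map_smul' := fun c X => rfl }
  have hF : ∀ X Y : U, inner ℂ (F X) (F Y) = (X.1ᴴ * Y.1) b b := by
    intro X Y
    simp only [PiLp.inner_apply, Matrix.mul_apply, RCLike.inner_apply, Matrix.conjTranspose_apply]
    exact Finset.sum_congr rfl fun i _ => mul_comm _ _
  have hFs : ∀ X Y : U, X.1ᴴ * Y.1 = inner ℂ (F X) (F Y) • (1 : Matrix β β ℂ) := by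
    intro X Y
    obtain ⟨c, hc⟩ := hU X X.2 Y Y.2
    rw [hF, hc]
    simp
  have hinj : ∀ X : U, F X = 0 → X = 0 := by
    intro X hX
    have := hFs X X
    rw [hX, inner_zero_left, zero_smul, Matrix.conjTranspose_mul_self_eq_zero] at this
    exact Subtype.ext this
  let e := stdOrthonormalBasis ℂ (LinearMap.range F)
  choose R hR using fun i => LinearMap.mem_range.1 (e i).2
  have hRR : ∀ i j, (R i).1ᴴ * (R j).1 = if i = j then 1 else 0 := by
    intro i j
    rw [hFs, hR, hR, ← Submodule.coe_inner, e.inner_eq_ite]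
    split_ifs <;> simp
  have hexp : ∀ X : U, ∃ c : Fin (Module.finrank ℂ (LinearMap.range F)) → ℂ,
      X.1 = ∑ i, c i • (R i).1 := by
    intro X
    let x : LinearMap.range F := ⟨F X, LinearMap.mem_range_self F X⟩
    refine ⟨fun i => e.repr x i, ?_⟩
    have h1 : F (X - ∑ i, e.repr x i • R i) = 0 := by
      have h2 := congrArg Subtype.val (e.sum_repr x)
      simp only [Submodule.coe_sum, Submodule.coe_smul] at h2
      rw [map_sub, map_sum]
      simp only [map_smul, hR]
      rw [h2, sub_self]
    have h3 := congrArg Subtype.val (sub_eq_zero.1 (hinj _ h1))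
    simpa using h3
  let Q := ∑ i, (R i).1 * (R i).1ᴴ
  have hRQ : ∀ i, (R i).1ᴴ * Q = (R i).1ᴴ := by
    intro i
    rw [Matrix.mul_sum, Finset.sum_eq_single i]
    · rw [← Matrix.mul_assoc, hRR, if_pos rfl, Matrix.one_mul]
    · intro j _ hj
      rw [← Matrix.mul_assoc, hRR, if_neg hj.symm, Matrix.zero_mul]
    · simp
  have hQ : Q * Q = Q := by
    nth_rewrite 1 [show Q = ∑ i, (R i).1 * (R i).1ᴴ from rfl]
    simp only [Matrix.sum_mul, Matrix.mul_assoc, hRQ]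
    rfl
  -- The Kraus operator `(R i)ᴴ` turns `X` into the scalar `c i`; these scalars account for the
  -- whole squared norm of `X *ᵥ ψ`, and the completing operators can only add fidelity.
  obtain ⟨N, hN⟩ := exists_channel_of_projector (fun i => (R i).1ᴴ) (Q := Q) (by simp [Q]) hQ
  obtain ⟨B, hN, -⟩ := hN
  refine ⟨N, fun X hX ψ hψ => ?_⟩
  obtain ⟨c, hc⟩ := hexp ⟨X, hX⟩
  have hRX : ∀ i, (R i).1ᴴ * X = c i • 1 := by
    intro i
    change X = _ at hc
    rw [hc, Matrix.mul_sum, Finset.sum_eq_single i]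
    · rw [Matrix.mul_smul, hRR, if_pos rfl]
    · intro j _ hj
      rw [Matrix.mul_smul, hRR, if_neg hj.symm, smul_zero]
    · simp
  have hXX : Xᴴ * X = (∑ i, star (c i) * c i) • 1 := by
    nth_rewrite 1 [show X = _ from hc]
    rw [Matrix.conjTranspose_sum, Matrix.sum_mul, Finset.sum_smul]
    refine Finset.sum_congr rfl fun i _ => ?_
    rw [Matrix.conjTranspose_smul, Matrix.smul_mul, hRX, smul_smul]
  have hn : nsq (X *ᵥ ψ) = ∑ i, Complex.normSq (c i) := by
    rw [nsq_mulVec, hXX, Matrix.smul_mulVec, Matrix.one_mulVec, dotProduct_smul, hψ, smul_eq_mul,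
      mul_one, Complex.re_sum]
    refine Finset.sum_congr rfl fun i _ => ?_
    rw [Complex.star_def, ← Complex.normSq_eq_conj_mul_self, Complex.ofReal_re]
  have hfid : ∑ i, Complex.normSq (star ψ ⬝ᵥ ((N.kraus i * X) *ᵥ ψ)) =
      pureFidelity ψ (N.apply (proj (X *ᵥ ψ))) := by
    rw [Channel.apply, pureFidelity_sum]
    refine Finset.sum_congr rfl fun i _ => ?_
    rw [mul_proj_mul, pureFidelity_proj, Matrix.mulVec_mulVec]
  rw [hfid, hN, hn]
  have hadd : ∀ ρ σ : Matrix β β ℂ,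
      pureFidelity ψ (ρ + σ) = pureFidelity ψ ρ + pureFidelity ψ σ := by
    intro ρ σ
    simp [pureFidelity, Matrix.add_mulVec, dotProduct_add]
  rw [hadd, pureFidelity_sum, pureFidelity_sum]
  refine le_add_of_le_of_nonneg (le_of_eq (Finset.sum_congr rfl fun i _ => ?_))
    (Finset.sum_nonneg fun x _ => ?_)
  · rw [mul_proj_mul, pureFidelity_proj, Matrix.mulVec_mulVec, hRX, Matrix.smul_mulVec,
      Matrix.one_mulVec, dotProduct_smul, hψ, smul_eq_mul, mul_one]
  · rw [mul_proj_mul, pureFidelity_proj]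
    exact Complex.normSq_nonneg _

/-- Polarization, which extends an equality on pure states to all rank-one operators. -/
theorem four_smul_vecMulVec_star {α : Type} (a b : α → ℂ) : (4 : ℂ) • Matrix.vecMulVec a (star b) =
    proj (a + b) - proj (a - b) + Complex.I • proj (a + Complex.I • b) -
      Complex.I • proj (a - Complex.I • b) := by
  ext x y
  simp only [proj, Matrix.vecMulVec_apply, Matrix.smul_apply, Matrix.add_apply, Matrix.sub_apply,
    Pi.add_apply, Pi.sub_apply, Pi.star_apply, Pi.smul_apply, smul_eq_mul, star_add, star_sub,
    star_mul', Complex.star_def, Complex.conj_I]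
  linear_combination 
    (2 * a x * (starRingEnd ℂ) (b y) - 2 * b x * (starRingEnd ℂ) (a y)) * Complex.I_sq

/-- Two families of Kraus operators that agree on pure states span the same space. -/
theorem mem_of_kraus_eq [DecidableEq α] [Fintype β] [DecidableEq β] {κ : Type} [Fintype κ]
    (X : ι → Matrix β α ℂ) (A : κ → Matrix β α ℂ)
    (h : ∀ ψ : α → ℂ, IsUnitVec ψ → ∑ i, X i * proj ψ * (X i)ᴴ = ∑ j, A j * proj ψ * (A j)ᴴ)
    (U : Submodule ℂ (Matrix β α ℂ)) (hU : ∀ j, A j ∈ U) (i : ι) : X i ∈ U := by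
  have h1 : ∀ ψ : α → ℂ, ∑ i, X i * proj ψ * (X i)ᴴ = ∑ j, A j * proj ψ * (A j)ᴴ := by
    intro ψ
    by_cases h0 : nsq ψ = 0
    · have : ψ = 0 := by
        rw [nsq_eq_sum, Finset.sum_eq_zero_iff_of_nonneg fun i _ => Complex.normSq_nonneg _] at h0
        ext i
        simpa using h0 i (Finset.mem_univ i)
      subst this
      simp [proj]
    · have hpos : 0 < nsq ψ := lt_of_le_of_ne (nsq_nonneg ψ) (Ne.symm h0)
      have hre : star ψ ⬝ᵥ ψ = (nsq ψ : ℂ) := by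
        rw [nsq_eq_sum]
        simp [dotProduct, Complex.normSq_eq_conj_mul_self]
      obtain ⟨r, hr0, hr⟩ : ∃ r : ℝ, r ≠ 0 ∧ r * r = nsq ψ :=
        ⟨√(nsq ψ), (Real.sqrt_pos.2 hpos).ne', Real.mul_self_sqrt hpos.le⟩
      have hstar : star (r : ℂ)⁻¹ = (r : ℂ)⁻¹ := by
        rw [← Complex.ofReal_inv]
        exact Complex.conj_ofReal _
      have hr0' : (r : ℂ) ≠ 0 := Complex.ofReal_ne_zero.2 hr0
      have hu : IsUnitVec ((r : ℂ)⁻¹ • ψ) := by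
        rw [IsUnitVec, star_smul, smul_dotProduct, dotProduct_smul, hre, ← hr, hstar]
        push_cast
        simp only [smul_eq_mul]
        field_simp
      have h2 := h _ hu
      have hp : proj ((r : ℂ)⁻¹ • ψ) = ((r : ℂ)⁻¹ * (r : ℂ)⁻¹) • proj ψ := by
        rw [proj, star_smul, hstar, Matrix.smul_vecMulVec, Matrix.vecMulVec_smul, smul_smul, proj]
      simp only [hp, Matrix.mul_smul, Matrix.smul_mul, ← Finset.smul_sum] at h2
      exact smul_right_injective _ (mul_ne_zero (inv_ne_zero hr0') (inv_ne_zero hr0')) h2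
  have h2 : ∀ a b : α → ℂ, ∑ i, X i * Matrix.vecMulVec a (star b) * (X i)ᴴ =
      ∑ j, A j * Matrix.vecMulVec a (star b) * (A j)ᴴ := by
    intro a b
    refine smul_right_injective _ (r := (4 : ℂ)) (by norm_num) ?_
    dsimp only
    have h4 : ∀ (M : Matrix β α ℂ), (4 : ℂ) • (M * Matrix.vecMulVec a (star b) * Mᴴ) =
        M * proj (a + b) * Mᴴ - M * proj (a - b) * Mᴴ +
          Complex.I • (M * proj (a + Complex.I • b) * Mᴴ) -
            Complex.I • (M * proj (a - Complex.I • b) * Mᴴ) := by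
      intro M
      rw [← Matrix.smul_mul, ← Matrix.mul_smul, four_smul_vecMulVec_star]
      simp only [Matrix.mul_add, Matrix.mul_sub, Matrix.add_mul, Matrix.sub_mul, Matrix.mul_smul,
        Matrix.smul_mul]
    simp only [Finset.smul_sum, h4, Finset.sum_add_distrib, Finset.sum_sub_distrib]
    simp only [← Finset.smul_sum, h1]
  have h3 : ∀ (x x' : α) (y y' : β), ∑ i, X i y x * star (X i y' x') =
      ∑ j, A j y x * star (A j y' x') := by
    intro x x' y y'
    have := congrFun (congrFun (h2 (Pi.single x 1) (Pi.single x' 1)) y) y'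
    simpa [Matrix.sum_apply, Matrix.mul_vecMulVec, Matrix.vecMulVec_mul, Matrix.vecMulVec_apply,
      ← Pi.single_star] using this
  by_contra hX
  -- `f` vanishes on `U` but not on `X i`. The sum of the squared moduli of `f` over a Kraus family
  -- depends only on the map it defines (its Choi matrix, `h3`), so it is zero for `X` because it is
  -- for `A`.
  obtain ⟨f, hf, hfU⟩ := Submodule.exists_le_ker_of_notMem hX
  have hfX : ∀ M : Matrix β α ℂ, f M = ∑ p : β × α, M p.1 p.2 * f (Matrix.single p.1 p.2 1) := by
    intro M
    conv_lhs => rw [Matrix.matrix_eq_sum_single M]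
    rw [Fintype.sum_prod_type]
    simp only [map_sum]
    refine Finset.sum_congr rfl fun y _ => Finset.sum_congr rfl fun x _ => ?_
    rw [← smul_eq_mul, ← map_smul, Matrix.smul_single, smul_eq_mul, mul_one]
  have hsq : ∀ {ν : Type} [Fintype ν] (Z : ν → Matrix β α ℂ), ∑ i, f (Z i) * star (f (Z i)) =
      ∑ p : β × α, ∑ q : β × α, (∑ i, Z i p.1 p.2 * star (Z i q.1 q.2)) *
        (f (Matrix.single p.1 p.2 1) * star (f (Matrix.single q.1 q.2 1))) := by
    intro ν _ Z
    simp only [Finset.sum_mul]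
    rw [Finset.sum_congr rfl fun p _ => Finset.sum_comm, Finset.sum_comm]
    refine Finset.sum_congr rfl fun i _ => ?_
    rw [hfX (Z i), star_sum, Finset.sum_mul_sum]
    refine Finset.sum_congr rfl fun p _ => Finset.sum_congr rfl fun q _ => ?_
    rw [star_mul']
    ring
  have hzero : ∑ i, f (X i) * star (f (X i)) = 0 := by
    rw [hsq X]
    simp only [h3]
    rw [← hsq A]
    exact Finset.sum_eq_zero fun j _ => by rw [LinearMap.mem_ker.1 (hfU (hU j)), zero_mul]
  have hre : ∑ i, Complex.normSq (f (X i)) = 0 := by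
    have := congrArg Complex.re hzero
    simpa [Complex.mul_conj] using this
  rw [Finset.sum_eq_zero_iff_of_nonneg fun i _ => Complex.normSq_nonneg _] at hre
  exact hf (by simpa using hre i (Finset.mem_univ i))

end Channels

/-! ### Random subcodes detect fixed errors -/

/-- Resampling one coordinate preserves the uniform distribution: exchanging it with the fresh value
is an involution on pairs. -/
theorem card_mul_card_filter {ι : Type} [Fintype ι] [DecidableEq ι] {α : ι → Type}
    [∀ i, Fintype (α i)] (j : ι) (p : (∀ i, α i) → Prop) [DecidablePred p] :
    ∑ κ : ∀ i, α i, (Finset.univ.filter fun y : α j => p (Function.update κ j y)).card =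
      Fintype.card (α j) * (Finset.univ.filter p).card := by
  let e : (∀ i, α i) × α j → (∀ i, α i) × α j := fun q => (Function.update q.1 j q.2, q.1 j)
  have he : Function.Involutive e := by
    rintro ⟨κ, y⟩
    simp [e]
  have h1 := Equiv.sum_comp he.toPerm fun q : (∀ i, α i) × α j => if p q.1 then 1 else 0
  rw [Fintype.sum_prod_type, Fintype.sum_prod_type_right] at h1
  simp only [Finset.card_filter]
  rw [show Fintype.card (α j) * (∑ κ, if p κ then 1 else 0) =
    ∑ _y : α j, ∑ κ, if p κ then 1 else 0 by simp]
  exact h1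

/-- If `q` is implied by `p`, which does not depend on coordinate `j`, and a condition on coordinate
`j` satisfied by a fraction `c` of its values, then `q` is rarer than `p` by the factor `c`. -/
theorem card_filter_le_mul_card_filter {ι : Type} [Fintype ι] [DecidableEq ι] {α : ι → Type}
    [∀ i, Fintype (α i)] (j : ι) [Nonempty (α j)] (p q : (∀ i, α i) → Prop) [DecidablePred p]
    [DecidablePred q] (c : ℝ) (hp : ∀ κ y, q (Function.update κ j y) → p κ)
    (hc : ∀ κ, p κ → ((Finset.univ.filter fun y : α j => q (Function.update κ j y)).card : ℝ) ≤
      c * Fintype.card (α j)) :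
    ((Finset.univ.filter q).card : ℝ) ≤ c * (Finset.univ.filter p).card := by
  have hpos : (0 : ℝ) < Fintype.card (α j) := by exact_mod_cast Fintype.card_pos
  have h1 := card_mul_card_filter j q
  have h2 : (Fintype.card (α j) : ℝ) * (Finset.univ.filter q).card ≤
      ∑ κ : ∀ i, α i, if p κ then c * Fintype.card (α j) else 0 := by
    rw [← Nat.cast_mul, ← h1, Nat.cast_sum]
    refine Finset.sum_le_sum fun κ _ => ?_
    split_ifs with h
    · exact hc κ h
    · rw [Finset.card_eq_zero.2, Nat.cast_zero]
      exact Finset.filter_eq_empty_iff.2 fun y _ hy => h (hp κ y hy)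
  rw [← Finset.sum_filter, Finset.sum_const, nsmul_eq_mul] at h2
  refine le_of_mul_le_mul_left (h2.trans (le_of_eq ?_)) hpos
  ring

/-- Bias at most 1/2 leaves at most (1 + 1/2)/2 = 3/4 of the set with even parity. Deleting the zero
string, itself of even parity, cannot raise that fraction. -/
theorem IsBiased.card_filter_le {ι : Type} [Fintype ι] [DecidableEq ι] {η : ℝ}
    {A : Finset (ι → ZMod 2)} (hA : IsBiased η A) (hη : η ≤ 1 / 2) {e : ι → ZMod 2} (he : e ≠ 0) :
    (((A.erase 0).filter fun a => e ⬝ᵥ a = 0).card : ℝ) ≤ 3 / 4 * (A.erase 0).card := by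
  have hpos : (0 : ℝ) < A.card := by exact_mod_cast hA.1.card_pos
  have h := (abs_le.1 (hA.2 e he)).2.trans hη
  rw [← sub_div, div_le_iff₀ hpos] at h
  have hsum : (A.filter fun a => e ⬝ᵥ a = 0).card + (A.filter fun a => e ⬝ᵥ a = 1).card =
      A.card := by
    rw [← Finset.card_filter_add_card_filter_not (s := A) fun a => e ⬝ᵥ a = 0]
    congr 2
    refine Finset.filter_congr fun a _ => ?_
    rcases zmod_two_cases (e ⬝ᵥ a) with h | h <;> simp [h]
  have hsum' : ((A.filter fun a => e ⬝ᵥ a = 0).card : ℝ) +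
      (A.filter fun a => e ⬝ᵥ a = 1).card = A.card := by exact_mod_cast hsum
  by_cases h0 : (0 : ι → ZMod 2) ∈ A
  · have h1 : (0 : ι → ZMod 2) ∈ A.filter fun a => e ⬝ᵥ a = 0 := by simp [h0]
    have h2 : ((A.erase 0).filter fun a => e ⬝ᵥ a = 0) =
        (A.filter fun a => e ⬝ᵥ a = 0).erase 0 := by
      rw [Finset.filter_erase]
    rw [h2, Finset.card_erase_of_mem h1, Finset.card_erase_of_mem h0,
      Nat.cast_sub (Finset.card_pos.2 ⟨_, h1⟩), Nat.cast_sub hA.1.card_pos]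
    push_cast
    linarith
  · rw [Finset.erase_eq_of_notMem h0]
    linarith

/-- Otherwise the set is `{0}`, whose bias is 1. -/
theorem IsBiased.erase_nonempty {ι : Type} [Fintype ι] [DecidableEq ι] [Nonempty ι] {η : ℝ}
    {A : Finset (ι → ZMod 2)} (hA : IsBiased η A) (hη : η ≤ 1 / 2) : (A.erase 0).Nonempty := by
  by_contra h
  rw [Finset.not_nonempty_iff_eq_empty, Finset.erase_eq_empty_iff] at h
  obtain ⟨i⟩ := ‹Nonempty ι›
  have hA0 : A = {0} := h.resolve_left hA.1.ne_empty
  subst hA0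
  have := hA.2 (Pi.single i 1) (by simp)
  norm_num [Finset.filter_singleton] at this
  linarith

theorem comp_swap_ne_zero {m : ℕ} {b : PVec m} (hb : b ≠ 0) : b ∘ Sum.swap ≠ 0 := by
  intro h
  apply hb
  ext i
  simpa using congrFun h i.swap

namespace Subcodes

variable {n k K : ℕ} {C : StabilizerCode n k} {A : SetFamily k K} (S : Subcodes C A)

theorem stab_le (κ : KeyOf A) (j : ℕ) (hj : j ≤ K) : C.stab ≤ (S.code j hj κ).stab := by
  induction j with
  | zero => exact le_of_eq (congrArg StabilizerCode.stab (S.code_zero κ)).symm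
  | succ j ih =>
    exact (ih (Nat.le_of_succ_le hj)).trans (StabilizerCode.AddsGenerator.le (S.step ⟨j, hj⟩ κ))

/-- The physical Pauli operator described by `e` acts as a nontrivial logical operator of the code
after `j` steps. -/
def Undetected (e : PVec n) (j : ℕ) (hj : j ≤ K) (κ : KeyOf A) : Prop :=
  ∃ b, b ≠ 0 ∧ (S.code j hj κ).Acts e b

-- The code after `j` steps does not depend on entry `j` of the key. With the earlier entries fixed,
-- `e` therefore acts on it as a fixed nonzero `b`, and stays undetected only if the new entry is
-- orthogonal to `b`, which holds for at most 3/4 of the entries.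
open Classical in
theorem card_undetected_le {η : ℝ} (hη : η ≤ 1 / 2) (hA : ∀ j, IsBiased η (A j)) (hK : K ≤ k)
    (e : PVec n) (j : ℕ) (hj : j ≤ K) :
    ((Finset.univ.filter (S.Undetected e j hj)).card : ℝ) ≤
      (3 / 4) ^ j * Fintype.card (KeyOf A) := by
  induction j with
  | zero =>
    rw [pow_zero, one_mul]
    exact_mod_cast Finset.card_le_univ _
  | succ j ih =>
    have hj' : j ≤ K := Nat.le_of_succ_le hj
    have hne : Nonempty (Fin (k - j) ⊕ Fin (k - j)) := ⟨Sum.inl ⟨0, by omega⟩⟩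
    have hne' : Nonempty {a // a ∈ (A ⟨j, hj⟩).erase 0} :=
      ((hA ⟨j, hj⟩).erase_nonempty (ι := Fin (k - j) ⊕ Fin (k - j)) hη).to_subtype
    have hcode : ∀ (κ : KeyOf A) y, S.code j hj' (Function.update κ ⟨j, hj⟩ y) =
        S.code j hj' κ := by
      intro κ y
      refine S.code_congr j hj' _ _ fun i hi => Function.update_of_ne ?_ _ _
      rintro rfl
      exact lt_irrefl _ hi
    have hstep : ∀ (κ : KeyOf A) y,
        S.Undetected e (j + 1) hj (Function.update κ ⟨j, hj⟩ y) →
          ∃ b, b ≠ 0 ∧ (S.code j hj' κ).Acts e b ∧ symp y.1 b = 0 := by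
      rintro κ y ⟨b', hb'0, hb'⟩
      have hadd := S.step ⟨j, hj⟩ (Function.update κ ⟨j, hj⟩ y)
      simp only [hcode, Function.update_self] at hadd
      obtain ⟨b, hb, hsymp⟩ := hb'.of_addsGenerator hadd
      refine ⟨b, ?_, hb, hsymp⟩
      rintro rfl
      exact hb'0 (hb'.unique (hb.zero_of_stab_le (StabilizerCode.AddsGenerator.le hadd)))
    have h1 := card_filter_le_mul_card_filter (α := fun j => {a // a ∈ (A j).erase 0}) ⟨j, hj⟩
      (S.Undetected e j hj') (S.Undetected e (j + 1) hj) (3 / 4) (by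
        intro κ y h
        obtain ⟨b, hb0, hb, -⟩ := hstep κ y h
        exact ⟨b, hb0, hb⟩) (by
        rintro κ ⟨b, hb0, hb⟩
        have h2 := (hA ⟨j, hj⟩).card_filter_le hη (comp_swap_ne_zero hb0)
        rw [Fintype.card_coe]
        refine le_trans ?_ h2
        rw [Nat.cast_le]
        refine Finset.card_le_card_of_injOn Subtype.val ?_ Subtype.val_injective.injOn
        intro y hy
        obtain ⟨b', -, hb', hs⟩ := hstep κ y (Finset.mem_filter.1 hy).2
        rw [Finset.coe_filter]
        refine ⟨y.2, ?_⟩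
        rw [hb'.unique hb, symp_comm] at hs
        exact hs)
    refine h1.trans ?_
    rw [pow_succ', mul_assoc]
    exact mul_le_mul_of_nonneg_left (ih hj') (by norm_num)

end Subcodes

/-! ### Spans of Pauli operators -/

/-- Cauchy–Schwarz on the Pauli expansion of `B`: each Pauli preserves the norm of `v`, and the
squared coefficients sum to the normalized trace. The bound is uniform in `v`, which later removes
the dependence on the key. -/
theorem nsq_le_of_mem_span {k : ℕ} (V : Finset (PVec k)) {B : Op k}
    (hB : B ∈ Submodule.span ℂ (pauliOf '' (V : Set (PVec k)))) {v : Bits k → ℂ}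
    (hv : IsUnitVec v) : nsq (B *ᵥ v) ≤ V.card * ((Bᴴ * B).trace.re / 2 ^ k) := by
  obtain ⟨c, hc⟩ : ∃ c : PVec k → ℂ, B = ∑ f ∈ V, c f • pauliOf f := by
    obtain ⟨c, hc⟩ := (Submodule.mem_span_image_finset_iff_exists_fun ℂ).1 hB
    refine ⟨fun f => if h : f ∈ V then c ⟨f, h⟩ else 0, ?_⟩
    rw [← hc, ← Finset.sum_coe_sort V]
    refine Finset.sum_congr rfl fun i _ => ?_
    dsimp only
    rw [dif_pos i.2]
  have htr : (Bᴴ * B).trace.re / 2 ^ k = ∑ f ∈ V, Complex.normSq (c f) := by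
    have h1 : (Bᴴ * B).trace = ∑ f ∈ V, (Complex.normSq (c f) : ℂ) * 2 ^ k := by
      rw [hc, Matrix.conjTranspose_sum, Matrix.sum_mul, Matrix.trace_sum]
      refine Finset.sum_congr rfl fun f hf => ?_
      rw [Matrix.mul_sum, Matrix.trace_sum, Finset.sum_eq_single f]
      · rw [Matrix.conjTranspose_smul, Matrix.smul_mul, Matrix.mul_smul, Matrix.trace_smul,
          Matrix.trace_smul, trace_pauliOf_conjTranspose_mul, if_pos rfl, smul_eq_mul, smul_eq_mul,
          ← mul_assoc, Complex.normSq_eq_conj_mul_self, Complex.star_def]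
      · intro g _ hg
        rw [Matrix.conjTranspose_smul, Matrix.smul_mul, Matrix.mul_smul, Matrix.trace_smul,
          Matrix.trace_smul, trace_pauliOf_conjTranspose_mul, if_neg hg.symm, smul_zero, smul_zero]
      · exact fun h => absurd hf h
    rw [h1, ← Finset.sum_mul, ← Complex.ofReal_sum]
    have h2 : (2 : ℂ) ^ k = ((2 ^ k : ℝ) : ℂ) := by push_cast; rfl
    rw [h2, ← Complex.ofReal_mul, Complex.ofReal_re]
    field_simp
  rw [htr]
  have hent : ∀ x, Complex.normSq ((B *ᵥ v) x) ≤ (∑ f ∈ V, Complex.normSq (c f)) *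
      ∑ f ∈ V, Complex.normSq ((pauliOf f *ᵥ v) x) := by
    intro x
    have h1 : (B *ᵥ v) x = ∑ f ∈ V, c f * (pauliOf f *ᵥ v) x := by
      rw [hc, Matrix.sum_mulVec]
      simp [Matrix.smul_mulVec]
    rw [h1]
    simp only [Complex.normSq_eq_norm_sq]
    calc ‖∑ f ∈ V, c f * (pauliOf f *ᵥ v) x‖ ^ 2 ≤
        (∑ f ∈ V, ‖c f‖ * ‖(pauliOf f *ᵥ v) x‖) ^ 2 := by
          gcongr
          refine (norm_sum_le _ _).trans (le_of_eq ?_)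
          simp
      _ ≤ _ := Finset.sum_mul_sq_le_sq_mul_sq _ _ _
  rw [nsq_eq_sum]
  refine (Finset.sum_le_sum fun x _ => hent x).trans (le_of_eq ?_)
  rw [← Finset.mul_sum, Finset.sum_comm]
  have h1 : ∀ f : PVec k, ∑ x, Complex.normSq ((pauliOf f *ᵥ v) x) = 1 := by
    intro f
    rw [← nsq_eq_sum]
    exact (hv.mulVec (pauliOf_conjTranspose_mul f)).nsq_eq_one
  simp only [h1, Finset.sum_const, nsmul_eq_mul, mul_one]
  ring

/-- Elements of the group generated by Pauli operators described by `p` are described by linear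
combinations of the `p i`. -/
theorem exists_eq_smul_pauliOf_of_mem_closure {k : ℕ} {ι : Type} [Fintype ι]
    (P : ι → pauliGroup k) (p : ι → PVec k)
    (hp : ∀ i, ∃ c : ℂ, ((P i : (Op k)ˣ) : Op k) = c • pauliOf (p i))
    {Q : pauliGroup k} (hQ : Q ∈ Subgroup.closure (Set.range P)) :
    ∃ (c : ℂ) (g : ι → ZMod 2), ((Q : (Op k)ˣ) : Op k) = c • pauliOf (∑ i, g i • p i) := by
  classical
  induction hQ using Subgroup.closure_induction with
  | mem x hx =>
    obtain ⟨i, rfl⟩ := hx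
    obtain ⟨c, hc⟩ := hp i
    exact ⟨c, Pi.single i 1, by simp [hc, Pi.single_apply]⟩
  | one => exact ⟨1, 0, by simp⟩
  | mul x y _ _ hx hy =>
    obtain ⟨c, g, hx⟩ := hx
    obtain ⟨d, h, hy⟩ := hy
    have h1 : ∑ i, (g + h) i • p i = ∑ i, g i • p i + ∑ i, h i • p i := by
      simp only [Pi.add_apply, add_smul, Finset.sum_add_distrib]
    obtain ⟨z, hz⟩ : ∃ z, pauliOf (∑ i, g i • p i) * pauliOf (∑ i, h i • p i) =
        bitSign z • pauliOf (∑ i, (g + h) i • p i) := ⟨_, h1 ▸ pauliOf_mul _ _⟩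
    refine ⟨c * (d * bitSign z), g + h, ?_⟩
    rw [Subgroup.coe_mul, Units.val_mul, hx, hy, Matrix.smul_mul, Matrix.mul_smul, hz, smul_smul,
      smul_smul, mul_assoc]
  | inv x _ hx =>
    obtain ⟨c, g, hx⟩ := hx
    have h1 : (((x⁻¹ : pauliGroup k) : (Op k)ˣ) : Op k) = ((x : (Op k)ˣ) : Op k)ᴴ := by
      have h2 := pauliGroup_conjTranspose_mul x.2
      rw [Subgroup.coe_inv]
      exact Units.inv_eq_of_mul_eq_one_left h2
    simp only [h1, hx, Matrix.conjTranspose_smul, pauliOf_conjTranspose, smul_smul]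
    exact ⟨_, g, rfl⟩

/-! ### Decoding pseudorandom subcodes of list codes -/

/-- The operator `1 ⊗ ⟨s|`. -/
def blockSel (α : Type) {σ : Type} [DecidableEq α] [DecidableEq σ] (s : σ) : Matrix α (α × σ) ℂ :=
  Matrix.of fun x y => if y = (x, s) then 1 else 0

section

variable {α σ β : Type} [Fintype α] [DecidableEq α] [Fintype σ] [DecidableEq σ]

theorem blockSel_mul_apply (s : σ) (M : Matrix (α × σ) β ℂ) (x : α) (j : β) :
    (blockSel α s * M) x j = M (x, s) j := by
  simp [blockSel, Matrix.mul_apply]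

theorem mul_blockSel_conjTranspose_apply (s : σ) (M : Matrix β (α × σ) ℂ) (x : α) (j : β) :
    (M * (blockSel α s)ᴴ) j x = M j (x, s) := by
  simp [blockSel, Matrix.mul_apply, apply_ite]

theorem sum_blockSel_conjTranspose_mul :
    ∑ s : σ, (blockSel α s)ᴴ * blockSel α s = 1 := by
  ext ⟨x, s⟩ ⟨y, t⟩
  simp only [Matrix.sum_apply, Matrix.mul_apply, Matrix.conjTranspose_apply, blockSel,
    Matrix.of_apply, Matrix.one_apply, Prod.mk.injEq]
  rw [Finset.sum_eq_single s, Finset.sum_eq_single x]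
  · simp only [and_self, if_true, star_one, one_mul]
    simp only [eq_comm]
  · intro z _ hz
    simp [hz.symm]
  · simp
  · intro t' _ ht
    simp [ht.symm]
  · simp

theorem blockSel_mul_kronecker_mul (s t : σ) (M : Matrix α α ℂ) :
    blockSel α s * (M ⊗ₖ Matrix.single t t (1 : ℂ)) * (blockSel α s)ᴴ = if t = s then M else 0 := by
  ext x y
  rw [mul_blockSel_conjTranspose_apply, blockSel_mul_apply, Matrix.kroneckerMap_apply]
  split_ifs with h <;> simp [h]

end

/-- For a Pauli error, selecting the label `s` on both sides of the list-code identity gives two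
Kraus families with the same action, so each block lies in the space containing the `A s j`.
Membership is linear in `E`, which covers superpositions although `A` varies with the error. -/
theorem kraus_block_mem {n k : ℕ} {t : ℝ} {C : StabilizerCode n k}
    {D : Channel (Bits n) (Bits k × Bits (n - k))} {U : Bits (n - k) → Submodule ℂ (Op k)}
    (hD : ∀ E ∈ errorSet n t, ∃ (r : ℕ) (A : Bits (n - k) → Fin r → Op k),
      (∀ s j, A s j ∈ U s) ∧ ∀ ψ : Bits k → ℂ, IsUnitVec ψ →
        D.apply (E * proj (C.enc *ᵥ ψ) * Eᴴ) =
          ∑ s, ∑ j, (A s j * proj ψ * (A s j)ᴴ) ⊗ₖ (Matrix.single s s 1))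
    {E : Op n} (hE : E ∈ Submodule.span ℂ (errorSet n t)) (l : Fin D.r) (s : Bits (n - k)) :
    blockSel (Bits k) s * D.kraus l * E * C.enc ∈ U s := by
  induction hE using Submodule.span_induction with
  | zero => simp
  | add x y _ _ hx hy =>
    rw [Matrix.mul_add, Matrix.add_mul]
    exact Submodule.add_mem _ hx hy
  | smul c x _ hx =>
    rw [Matrix.mul_smul, Matrix.smul_mul]
    exact Submodule.smul_mem _ c hx
  | mem E hE =>
    obtain ⟨r, A, hA, h⟩ := hD E hE
    refine mem_of_kraus_eq (fun l => blockSel (Bits k) s * D.kraus l * E * C.enc)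
      (A s) (fun ψ hψ => ?_) (U s)
      (hA s) l
    have h1 := congrArg (fun ρ => blockSel (Bits k) s * ρ * (blockSel (Bits k) s)ᴴ) (h ψ hψ)
    simp only [Matrix.mul_sum, Matrix.sum_mul, blockSel_mul_kronecker_mul] at h1
    rw [Finset.sum_eq_single s] at h1
    · simp only [if_true] at h1
      rw [← h1, Channel.apply, Matrix.mul_sum, Matrix.sum_mul]
      refine Finset.sum_congr rfl fun l _ => ?_
      rw [← mul_proj_mul]
      simp only [Matrix.conjTranspose_mul, Matrix.mul_assoc]
    · intro t _ ht
      simp [ht]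
    · simp

/-- `V` is closed under addition, so `Xᴴ * Y` is again a combination of the Paulis in `V`. This
yields the Knill–Laflamme condition for the whole span. -/
theorem exists_scalar_of_compress {k m : ℕ} {V : Set (PVec k)}
    (hadd : ∀ f ∈ V, ∀ g ∈ V, f + g ∈ V) {W : Matrix (Bits k) (Bits m) ℂ}
    (hW : ∀ f ∈ V, ∃ c : ℂ, Wᴴ * pauliOf f * W = c • 1) {X Y : Op k}
    (hX : X ∈ Submodule.span ℂ (pauliOf '' V)) (hY : Y ∈ Submodule.span ℂ (pauliOf '' V)) :
    ∃ c : ℂ, (X * W)ᴴ * (Y * W) = c • 1 := by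
  have hXY : Xᴴ * Y ∈ Submodule.span ℂ (pauliOf '' V) := by
    induction hX using Submodule.span_induction with
    | zero => simp
    | add x y _ _ hx hy =>
      rw [Matrix.conjTranspose_add, Matrix.add_mul]
      exact Submodule.add_mem _ hx hy
    | smul c x _ hx =>
      rw [Matrix.conjTranspose_smul, Matrix.smul_mul]
      exact Submodule.smul_mem _ _ hx
    | mem x hx =>
      obtain ⟨f, hf, rfl⟩ := hx
      induction hY using Submodule.span_induction with
      | zero => simp
      | add x y _ _ hx hy =>
        rw [Matrix.mul_add]
        exact Submodule.add_mem _ hx hy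
      | smul c x _ hx =>
        rw [Matrix.mul_smul]
        exact Submodule.smul_mem _ _ hx
      | mem x hx =>
        obtain ⟨g, hg, rfl⟩ := hx
        obtain ⟨z, hz⟩ := pauliOf_conjTranspose_mul_pauliOf f g
        rw [hz]
        exact Submodule.smul_mem _ _ (Submodule.subset_span ⟨_, hadd f hf g hg, rfl⟩)
  have key : ∀ Z ∈ Submodule.span ℂ (pauliOf '' V), ∃ c : ℂ, Wᴴ * Z * W = c • 1 := by
    intro Z hZ
    induction hZ using Submodule.span_induction with
    | zero => exact ⟨0, by simp⟩
    | add x y _ _ hx hy =>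
      obtain ⟨c, hc⟩ := hx
      obtain ⟨d, hd⟩ := hy
      exact ⟨c + d, by rw [Matrix.mul_add, Matrix.add_mul, hc, hd, add_smul]⟩
    | smul a x _ hx =>
      obtain ⟨c, hc⟩ := hx
      exact ⟨a * c, by rw [Matrix.mul_smul, Matrix.smul_mul, hc, smul_smul]⟩
    | mem x hx =>
      obtain ⟨f, hf, rfl⟩ := hx
      exact hW f hf
  obtain ⟨c, hc⟩ := key _ hXY
  refine ⟨c, ?_⟩
  rw [← hc, Matrix.conjTranspose_mul]
  simp only [Matrix.mul_assoc]

/-- Either the compression of the error to the subcode vanishes, or the error acts there, and then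
only trivially. -/
theorem StabilizerCode.exists_scalar_of_not_acts {n k m : ℕ} {C : StabilizerCode n k}
    {C' : StabilizerCode n m} (hle : C.stab ≤ C'.stab) {e : PVec n} {f : PVec k} (hf : C.Acts e f)
    (h : ¬∃ b, b ≠ 0 ∧ C'.Acts e b) :
    ∃ c : ℂ, (C.encᴴ * C'.enc)ᴴ * pauliOf f * (C.encᴴ * C'.enc) = c • 1 := by
  obtain ⟨c₀, hc₀⟩ := hf
  have hc₀0 : c₀ ≠ 0 := by
    rintro rfl
    simpa using Acts.isometry hc₀
  have h1 : C.encᴴ * pauliOf e * C.enc = c₀ • pauliOf f := by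
    rw [Matrix.mul_assoc, hc₀, Matrix.mul_smul, ← Matrix.mul_assoc, C.enc_isometry, Matrix.one_mul]
  have h2 := compress_of_stab_le hle (pauliOf e)
  rw [h1, Matrix.mul_smul, Matrix.smul_mul] at h2
  suffices h3 : ∃ c : ℂ, C'.encᴴ * pauliOf e * C'.enc = c • 1 by
    obtain ⟨c, hc⟩ := h3
    refine ⟨c₀⁻¹ * c, ?_⟩
    rw [← smul_smul, ← hc, h2, smul_smul, inv_mul_cancel₀ hc₀0, one_smul]
  by_cases h0 : C'.encᴴ * pauliOf e * C'.enc = 0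
  · exact ⟨0, by rw [h0, zero_smul]⟩
  · obtain ⟨b, hb⟩ := acts_of_compress_ne_zero h0
    have hb0 : b = 0 := by
      by_contra hb0
      exact h ⟨b, hb0, hb⟩
    subst hb0
    obtain ⟨c, hc⟩ := hb
    refine ⟨c, ?_⟩
    rw [Matrix.mul_assoc, hc, pauliOf_zero, Matrix.mul_one, Matrix.mul_smul, C'.enc_isometry]

/-- Applying `D`, reading off the label, and recovering according to it. -/
theorem exists_labelled_recovery {α β γ σ : Type} [Fintype α] [DecidableEq α] [Fintype β]
    [DecidableEq β] [Fintype γ] [Fintype σ] [DecidableEq σ] (D : Channel α (β × σ))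
    (R : σ → Channel β γ) : ∃ N : Channel α γ, ∀ ρ, N.apply ρ = ∑ s, ∑ l,
      (R s).apply (blockSel β s * D.kraus l * ρ * (blockSel β s * D.kraus l)ᴴ) := by
  obtain ⟨N, hN⟩ := exists_channel
    (fun q : (Σ s : σ, Fin D.r × Fin (R s).r) =>
      (R q.1).kraus q.2.2 * (blockSel β q.1 * D.kraus q.2.1)) (by
    have h1 : ∀ (s : σ) (l : Fin D.r), ∑ i, ((R s).kraus i * (blockSel β s * D.kraus l))ᴴ *
        ((R s).kraus i * (blockSel β s * D.kraus l)) =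
          (D.kraus l)ᴴ * (((blockSel β s)ᴴ * blockSel β s) * D.kraus l) := by
      intro s l
      have h2 : ∀ i, ((R s).kraus i * (blockSel β s * D.kraus l))ᴴ *
          ((R s).kraus i * (blockSel β s * D.kraus l)) =
            (blockSel β s * D.kraus l)ᴴ * (((R s).kraus i)ᴴ * (R s).kraus i) *
              (blockSel β s * D.kraus l) := by
        intro i
        simp only [Matrix.conjTranspose_mul, Matrix.mul_assoc]
      simp only [h2]
      rw [← Matrix.sum_mul, ← Matrix.mul_sum, (R s).trace_preserving, Matrix.mul_one]
      simp only [Matrix.conjTranspose_mul, Matrix.mul_assoc]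
    rw [Fintype.sum_sigma]
    simp only [Fintype.sum_prod_type, h1]
    rw [Finset.sum_comm]
    simp only [← Matrix.mul_sum, ← Matrix.sum_mul, sum_blockSel_conjTranspose_mul, Matrix.one_mul]
    exact D.trace_preserving)
  refine ⟨N, fun ρ => ?_⟩
  rw [hN, Fintype.sum_sigma]
  refine Finset.sum_congr rfl fun s _ => ?_
  rw [Fintype.sum_prod_type]
  refine Finset.sum_congr rfl fun l _ => ?_
  rw [Channel.apply]
  refine Finset.sum_congr rfl fun i _ => ?_
  simp only [Matrix.conjTranspose_mul, Matrix.mul_assoc]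

theorem pureFidelity_apply_proj {α β : Type} [Fintype α] [DecidableEq α] [Fintype β]
    (R : Channel α β) (ψ : β → ℂ) (φ : α → ℂ) :
    pureFidelity ψ (R.apply (proj φ)) = ∑ i, Complex.normSq (star ψ ⬝ᵥ (R.kraus i *ᵥ φ)) := by
  rw [Channel.apply, pureFidelity_sum]
  exact Finset.sum_congr rfl fun i _ => by rw [mul_proj_mul, pureFidelity_proj]

theorem Channel.apply_sum {α β ι : Type} [Fintype α] [DecidableEq α] [Fintype β] [Fintype ι]
    (R : Channel α β) (ρ : ι → Matrix α α ℂ) : R.apply (∑ i, ρ i) = ∑ i, R.apply (ρ i) := by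
  simp only [Channel.apply, Matrix.mul_sum, Matrix.sum_mul]
  exact Finset.sum_comm

theorem StabilizerCode.encode_apply_proj {n k : ℕ} (C : StabilizerCode n k) (ψ : Bits k → ℂ) :
    C.encode.apply (proj ψ) = proj (C.enc *ᵥ ψ) := by
  rw [← mul_proj_mul]
  exact Fin.sum_univ_one fun _ => C.enc * proj ψ * C.encᴴ

theorem pureFidelity_labelled_recovery {α β γ σ : Type} [Fintype α] [DecidableEq α] [Fintype β]
    [DecidableEq β] [Fintype γ] [DecidableEq γ] [Fintype σ] [DecidableEq σ] {D : Channel α (β × σ)}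
    {R : σ → Channel β γ} {M : Channel α γ} (hM : ∀ ρ, M.apply ρ = ∑ s, ∑ l,
      (R s).apply (blockSel β s * D.kraus l * ρ * (blockSel β s * D.kraus l)ᴴ))
    (N : Channel α α) (V : Matrix α γ ℂ) (ψ : γ → ℂ) :
    pureFidelity ψ (M.apply (N.apply (proj (V *ᵥ ψ)))) = ∑ s, ∑ l, ∑ h, ∑ i, Complex.normSq
      (star ψ ⬝ᵥ (((R s).kraus i * (blockSel β s * D.kraus l * N.kraus h * V)) *ᵥ ψ)) := by
  rw [hM, pureFidelity_sum]
  refine Finset.sum_congr rfl fun s _ => ?_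
  rw [pureFidelity_sum]
  refine Finset.sum_congr rfl fun l _ => ?_
  have hN : N.apply (proj (V *ᵥ ψ)) = ∑ h, N.kraus h * proj (V *ᵥ ψ) * (N.kraus h)ᴴ := rfl
  rw [hN, Matrix.mul_sum, Matrix.sum_mul, Channel.apply_sum, pureFidelity_sum]
  refine Finset.sum_congr rfl fun h _ => ?_
  rw [mul_proj_mul, mul_proj_mul, pureFidelity_apply_proj]
  refine Finset.sum_congr rfl fun i _ => ?_
  simp only [Matrix.mulVec_mulVec, Matrix.mul_assoc]

theorem sum_block_isometry {α β γ σ : Type} [Fintype α] [DecidableEq α] [Fintype β]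
    [DecidableEq β] [Fintype γ] [DecidableEq γ] [Fintype σ] [DecidableEq σ] (D : Channel α (β × σ))
    (N : Channel α α) {V : Matrix α γ ℂ} (hV : Vᴴ * V = 1) :
    ∑ s : σ, ∑ l, ∑ h, (blockSel β s * D.kraus l * N.kraus h * V)ᴴ *
      (blockSel β s * D.kraus l * N.kraus h * V) = 1 := by
  have h1 : ∀ (s : σ) l h, (blockSel β s * D.kraus l * N.kraus h * V)ᴴ *
      (blockSel β s * D.kraus l * N.kraus h * V) = Vᴴ * ((N.kraus h)ᴴ * ((D.kraus l)ᴴ *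
        (((blockSel β s)ᴴ * blockSel β s) * D.kraus l) * N.kraus h) * V) := by
    intro s l h
    simp only [Matrix.conjTranspose_mul, Matrix.mul_assoc]
  simp only [h1]
  rw [Finset.sum_comm, Finset.sum_congr rfl fun l _ => Finset.sum_comm, Finset.sum_comm]
  simp only [← Matrix.mul_sum, ← Matrix.sum_mul, sum_blockSel_conjTranspose_mul, Matrix.one_mul,
    D.trace_preserving, N.trace_preserving, hV]

theorem trace_conjTranspose_mul_self_re_nonneg {α β : Type} [Fintype α] [Fintype β]
    (M : Matrix α β ℂ) : 0 ≤ (Mᴴ * M).trace.re := by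
  rw [Matrix.trace, Complex.re_sum]
  refine Finset.sum_nonneg fun j _ => ?_
  rw [Matrix.diag_apply, Matrix.mul_apply, Complex.re_sum]
  refine Finset.sum_nonneg fun i _ => ?_
  rw [Matrix.conjTranspose_apply, Complex.star_def, ← Complex.normSq_eq_conj_mul_self,
    Complex.ofReal_re]
  exact Complex.normSq_nonneg _

theorem card_image_linearCombination_le {k L : ℕ} (p : Fin L → PVec k) :
    (Finset.univ.image fun g : Fin L → ZMod 2 => ∑ i, g i • p i).card ≤ 2 ^ L := by
  refine Finset.card_image_le.trans ?_
  simp [ZMod.card]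

theorem nonempty_keyOf {k K : ℕ} {η : ℝ} {A : SetFamily k K} (hA : ∀ j, IsBiased η (A j))
    (hη : η ≤ 1 / 2) (hK : K ≤ k) : Nonempty (KeyOf A) := by
  refine ⟨fun j => ?_⟩
  have : Nonempty (Fin (k - j) ⊕ Fin (k - j)) := ⟨Sum.inl ⟨0, by omega⟩⟩
  exact ⟨_, ((hA j).erase_nonempty hη).choose_spec⟩

theorem exists_decoder {n k L K : ℕ} {p ε η : ℝ} {C : StabilizerCode n k}
    (hC : IsListCode C (p * n) L) (hη : η ≤ 1 / 2) {A : SetFamily k K}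
    (hA : ∀ j, IsBiased η (A j)) (hK : K ≤ k) (hε : (4 : ℝ) ^ L * (3 / 4) ^ K ≤ ε)
    (S : Subcodes C A) :
    ∃ dec : KeyOf A → Channel (Bits n) (Bits (k - K)),
      SendsWithFidelity (fun κ => (S.code K le_rfl κ).encode) dec p (1 - ε) := by
  classical
  obtain ⟨D, P, hD⟩ := hC
  choose t v hv using fun s i => mem_pauliGroup_iff.1 (P s i).2
  let V : Bits (n - k) → Finset (PVec k) := fun s =>
    Finset.univ.image fun g : Fin L → ZMod 2 => ∑ i, g i • v s i
  have hVcard : ∀ s, (V s).card ≤ 2 ^ L := fun s => card_image_linearCombination_le (v s)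
  let U : Bits (n - k) → Submodule ℂ (Op k) := fun s =>
    Submodule.span ℂ (pauliOf '' (V s : Set (PVec k)))
  have hU : ∀ {E}, E ∈ Submodule.span ℂ (errorSet n (p * n)) → ∀ l s,
      blockSel (Bits k) s * D.kraus l * E * C.enc ∈ U s := by
    refine kraus_block_mem fun E hE => ?_
    obtain ⟨r, B, -, hB, h⟩ := hD E hE
    refine ⟨r, B, fun s j => Submodule.span_le.2 ?_ (hB s j), h⟩
    rintro _ ⟨Q, hQ, rfl⟩
    obtain ⟨c, g, hg⟩ := exists_eq_smul_pauliOf_of_mem_closure (P s) (v s)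
      (fun i => ⟨_, hv s i⟩) hQ
    change ((Q : (Op k)ˣ) : Op k) ∈ U s
    rw [hg]
    refine Submodule.smul_mem _ _ (Submodule.subset_span ⟨_, ?_, rfl⟩)
    simp [V]
  choose e he using C.exists_acts
  let W : KeyOf A → Matrix (Bits k) (Bits (k - K)) ℂ := fun κ => C.encᴴ * (S.code K le_rfl κ).enc
  have hCW : ∀ κ, C.enc * W κ = (S.code K le_rfl κ).enc := fun κ =>
    StabilizerCode.enc_mul_of_stab_le (S.stab_le κ K le_rfl)
  have hW : ∀ κ, (W κ)ᴴ * W κ = 1 := by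
    intro κ
    have h1 := (S.code K le_rfl κ).enc_isometry
    rwa [← hCW, Matrix.conjTranspose_mul, Matrix.mul_assoc,
      ← Matrix.mul_assoc _ C.enc, C.enc_isometry, Matrix.one_mul] at h1
  -- A physical representative `e f` stands for each logical Pauli of the list's span, so that its
  -- fate in the subcode can be followed.
  let good : KeyOf A → Bits (n - k) → Prop := fun κ s =>
    ∀ f ∈ V s, ¬S.Undetected (e f) K le_rfl κ
  have hrec : ∀ κ s, ∃ R : Channel (Bits k) (Bits (k - K)), good κ s → ∀ X ∈ U s,
      ∀ ψ, IsUnitVec ψ → nsq ((X * W κ) *ᵥ ψ) ≤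
        ∑ i, Complex.normSq (star ψ ⬝ᵥ ((R.kraus i * (X * W κ)) *ᵥ ψ)) := by
    intro κ s
    by_cases hg : good κ s
    · have hVadd : ∀ f ∈ (V s : Set (PVec k)), ∀ g ∈ (V s : Set (PVec k)),
          f + g ∈ (V s : Set (PVec k)) := by
        intro f hf g hg
        simp only [V, Finset.coe_image, Finset.coe_univ, Set.image_univ, Set.mem_range] at hf hg ⊢
        obtain ⟨a, rfl⟩ := hf
        obtain ⟨b, rfl⟩ := hg
        exact ⟨a + b, by simp only [Pi.add_apply, add_smul, Finset.sum_add_distrib]⟩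
      let mulW : Op k →ₗ[ℂ] Matrix (Bits k) (Bits (k - K)) ℂ :=
        { toFun := fun X => X * W κ
          map_add' := fun X Y => Matrix.add_mul X Y _
          map_smul' := fun c X => Matrix.smul_mul c X _ }
      obtain ⟨R, hR⟩ := exists_recovery ((U s).map mulW) (by
        rintro _ ⟨X, hX, rfl⟩ _ ⟨Y, hY, rfl⟩
        refine exists_scalar_of_compress hVadd (fun f hf => ?_) hX hY
        exact StabilizerCode.exists_scalar_of_not_acts (S.stab_le κ K le_rfl) (he f) (hg f hf))
      exact ⟨R, fun _ X hX ψ hψ => hR _ ⟨X, hX, rfl⟩ ψ hψ⟩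
    -- Bad pairs are counted as lost, so any channel will do.
    · obtain ⟨R, -⟩ := exists_recovery (⊥ : Submodule ℂ (Matrix (Bits k) (Bits (k - K)) ℂ)) (by
        intro X hX Y _
        rw [(Submodule.mem_bot ℂ).1 hX]
        exact ⟨0, by simp⟩)
      exact ⟨R, fun h => absurd h hg⟩
  choose R hR using hrec
  choose dec hdec using fun κ => exists_labelled_recovery D (R κ)
  refine ⟨dec, fun N hN ψ hψ => ?_⟩
  let B : Bits (n - k) → Fin D.r → Fin N.r → Op k := fun s l h =>
    blockSel (Bits k) s * D.kraus l * N.kraus h * C.enc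
  have hB : ∀ s l h, B s l h ∈ U s := fun s l h => hU (hN h) l s
  have hBsum : ∑ s, ∑ l, ∑ h, (B s l h)ᴴ * B s l h = 1 := sum_block_isometry D N C.enc_isometry
  -- The probability of syndrome `s` for the maximally mixed encoded state of `C`, hence independent
  -- of the key and of `ψ`.
  let q : Bits (n - k) → ℝ := fun s => ∑ l, ∑ h, ((B s l h)ᴴ * B s l h).trace.re / 2 ^ k
  have hq1 : ∑ s, q s = 1 := by
    simp only [q, ← Finset.sum_div, ← Complex.re_sum, ← Matrix.trace_sum, hBsum]
    rw [Matrix.trace_one, Complex.natCast_re]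
    simp [ZMod.card]
  have htr : ∀ s l h, 0 ≤ ((B s l h)ᴴ * B s l h).trace.re / 2 ^ k := fun s l h =>
    div_nonneg (trace_conjTranspose_mul_self_re_nonneg _) (by positivity)
  have hq0 : ∀ s, 0 ≤ q s := fun s =>
    Finset.sum_nonneg fun l _ => Finset.sum_nonneg fun h _ => htr s l h
  -- Good syndromes lose nothing; a bad one loses at most its actual probability, which is at most
  -- `2 ^ L * q s`.
  have hfid : ∀ κ, 1 - ∑ s, (if good κ s then 0 else 2 ^ L * q s) ≤ pureFidelity ψ
      ((dec κ).apply (N.apply ((S.code K le_rfl κ).encode.apply (proj ψ)))) := by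
    intro κ
    rw [StabilizerCode.encode_apply_proj, pureFidelity_labelled_recovery (hdec κ), ← hCW]
    have hone : ∑ s, ∑ l, ∑ h, nsq ((B s l h * W κ) *ᵥ ψ) = 1 := by
      have := sum_nsq_mulVec (A := fun i : Bits (n - k) × Fin D.r × Fin N.r => B i.1 i.2.1 i.2.2)
        (by simpa only [Fintype.sum_prod_type] using hBsum) (hψ.mulVec (hW κ))
      simpa only [Fintype.sum_prod_type, Matrix.mulVec_mulVec] using this
    rw [← hone, ← Finset.sum_sub_distrib]
    refine Finset.sum_le_sum fun s _ => ?_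
    split_ifs with hg
    · rw [sub_zero]
      refine Finset.sum_le_sum fun l _ => Finset.sum_le_sum fun h _ => ?_
      refine (hR κ s hg (B s l h) (hB s l h) ψ hψ).trans (le_of_eq ?_)
      simp only [B, Matrix.mul_assoc]
    · refine le_trans (sub_nonpos.2 ?_) (Finset.sum_nonneg fun l _ => Finset.sum_nonneg fun h _ =>
        Finset.sum_nonneg fun i _ => Complex.normSq_nonneg _)
      simp only [q, Finset.mul_sum]
      refine Finset.sum_le_sum fun l _ => Finset.sum_le_sum fun h _ => ?_
      rw [← Matrix.mulVec_mulVec]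
      refine (nsq_le_of_mem_span (V s) (hB s l h) (hψ.mulVec (hW κ))).trans ?_
      refine mul_le_mul_of_nonneg_right ?_ (htr s l h)
      exact_mod_cast hVcard s
  have hbad : ∀ s, ((Finset.univ.filter fun κ => ¬good κ s).card : ℝ) ≤
      2 ^ L * ((3 / 4) ^ K * Fintype.card (KeyOf A)) := by
    intro s
    have h1 : (Finset.univ.filter fun κ => ¬good κ s) ⊆
        (V s).biUnion fun f => Finset.univ.filter (S.Undetected (e f) K le_rfl) := by
      intro κ hκ
      simp only [good, Finset.mem_filter, not_forall, not_not] at hκ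
      obtain ⟨-, f, hf, h⟩ := hκ
      exact Finset.mem_biUnion.2 ⟨f, hf, by simpa using h⟩
    have h2 := (Finset.card_le_card h1).trans Finset.card_biUnion_le
    have h3 : ((Finset.univ.filter fun κ => ¬good κ s).card : ℝ) ≤
        ∑ f ∈ V s, ((Finset.univ.filter (S.Undetected (e f) K le_rfl)).card : ℝ) := by
      exact_mod_cast h2
    refine h3.trans ((Finset.sum_le_sum fun f _ =>
      S.card_undetected_le hη hA hK (e f) K le_rfl).trans ?_)
    rw [Finset.sum_const, nsmul_eq_mul]
    refine mul_le_mul_of_nonneg_right ?_ (by positivity)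
    exact_mod_cast hVcard s
  have hne := nonempty_keyOf hA hη hK
  have hcard : (0 : ℝ) < Fintype.card (KeyOf A) := by exact_mod_cast Fintype.card_pos
  have hcast : ((Fintype.card (KeyOf A) : ℂ))⁻¹ = (((Fintype.card (KeyOf A) : ℝ)⁻¹ : ℝ) : ℂ) := by
    push_cast
    rfl
  rw [hcast, pureFidelity_smul, pureFidelity_sum, inv_mul_eq_div, le_div_iff₀ hcard]
  refine le_trans ?_ (Finset.sum_le_sum fun κ _ => hfid κ)
  rw [Finset.sum_sub_distrib, Finset.sum_comm]
  -- With `q s` fixed, the sum over keys just counts bad keys. One factor `2 ^ L` comes from the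
  -- union bound, the other from Cauchy–Schwarz.
  have h1 : ∀ s, ∑ κ, (if good κ s then 0 else 2 ^ L * q s) ≤
      (4 ^ L * (3 / 4) ^ K * Fintype.card (KeyOf A)) * q s := by
    intro s
    have h2 : ∑ κ, (if good κ s then 0 else 2 ^ L * q s) =
        (Finset.univ.filter fun κ => ¬good κ s).card * (2 ^ L * q s) := by
      rw [← nsmul_eq_mul, ← Finset.sum_const, Finset.sum_filter]
      exact Finset.sum_congr rfl fun κ _ => by split_ifs <;> simp_all
    rw [h2]
    refine (mul_le_mul_of_nonneg_right (hbad s)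
      (mul_nonneg (by positivity) (hq0 s))).trans (le_of_eq ?_)
    rw [show (4 : ℝ) = 2 * 2 by norm_num, mul_pow]
    ring
  have h2 := Finset.sum_le_sum fun s (_ : s ∈ Finset.univ) => h1 s
  rw [← Finset.mul_sum, hq1, mul_one] at h2
  have h3 := mul_le_mul_of_nonneg_right hε hcard.le
  have h4 : ∑ _κ : KeyOf A, (1 : ℝ) = Fintype.card (KeyOf A) := by simp
  rw [h4]
  linarith

/-! ### Small-biased sets -/

theorem card_filter_sub_card_filter {ι : Type} (s : Finset ι) (f : ι → ZMod 2) :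
    ((s.filter fun a => f a = 0).card : ℂ) - (s.filter fun a => f a = 1).card =
      ∑ a ∈ s, bitSign (f a) := by
  rw [Finset.card_filter, Finset.card_filter]
  push_cast
  rw [← Finset.sum_sub_distrib]
  refine Finset.sum_congr rfl fun a _ => ?_
  rcases zmod_two_cases (f a) with h | h <;> simp [h]

theorem isBiased_iff_norm_sum {ι : Type} [Fintype ι] {η : ℝ} {A : Finset (ι → ZMod 2)} :
    IsBiased η A ↔ A.Nonempty ∧ ∀ e : ι → ZMod 2, e ≠ 0 →
      ‖∑ a ∈ A, bitSign (e ⬝ᵥ a)‖ / A.card ≤ η := by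
  refine and_congr_right fun _ => forall_congr' fun e => imp_congr_right fun _ => ?_
  rw [← card_filter_sub_card_filter, ← sub_div, abs_div, Nat.abs_cast,
    ← Complex.ofReal_natCast, ← Complex.ofReal_natCast, ← Complex.ofReal_sub, Complex.norm_real,
    Real.norm_eq_abs]

theorem isBiased_univ {ι : Type} [Fintype ι] [DecidableEq ι] {η : ℝ} (hη : 0 ≤ η) :
    IsBiased η (Finset.univ : Finset (ι → ZMod 2)) := by
  refine isBiased_iff_norm_sum.2 ⟨Finset.univ_nonempty, fun e he => ?_⟩
  obtain ⟨i, hi⟩ := Function.ne_iff.1 he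
  rw [sum_bitSign_eq_zero (fun a => e ⬝ᵥ a) (fun x y => dotProduct_add _ _ _)
    (g := Pi.single i 1)]
  · simpa using hη
  · rw [dotProduct_single_one]
    exact (zmod_two_cases _).resolve_left hi

/-! ### The powering construction over a finite field -/

section Field

variable {F : Type} [Field F] [Algebra (ZMod 2) F] {r : ℕ} {ψ : F →ₗ[ZMod 2] ZMod 2} {z₀ : F}

theorem sum_bitSign_functional_mul [Fintype F] [DecidableEq F] (hψ : ψ z₀ = 1) (w : F) :
    ∑ y, bitSign (ψ (y * w)) = if w = 0 then (Fintype.card F : ℂ) else 0 := by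
  split_ifs with hw
  · simp [hw]
  · refine sum_bitSign_eq_zero (fun y => ψ (y * w)) (fun x y => ?_) (g := z₀ * w⁻¹) ?_
    · rw [add_mul, map_add]
    · rw [inv_mul_cancel_right₀ hw, hψ]

/-- The form `ψ (x * y)` is nondegenerate: if `w ≠ w'`, some multiple of `w - w'` equals `z₀`. -/
theorem eq_of_functional_mul_basis_eq (b : Module.Basis (Fin r) (ZMod 2) F) (hψ : ψ z₀ = 1) {w w' : F}
    (h : ∀ j, ψ (w * b j) = ψ (w' * b j)) :
    w = w' := by
  have h1 : ψ.comp (LinearMap.mulLeft (ZMod 2) w) = ψ.comp (LinearMap.mulLeft (ZMod 2) w') :=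
    b.ext fun j => by simpa using h j
  by_contra hne
  have h2 : w - w' ≠ 0 := sub_ne_zero.2 hne
  have h3 := LinearMap.congr_fun h1 ((w - w')⁻¹ * z₀)
  simp only [LinearMap.comp_apply, LinearMap.mulLeft_apply] at h3
  rw [← sub_eq_zero, ← map_sub, ← sub_mul, mul_inv_cancel_left₀ h2, hψ] at h3
  exact one_ne_zero h3

/-- The string with coordinates `ψ (y x^d b_j)`. -/
noncomputable def powerString {ι : Type} (b : Module.Basis (Fin r) (ZMod 2) F)
    (ψ : F →ₗ[ZMod 2] ZMod 2) (d : ι → ℕ) (j : ι → Fin r) (x y : F) :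
    ι → ZMod 2 := fun i => ψ (y * (x ^ d i * b (j i)))

variable {ι : Type} {d : ι → ℕ} {j : ι → Fin r} (b : Module.Basis (Fin r) (ZMod 2) F)

/-- The coordinates of degree 0 determine `y` and those of degree 1 determine `y * x`; as `y ≠ 0`,
this gives `x`. -/
theorem powerString_injOn (hψ : ψ z₀ = 1) (h0 : ∀ l, ∃ i, d i = 0 ∧ j i = l)
    (h1 : ∀ l, ∃ i, d i = 1 ∧ j i = l)
    {x y x' y' : F} (hy : y ≠ 0) (h : powerString b ψ d j x y = powerString b ψ d j x' y') :
    x = x' ∧ y = y' := by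
  have hyy : y = y' := by
    refine eq_of_functional_mul_basis_eq b hψ fun l => ?_
    obtain ⟨i, hi, rfl⟩ := h0 l
    have := congrFun h i
    simpa [powerString, hi] using this
  subst hyy
  have hxx : y * x = y * x' := by
    refine eq_of_functional_mul_basis_eq b hψ fun l => ?_
    obtain ⟨i, hi, rfl⟩ := h1 l
    have := congrFun h i
    simpa [powerString, hi, mul_assoc] using this
  exact ⟨mul_left_cancel₀ hy hxx, rfl⟩

theorem dotProduct_powerString [Fintype ι] (e : ι → ZMod 2) (x y : F) :
    e ⬝ᵥ powerString b ψ d j x y = ψ (y * ∑ i, e i • (x ^ d i * b (j i))) := by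
  simp [dotProduct, powerString, Finset.mul_sum]

-- The sum is a polynomial in `x` of degree at most `m`. Distinct coordinates have distinct pairs of
-- degree and basis vector, so the basis expansion of some coefficient contains a nonzero `e i`.
open Polynomial in
theorem card_roots_le [Fintype F] [DecidableEq F] [Fintype ι]
    (hinj : Function.Injective fun i => (d i, j i)) {m : ℕ} (hd : ∀ i, d i ≤ m)
    {e : ι → ZMod 2} (he : e ≠ 0) :
    (Finset.univ.filter fun x : F => ∑ i, e i • (x ^ d i * b (j i)) = 0).card ≤ m := by
  classical
  let P : F[X] := ∑ i, monomial (d i) (e i • b (j i))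
  have hPe : ∀ x, P.eval x = ∑ i, e i • (x ^ d i * b (j i)) := by
    intro x
    simp only [P, eval_finsetSum, eval_monomial]
    exact Finset.sum_congr rfl fun i _ => by rw [smul_mul_assoc, mul_comm (b (j i))]
  have hP : P ≠ 0 := by
    intro h0
    obtain ⟨i₀, hi₀⟩ := Function.ne_iff.1 he
    apply hi₀
    have h1 := congrArg (fun p : F[X] => b.repr (p.coeff (d i₀)) (j i₀)) h0
    simp only [P, finsetSum_coeff, coeff_monomial, map_sum, Finsupp.coe_finsetSum,
      Finset.sum_apply, coeff_zero, map_zero, Finsupp.coe_zero, Pi.zero_apply] at h1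
    rw [Finset.sum_eq_single i₀] at h1
    · simpa using h1
    · intro i _ hi
      split_ifs with hdi
      · have hj : j i ≠ j i₀ := fun hj => hi (hinj (Prod.ext hdi hj))
        simp [hj]
      · simp
    · simp
  have hdeg : P.natDegree ≤ m :=
    natDegree_sum_le_of_forall_le _ _ fun i _ => (natDegree_monomial_le _).trans (hd i)
  refine le_trans ?_ hdeg
  refine le_trans (Finset.card_le_card fun x hx => ?_)
    ((Multiset.toFinset_card_le _).trans (card_roots' P))
  rw [Multiset.mem_toFinset, mem_roots hP, IsRoot, hPe]
  exact (Finset.mem_filter.1 hx).2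

/-- For q = |F|, summing signs over `y ≠ 0` gives q - 1 when `x` is a root of the polynomial of `e`,
and -1 otherwise. With Z roots the total is (Z - 1)q over q(q - 1) strings, a bias of |Z - 1|/(q -
1). -/
theorem exists_isBiased_of_field [Fintype F] [Fintype ι] (b : Module.Basis (Fin r) (ZMod 2) F)
    (hψ : ψ z₀ = 1) (hinj : Function.Injective fun i => (d i, j i)) {m : ℕ}
    (hm : 1 ≤ m) (hd : ∀ i, d i ≤ m) (h0 : ∀ l, ∃ i, d i = 0 ∧ j i = l)
    (h1 : ∀ l, ∃ i, d i = 1 ∧ j i = l) {η : ℝ} (hη : m ≤ η * (Fintype.card F - 1)) :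
    ∃ A : Finset (ι → ZMod 2), IsBiased η A ∧ A.card ≤ Fintype.card F ^ 2 := by
  classical
  let D : Finset (F × F) := Finset.univ ×ˢ Finset.univ.erase 0
  let a : F × F → ι → ZMod 2 := fun q => powerString b ψ d j q.1 q.2
  have ha : Set.InjOn a D := by
    rintro ⟨x, y⟩ hq ⟨x', y'⟩ - h
    have hy : y ≠ 0 := by simpa [D] using hq
    obtain ⟨rfl, rfl⟩ := powerString_injOn b hψ h0 h1 hy h
    rfl
  have hq2 : 1 < Fintype.card F := Fintype.one_lt_card
  have hcard : (D.image a).card = Fintype.card F * (Fintype.card F - 1) := by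
    rw [Finset.card_image_of_injOn ha, Finset.card_product, Finset.card_univ,
      Finset.card_erase_of_mem (Finset.mem_univ _), Finset.card_univ]
  refine ⟨D.image a, isBiased_iff_norm_sum.2 ⟨?_, fun e he => ?_⟩, ?_⟩
  · rw [← Finset.card_pos, hcard]
    exact Nat.mul_pos (by omega) (by omega)
  · let Z := (Finset.univ.filter fun x : F => ∑ i, e i • (x ^ d i * b (j i)) = 0).card
    have hZ : Z ≤ m := card_roots_le b hinj hd he
    have hsum : ∑ s ∈ D.image a, bitSign (e ⬝ᵥ s) = ((Z : ℂ) - 1) * Fintype.card F := by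
      rw [Finset.sum_image ha, Finset.sum_product]
      have h2 : ∀ x, ∑ y ∈ Finset.univ.erase (0 : F), bitSign (e ⬝ᵥ a (x, y)) =
          (if ∑ i, e i • (x ^ d i * b (j i)) = 0 then (Fintype.card F : ℂ) else 0) - 1 := by
        intro x
        simp only [a, dotProduct_powerString]
        rw [← sum_bitSign_functional_mul hψ, ← Finset.add_sum_erase _ _ (Finset.mem_univ (0 : F))]
        simp
      rw [Finset.sum_congr rfl fun x _ => h2 x, Finset.sum_sub_distrib, ← Finset.sum_filter,
        Finset.sum_const, Finset.sum_const, Finset.card_univ, nsmul_eq_mul, nsmul_eq_mul]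
      ring
    have hq1 : (0 : ℝ) < (Fintype.card F : ℝ) - 1 := by
      rw [sub_pos]
      exact_mod_cast hq2
    have hq0 : (0 : ℝ) < Fintype.card F := by linarith
    rw [hsum, hcard, norm_mul, Complex.norm_natCast, Nat.cast_mul, Nat.cast_sub hq2.le,
      Nat.cast_one, mul_comm, mul_div_mul_left _ _ hq0.ne', div_le_iff₀ hq1]
    refine le_trans ?_ hη
    rw [← Complex.ofReal_natCast, ← Complex.ofReal_one, ← Complex.ofReal_sub, Complex.norm_real,
      Real.norm_eq_abs, abs_le]
    have hZ' : (Z : ℝ) ≤ m := by exact_mod_cast hZ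
    have hm' : (1 : ℝ) ≤ m := by exact_mod_cast hm
    have hZ0 : (0 : ℝ) ≤ Z := Nat.cast_nonneg _
    constructor <;> linarith
  · rw [hcard, sq]
    exact Nat.mul_le_mul_left _ (Nat.sub_le _ _)

end Field

theorem exists_isBiased {ι : Type} [Fintype ι] [DecidableEq ι] {r : ℕ} (hr : 1 ≤ r) {η : ℝ}
    (hη : (Fintype.card ι : ℝ) ≤ η * (2 ^ r - 1)) (hη0 : 0 ≤ η) :
    ∃ A : Finset (ι → ZMod 2), IsBiased η A ∧ A.card ≤ 4 ^ r := by
  classical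
  have h4 : (4 : ℕ) ^ r = (2 ^ r) ^ 2 := by
    rw [← pow_mul, mul_comm, pow_mul]
    norm_num
  -- Short strings: the full cube is already small enough. Otherwise positions are pairs (quotient,
  -- remainder) modulo `r`, and at least `2 * r` positions guarantee that degrees 0 and 1 occur with
  -- every basis vector.
  by_cases hm : Fintype.card ι < 2 * r
  · refine ⟨Finset.univ, isBiased_univ hη0, ?_⟩
    rw [Finset.card_univ, Fintype.card_fun, ZMod.card, h4, ← pow_mul]
    exact Nat.pow_le_pow_right two_pos (by omega)
  · have : Fintype (GaloisField 2 r) := Fintype.ofFinite _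
    have hcard : Fintype.card (GaloisField 2 r) = 2 ^ r := by
      rw [← Nat.card_eq_fintype_card, GaloisField.card 2 r (by omega)]
    have hfr : Module.finrank (ZMod 2) (GaloisField 2 r) = r := GaloisField.finrank 2 (by omega)
    let b := Module.finBasisOfFinrankEq (ZMod 2) (GaloisField 2 r) hfr
    let σ : ι ≃ Fin (Fintype.card ι) := Fintype.equivFin ι
    have hψ : b.coord ⟨0, hr⟩ (b ⟨0, hr⟩) = 1 := by simp
    have hex : ∀ q < 2, ∀ l : Fin r, ∃ i, (σ i : ℕ) / r = q ∧
        (⟨(σ i : ℕ) % r, Nat.mod_lt _ hr⟩ : Fin r) = l := by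
      intro q hq l
      have hlt : r * q + l < Fintype.card ι := by
        have := l.isLt
        have : r * q ≤ r * 1 := Nat.mul_le_mul_left _ (by omega)
        omega
      refine ⟨σ.symm ⟨r * q + l, hlt⟩, ?_, ?_⟩
      · simp [Nat.mul_add_div hr, Nat.div_eq_of_lt l.isLt]
      · ext
        simp [Nat.mod_eq_of_lt l.isLt]
    obtain ⟨A, hA, hAc⟩ := exists_isBiased_of_field b hψ (ι := ι) (d := fun i => (σ i : ℕ) / r)
      (j := fun i => ⟨(σ i : ℕ) % r, Nat.mod_lt _ hr⟩) (m := Fintype.card ι) (η := η) (by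
        intro i i' h
        simp only [Prod.mk.injEq, Fin.mk.injEq] at h
        apply σ.injective
        ext
        rw [← Nat.div_add_mod (σ i : ℕ) r, h.1, h.2, Nat.div_add_mod]) (by omega)
      (fun i => (Nat.div_le_self _ _).trans (σ i).isLt.le) (hex 0 (by omega)) (hex 1 (by omega))
      (by rw [hcard]; exact_mod_cast hη)
    exact ⟨A, hA, by rwa [hcard, ← h4] at hAc⟩

/-- The numerator exceeds 1 and log (4/3) < 1/2. The consequence `3 ≤ n` serves the key-length
estimate. -/
theorem three_le_numGenerators {L : ℕ} {ε : ℝ} (hε0 : 0 < ε) (hε : ε < 1 / 2) :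
    3 ≤ numGenerators L ε := by
  have hlog : 0 < Real.logb 2 (4 / 3) := Real.logb_pos (by norm_num) (by norm_num)
  have h1 : 1 < Real.logb 2 (1 / ε) := by
    rw [Real.lt_logb_iff_rpow_lt (by norm_num) (by positivity), Real.rpow_one, lt_div_iff₀ hε0]
    linarith
  have h2 : Real.logb 2 (4 / 3) < 1 / 2 := by
    rw [Real.logb_lt_iff_lt_rpow (by norm_num) (by norm_num), ← Real.sqrt_eq_rpow,
      Real.lt_sqrt (by norm_num)]
    norm_num
  have h3 : (2 : ℝ) < (2 * L + Real.logb 2 (1 / ε)) / Real.logb 2 (4 / 3) := by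
    rw [lt_div_iff₀ hlog]
    have : (0 : ℝ) ≤ L := Nat.cast_nonneg L
    linarith
  exact Nat.lt_ceil.2 (by exact_mod_cast h3)

/-- This is the inequality defining the number of generators, exponentiated. -/
theorem four_pow_mul_le {L : ℕ} {ε : ℝ} (hε0 : 0 < ε) :
    (4 : ℝ) ^ L * (3 / 4) ^ numGenerators L ε ≤ ε := by
  have hlog : 0 < Real.logb 2 (4 / 3) := Real.logb_pos (by norm_num) (by norm_num)
  have h1 := (div_le_iff₀ hlog).1
    (Nat.le_ceil ((2 * L + Real.logb 2 (1 / ε)) / Real.logb 2 (4 / 3)))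
  change _ ≤ (numGenerators L ε : ℝ) * _ at h1
  have h4 : Real.logb 2 (4 ^ L / ε) = 2 * L + Real.logb 2 (1 / ε) := by
    rw [div_eq_mul_one_div, Real.logb_mul (by positivity) (by positivity), Real.logb_pow,
      show (4 : ℝ) = 2 ^ 2 by norm_num, Real.logb_pow, Real.logb_self_eq_one (by norm_num)]
    push_cast
    ring
  rw [← h4, ← Real.logb_pow, Real.logb_le_logb (by norm_num) (by positivity) (by positivity),
    div_le_iff₀ hε0] at h1
  have h5 : (3 / 4 : ℝ) ^ numGenerators L ε * (4 / 3) ^ numGenerators L ε = 1 := by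
    rw [← mul_pow]
    norm_num
  calc (4 : ℝ) ^ L * (3 / 4) ^ numGenerators L ε
      ≤ ((4 / 3) ^ numGenerators L ε * ε) * (3 / 4) ^ numGenerators L ε := by gcongr
    _ = ε := by rw [mul_right_comm, mul_comm ((4 / 3 : ℝ) ^ _), h5, one_mul]

theorem exists_biased_family {n k K : ℕ} {η : ℝ} (hkn : k ≤ n) (hn : 3 ≤ n) (hK : 1 ≤ K)
    (hη0 : 0 < η) (hη : η ≤ 1 / 2) :
    ∃ A : SetFamily k K, (∀ j, IsBiased η (A j)) ∧
      (keyBits (KeyOf A) : ℝ) < 4 * (K * Real.logb 2 ((n : ℝ) ^ 2 / η)) := by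
  have hn' : (3 : ℝ) ≤ n := by exact_mod_cast hn
  have hx : 1 ≤ 2 * (n : ℝ) / η + 1 := by
    have : 0 ≤ 2 * (n : ℝ) / η := by positivity
    linarith
  -- A field of size `2 ^ (s + 1)` suffices for strings of length at most 2n and is at most about
  -- twice as large as needed.
  obtain ⟨s, hs1, hs2⟩ := exists_nat_pow_near hx one_lt_two
  have hfam : ∀ j : Fin K, ∃ A : Finset (PVec (k - j)), IsBiased η A ∧ A.card ≤ 4 ^ (s + 1) := by
    intro j
    refine exists_isBiased (Nat.le_add_left 1 s) ?_ hη0.le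
    have h1 : 2 * (n : ℝ) / η ≤ 2 ^ (s + 1) - 1 := by linarith
    rw [div_le_iff₀ hη0] at h1
    refine le_trans ?_ (h1.trans (le_of_eq (mul_comm _ _)))
    rw [Fintype.card_sum, Fintype.card_fin]
    have h2 : k - (j : ℕ) + (k - j) ≤ 2 * n := by omega
    exact_mod_cast h2
  choose A hA hAc using hfam
  refine ⟨A, hA, ?_⟩
  have hkey : keyBits (KeyOf A) ≤ K * (2 * (s + 1)) := by
    rw [keyBits, Fintype.card_pi]
    refine Nat.clog_le_of_le_pow ?_
    calc ∏ j, Fintype.card {a // a ∈ (A j).erase 0} ≤ ∏ _j : Fin K, 4 ^ (s + 1) := by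
          refine Finset.prod_le_prod' fun j _ => ?_
          rw [Fintype.card_coe]
          exact Finset.card_erase_le.trans (hAc j)
      _ = 2 ^ (K * (2 * (s + 1))) := by
          rw [Finset.prod_const, Finset.card_univ, Fintype.card_fin,
            show 4 = 2 ^ 2 by norm_num, ← pow_mul, ← pow_mul]
          congr 1
          ring
  have hlog : (s + 1 : ℝ) < 2 * Real.logb 2 ((n : ℝ) ^ 2 / η) := by
    have hpos : 0 < (n : ℝ) ^ 2 / η := by positivity
    -- `n ≥ 3` and `η ≤ 1/2` give n²/η ≥ 18, which absorbs all constants. Each entry takes 2(s + 1)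
    -- bits, hence the final constant 4.
    have h1 : (2 : ℝ) ^ (s + 1) < ((n : ℝ) ^ 2 / η) ^ 2 := by
      have h18 : 18 ≤ (n : ℝ) ^ 2 / η := by
        rw [le_div_iff₀ hη0]
        nlinarith
      have h5 : 4 * (n : ℝ) / η + 2 < 18 * ((n : ℝ) ^ 2 / η) := by
        have h6 : 4 * (n : ℝ) / η ≤ 4 / 3 * ((n : ℝ) ^ 2 / η) := by
          rw [← mul_div_assoc]
          refine div_le_div_of_nonneg_right ?_ hη0.le
          nlinarith
        linarith
      calc (2 : ℝ) ^ (s + 1) = 2 * 2 ^ s := pow_succ' _ _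
        _ ≤ 4 * (n : ℝ) / η + 2 := by
          have : 4 * (n : ℝ) / η = 2 * (2 * n / η) := by ring
          linarith
        _ < 18 * ((n : ℝ) ^ 2 / η) := h5
        _ ≤ _ := by
          rw [sq ((n : ℝ) ^ 2 / η)]
          exact mul_le_mul_of_nonneg_right h18 hpos.le
    have h2 := Real.logb_lt_logb (b := 2) (by norm_num) (by positivity) h1
    rw [Real.logb_pow, Real.logb_pow, Real.logb_self_eq_one (by norm_num)] at h2
    push_cast at h2
    linarith
  have hK' : (0 : ℝ) < K := by exact_mod_cast hK
  calc (keyBits (KeyOf A) : ℝ) ≤ K * (2 * (s + 1)) := by exact_mod_cast hkey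
    _ < K * (2 * (2 * Real.logb 2 ((n : ℝ) ^ 2 / η))) := by gcongr
    _ = _ := by ring

/-! ### Existence of codes with few independent error tuples -/

theorem symp_zero_right {m : ℕ} (a : PVec m) : symp a 0 = 0 := by simp [symp]

theorem symp_sum_smul {m : ℕ} {ι : Type} [Fintype ι] (a : PVec m) (g : ι → ZMod 2)
    (b : ι → PVec m) :
    symp a (∑ i, g i • b i) = ∑ i, g i * symp a (b i) := by
  simp only [symp, dotProduct_sum, dotProduct_smul, smul_eq_mul]

/-- The map sending `a` to its products with the `b i` is onto, since a functional killing its range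
would give a combination of the `b i` orthogonal to everything. The commutant is its kernel. -/
theorem card_commutant_mul {m L : ℕ} {b : Fin L → PVec m} (hb : LinearIndependent (ZMod 2) b) :
    (Finset.univ.filter fun a : PVec m => ∀ i, symp a (b i) = 0).card * 2 ^ L = 4 ^ m := by
  let Φ : PVec m →ₗ[ZMod 2] (Fin L → ZMod 2) := (AddMonoidHom.mk' (fun a i => symp a (b i))
    (fun x y => funext fun i => symp_add_left x y (b i))).toZModLinearMap 2
  have hΦ : ∀ a i, Φ a i = symp a (b i) := fun _ _ => rfl
  have hsurj : LinearMap.range Φ = ⊤ := by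
    by_contra hne
    obtain ⟨f, hf0, hf⟩ := Submodule.exists_le_ker_of_lt_top _ (lt_top_iff_ne_top.2 hne)
    apply hf0
    have hfs : ∀ x, f x = ∑ i, f (Pi.single i 1) * x i := by
      intro x
      rw [LinearMap.pi_apply_eq_sum_univ f x]
      refine Finset.sum_congr rfl fun i _ => ?_
      rw [smul_eq_mul, mul_comm]
      congr 2
      ext j
      simp [Pi.single_apply, eq_comm]
    have h0 : ∑ i, f (Pi.single i 1) • b i = 0 := by
      by_contra h
      obtain ⟨a, ha⟩ := exists_symp_eq_one h
      rw [symp_comm, symp_sum_smul] at ha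
      have h1 := LinearMap.mem_ker.1 (hf (LinearMap.mem_range_self Φ a))
      rw [hfs] at h1
      simp only [hΦ] at h1
      exact zero_ne_one (h1.symm.trans ha)
    ext x
    have h1 := Fintype.linearIndependent_iff.1 hb _ h0 x
    simpa using h1
  have h1 := LinearMap.finrank_range_add_finrank_ker Φ
  rw [hsurj, finrank_top, Module.finrank_fintype_fun_eq_card, Module.finrank_fintype_fun_eq_card,
    Fintype.card_fin, Fintype.card_sum, Fintype.card_fin] at h1
  have h2 : (Finset.univ.filter fun a : PVec m => ∀ i, symp a (b i) = 0).card =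
      Nat.card (LinearMap.ker Φ) := by
    classical
    rw [Nat.card_eq_fintype_card, Fintype.card_subtype]
    congr 1
    ext a
    simp [LinearMap.mem_ker, funext_iff, hΦ]
  rw [h2, Module.natCard_eq_pow_finrank (K := ZMod 2), Nat.card_zmod, ← pow_add,
    show (4 : ℕ) = 2 ^ 2 by norm_num, ← pow_mul]
  congr 1
  omega

-- Averaging over all nonzero generators: an independent tuple can survive only under generators
-- commuting with all its members. There are 4^(m+1)/2^L - 1 of these, at most a fraction 2^(-L) of
-- the 4^(m+1) - 1 candidates.
open Classical in
theorem StabilizerCode.exists_addsGenerator_few {n m m' L : ℕ} (h : m' = m + 1)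
    (C : StabilizerCode n m') (T : Finset (Fin L → PVec n)) : ∃ C' : StabilizerCode n m,
      2 ^ L * (T.filter C'.ActsIndependently).card ≤ (T.filter C.ActsIndependently).card := by
  subst h
  choose C' hC' using fun a : {a : PVec (m + 1) // a ≠ 0} => C.exists_addsGenerator_succ a.2
  by_contra! hcon
  set N := (T.filter C.ActsIndependently).card with hN
  have h4 : 1 < 4 ^ (m + 1) := Nat.one_lt_pow (by omega) (by omega)
  have hcard : Fintype.card {a : PVec (m + 1) // a ≠ 0} = 4 ^ (m + 1) - 1 := by
    rw [Fintype.card_subtype_compl, Fintype.card_subtype_eq, Fintype.card_fun, ZMod.card,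
      Fintype.card_sum, Fintype.card_fin, ← two_mul, pow_mul]
    norm_num
  have hlow : (4 ^ (m + 1) - 1) * (N + 1) ≤
      2 ^ L * ∑ a, (T.filter (C' a).ActsIndependently).card := by
    rw [Finset.mul_sum, ← hcard, ← Finset.card_univ, ← smul_eq_mul, ← Finset.sum_const]
    exact Finset.sum_le_sum fun a _ => hcon (C' a)
  have hup : 2 ^ L * ∑ a, (T.filter (C' a).ActsIndependently).card ≤ N * (4 ^ (m + 1) - 1) := by
    have hswap : ∑ a, (T.filter (C' a).ActsIndependently).card =
        ∑ e ∈ T, (Finset.univ.filter fun a => (C' a).ActsIndependently e).card := by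
      simp only [Finset.card_filter]
      exact Finset.sum_comm
    have hterm : ∀ e ∈ T, 2 ^ L * (Finset.univ.filter fun a => (C' a).ActsIndependently e).card ≤
        if C.ActsIndependently e then 4 ^ (m + 1) - 1 else 0 := by
      intro e _
      split_ifs with he
      · obtain ⟨b, hb, hbe⟩ := he
        have hcomm := card_commutant_mul hb
        have hle : (Finset.univ.filter fun a => (C' a).ActsIndependently e).card ≤
            ((Finset.univ.filter fun a : PVec (m + 1) => ∀ i, symp a (b i) = 0).erase 0).card := by
          refine Finset.card_le_card_of_injOn Subtype.val ?_ Subtype.val_injective.injOn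
          intro a ha
          obtain ⟨b', -, hb'e, hab⟩ := (Finset.mem_filter.1 ha).2.of_addsGenerator (hC' a)
          simp only [Finset.coe_erase, Set.mem_sdiff, Finset.mem_coe, Finset.mem_filter,
            Finset.mem_univ, true_and, Set.mem_singleton_iff]
          exact ⟨fun i => (hb'e i).unique (hbe i) ▸ hab i, a.2⟩
        rw [Finset.card_erase_of_mem (by simp [symp_comm 0, symp_zero_right])] at hle
        refine (Nat.mul_le_mul_left _ hle).trans ?_
        rw [Nat.mul_sub, mul_comm, hcomm]
        have : 1 ≤ 2 ^ L := Nat.one_le_two_pow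
        omega
      · rw [Nat.le_zero, mul_eq_zero]
        right
        rw [Finset.card_eq_zero, Finset.filter_eq_empty_iff]
        intro a _ ha
        obtain ⟨b, hb, hbe, -⟩ := ha.of_addsGenerator (hC' a)
        exact he ⟨b, hb, hbe⟩
    rw [hswap, Finset.mul_sum]
    refine (Finset.sum_le_sum hterm).trans ?_
    rw [← Finset.sum_filter, Finset.sum_const, smul_eq_mul]
  have h5 := hlow.trans hup
  rw [mul_comm N, Nat.mul_le_mul_left_iff (by omega)] at h5
  omega

open Classical in
theorem StabilizerCode.exists_few {n L : ℕ} (T : Finset (Fin L → PVec n)) (j : ℕ) (hj : j ≤ n) :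
    ∃ C : StabilizerCode n (n - j), 2 ^ (L * j) * (T.filter C.ActsIndependently).card ≤ T.card := by
  induction j with
  | zero => exact ⟨trivialCode n, by simpa using Finset.card_filter_le _ _⟩
  | succ j ih =>
    obtain ⟨C, hC⟩ := ih (by omega)
    obtain ⟨C', hC'⟩ := exists_addsGenerator_few (show n - j = n - (j + 1) + 1 by omega) C T
    refine ⟨C', ?_⟩
    rw [mul_add, mul_one, pow_add, mul_assoc]
    exact (Nat.mul_le_mul_left _ hC').trans hC

/-! ### List codes -/

theorem blockSel_mul_conjTranspose {α σ : Type} [Fintype α] [DecidableEq α] [Fintype σ]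
    [DecidableEq σ] (s : σ) : blockSel α s * (blockSel α s)ᴴ = 1 := by
  ext x y
  rw [mul_blockSel_conjTranspose_apply]
  simp [blockSel, Matrix.one_apply, eq_comm]

theorem conjTranspose_blockSel_mul_mul {α σ : Type} [Fintype α] [DecidableEq α]
    [DecidableEq σ] (s : σ) (X : Matrix α α ℂ) :
    (blockSel α s)ᴴ * X * blockSel α s = X ⊗ₖ Matrix.single s s 1 := by
  ext ⟨x, t⟩ ⟨y, t'⟩
  simp only [Matrix.mul_apply, Matrix.conjTranspose_apply, blockSel, Matrix.of_apply,
    Prod.mk.injEq, Matrix.kroneckerMap_apply, Matrix.single_apply]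
  by_cases ht : t = s
  · by_cases ht' : t' = s
    · subst ht
      simp [ht', apply_ite]
    · simp [ht', Ne.symm ht']
  · simp [ht, Ne.symm ht]

theorem exists_pauli_mem_closure {k L : ℕ} (v : Fin L → PVec k) {b : PVec k}
    (hb : b ∈ Submodule.span (ZMod 2) (Set.range v)) :
    ∃ Q ∈ Subgroup.closure (Set.range fun i => (⟨pauliUnit 0 (v i), pauliUnit_mem 0 (v i)⟩ :
      pauliGroup k)), ∃ c : ℂ, pauliOf b = c • ((Q : (Op k)ˣ) : Op k) := by
  induction hb using Submodule.span_induction with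
  | mem x hx =>
    obtain ⟨i, rfl⟩ := hx
    exact ⟨_, Subgroup.subset_closure ⟨i, rfl⟩, 1, by simp⟩
  | zero => exact ⟨1, Subgroup.one_mem _, 1, by simp⟩
  | add x y _ _ hx hy =>
    obtain ⟨Q, hQ, c, hx⟩ := hx
    obtain ⟨Q', hQ', c', hy⟩ := hy
    refine ⟨Q * Q', Subgroup.mul_mem _ hQ hQ', ?_⟩
    have h1 := pauliOf_mul x y
    rw [hx, hy, Matrix.smul_mul, Matrix.mul_smul, smul_smul] at h1
    refine ⟨(bitSign ((fun i => x (Sum.inr i)) ⬝ᵥ (fun i => y (Sum.inl i))))⁻¹ * (c * c'), ?_⟩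
    rw [Subgroup.coe_mul, Units.val_mul, ← smul_smul, h1, smul_smul,
      inv_mul_cancel₀ (bitSign_ne_zero _), one_smul]
  | smul a x _ hx =>
    rcases zmod_two_cases a with rfl | rfl
    · exact ⟨1, Subgroup.one_mem _, 1, by simp⟩
    · simpa using hx

theorem exists_spanning_family {k L : ℕ} (B : Set (PVec k))
    (hB : ∀ b : Fin L → PVec k, (∀ i, b i ∈ B) → ¬LinearIndependent (ZMod 2) b) :
    ∃ v : Fin L → PVec k, B ⊆ Submodule.span (ZMod 2) (Set.range v) := by
  obtain ⟨S, hSB, hspan, hli⟩ := exists_linearIndependent (ZMod 2) B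
  have hcard : Nat.card S ≤ L := by
    by_contra! h
    have : Fintype S := Fintype.ofFinite S
    rw [Nat.card_eq_fintype_card] at h
    obtain ⟨f⟩ : Nonempty (Fin L ↪ S) :=
      Function.Embedding.nonempty_of_card_le (by simpa using h.le)
    exact hB (fun i => (f i : PVec k)) (fun i => hSB (f i).2) (hli.comp f f.injective)
  have : Fintype S := Fintype.ofFinite S
  rw [Nat.card_eq_fintype_card] at hcard
  obtain ⟨f⟩ : Nonempty (S ↪ Fin L) :=
    Function.Embedding.nonempty_of_card_le (by simpa using hcard)
  -- A maximal independent subset of `B`, padded with zero vectors to length `L`.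
  refine ⟨Function.extend f Subtype.val 0, ?_⟩
  refine (Submodule.subset_span.trans (le_of_eq (congrArg _ hspan.symm))).trans ?_
  refine Submodule.span_mono fun x hx => ?_
  exact ⟨f ⟨x, hx⟩, f.injective.extend_apply _ _ _⟩

theorem card_le_of_isometry {α β : Type} [Fintype α] [Fintype β] [DecidableEq β]
    {M : Matrix α β ℂ} (hM : Mᴴ * M = 1) : Fintype.card β ≤ Fintype.card α := by
  classical
  have h := Matrix.rank_mul_le_right Mᴴ M
  rw [hM, Matrix.rank_one] at h
  exact h.trans (Matrix.rank_le_card_height M)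

/-- Errors distinguished by no syndrome. -/
def StabilizerCode.syndromeSetoid {n k : ℕ} (C : StabilizerCode n k) (Err : Set (PVec n)) :
    Setoid Err where
  r e e' := ∃ b, C.Acts (e.1 + e'.1) b
  iseqv := by
    refine ⟨fun e => ⟨0, ?_⟩, ?_, ?_⟩
    · rw [add_self_bits]
      exact Acts.zero
    · rintro e e' ⟨b, hb⟩
      exact ⟨b, by rwa [add_comm]⟩
    · rintro e e' e'' ⟨b, hb⟩ ⟨b', hb'⟩
      refine ⟨b + b', ?_⟩
      have h : e.1 + e''.1 = e.1 + e'.1 + (e'.1 + e''.1) := by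
        rw [add_assoc, ← add_assoc e'.1, add_self_bits, zero_add]
      rw [h]
      exact hb.add hb'

/-- Errors in different syndrome classes move the code to orthogonal subspaces, so the decoder can
measure the class and undo its representative. The remaining error is a logical Pauli, and the
hypothesis confines those of one class to the span of `L` vectors. -/
theorem isListCode_of_not_actsIndependently {n k L : ℕ} (C : StabilizerCode n k) (t : ℝ)
    (h : ∀ e : Fin (L + 1) → PVec n,
      (∀ i, (pauliWeight (fun x => e i (Sum.inl x)) (fun x => e i (Sum.inr x)) : ℝ) ≤ t) →
        ¬C.ActsIndependently fun i : Fin L => e i.succ + e 0) : IsListCode C t L := by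
  classical
  let Err : Set (PVec n) :=
    {e | (pauliWeight (fun x => e (Sum.inl x)) (fun x => e (Sum.inr x)) : ℝ) ≤ t}
  let st := C.syndromeSetoid Err
  have : Fintype (Quotient st) := Fintype.ofFinite _
  let rep : Quotient st → PVec n := fun q => q.out.1
  let X : Quotient st → Matrix (Bits n) (Bits k) ℂ := fun q => pauliOf (rep q) * C.enc
  have hX : ∀ q q', (X q)ᴴ * X q' = if q = q' then 1 else 0 := by
    intro q q'
    have h0 : (X q)ᴴ * X q' = C.encᴴ * ((pauliOf (rep q))ᴴ * pauliOf (rep q')) * C.enc := by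
      simp only [X, Matrix.conjTranspose_mul, Matrix.mul_assoc]
    split_ifs with hq
    · subst hq
      rw [h0, pauliOf_conjTranspose_mul, Matrix.mul_one, C.enc_isometry]
    · obtain ⟨z, hz⟩ := pauliOf_conjTranspose_mul_pauliOf (rep q) (rep q')
      rw [h0, hz, Matrix.mul_smul, Matrix.smul_mul]
      by_contra hne
      apply hq
      rw [← Quotient.out_equiv_out]
      exact StabilizerCode.acts_of_compress_ne_zero fun h1 => hne (by rw [h1, smul_zero])
  -- The classes occupy mutually orthogonal copies of a 2^k-dimensional space inside 2^n dimensions,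
  -- so `n - k` bits can label them.
  obtain ⟨lab⟩ : Nonempty (Quotient st ↪ Bits (n - k)) := by
    apply Function.Embedding.nonempty_of_card_le
    have h1 : Fintype.card (Quotient st × Bits k) ≤ Fintype.card (Bits n) := by
      refine card_le_of_isometry (M := Matrix.of fun x q => X q.1 x q.2) ?_
      ext ⟨q, y⟩ ⟨q', y'⟩
      have h2 := congrFun (congrFun (hX q q') y) y'
      rw [Matrix.mul_apply] at h2 ⊢
      refine Eq.trans h2 ?_
      split_ifs with hq
      · simp [hq, Matrix.one_apply]
      · simp [hq]
    rw [Fintype.card_prod, Fintype.card_fun, Fintype.card_fun, ZMod.card, Fintype.card_fin,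
      Fintype.card_fin] at h1
    rw [Fintype.card_fun, ZMod.card, Fintype.card_fin]
    have h3 : 2 ^ n = 2 ^ (n - k) * 2 ^ k := by rw [← pow_add, Nat.sub_add_cancel C.le]
    rw [h3] at h1
    exact Nat.le_of_mul_le_mul_right h1 (by positivity)
  let Q : Op n := ∑ q, X q * (X q)ᴴ
  have hQX : ∀ q, Q * X q = X q := by
    intro q
    simp only [Q, Matrix.sum_mul]
    rw [Finset.sum_eq_single q]
    · rw [Matrix.mul_assoc, hX, if_pos rfl, Matrix.mul_one]
    · intro q' _ hq'
      rw [Matrix.mul_assoc, hX, if_neg hq', Matrix.mul_zero]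
    · simp
  have hQQ : Q * Q = Q := by
    nth_rewrite 2 [show Q = ∑ q, X q * (X q)ᴴ from rfl]
    simp only [Matrix.mul_sum, ← Matrix.mul_assoc, hQX]
    rfl
  obtain ⟨D, Z, hD, hZ⟩ := exists_channel_of_projector
    (fun q => (blockSel (Bits k) (lab q))ᴴ * (X q)ᴴ) (Q := Q) (by
      refine Finset.sum_congr rfl fun q _ => ?_
      rw [Matrix.conjTranspose_mul, Matrix.conjTranspose_conjTranspose,
        Matrix.conjTranspose_conjTranspose, Matrix.mul_assoc, ← Matrix.mul_assoc (blockSel _ _),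
        blockSel_mul_conjTranspose, Matrix.one_mul]) hQQ
  have hlist : ∀ q, ∃ v : Fin L → PVec k, {b | ∃ e ∈ Err, C.Acts (e + rep q) b} ⊆
      (Submodule.span (ZMod 2) (Set.range v) : Set (PVec k)) := by
    intro q
    -- `L` independent logical errors in one class, with the representative put in front, would form
    -- a forbidden tuple.
    refine exists_spanning_family _ fun b hb hli => ?_
    choose e he heb using hb
    refine h (Fin.cons (rep q) e) ?_ ⟨b, hli, fun i => by simpa using heb i⟩
    refine Fin.cases ?_ fun i => ?_
    · exact q.out.2
    · exact he i
  choose v hv using hlist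
  -- Labels belonging to no class get the zero list.
  let w : Bits (n - k) → Fin L → PVec k := Function.extend lab v 0
  refine ⟨D, fun s i => ⟨pauliUnit 0 (w s i), pauliUnit_mem 0 _⟩, ?_⟩
  rintro E ⟨t', u, u', hwt, rfl⟩
  let e : Err := ⟨Sum.elim u u', hwt⟩
  let q : Quotient st := Quotient.mk st e
  obtain ⟨b, hb⟩ : ∃ b, C.Acts (e.1 + rep q) b := st.symm (Quotient.mk_out (s := st) e)
  obtain ⟨c, hc⟩ : ∃ c : ℂ, Complex.I ^ t' • pauliOf e.1 * C.enc = c • (X q * pauliOf b) := by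
    obtain ⟨z, hz⟩ := pauliOf_conjTranspose_mul_pauliOf (rep q) e.1
    obtain ⟨c₀, hc₀⟩ := hb
    refine ⟨Complex.I ^ t' * (bitSign z * c₀), ?_⟩
    rw [Matrix.smul_mul, ← smul_smul]
    congr 1
    calc pauliOf e.1 * C.enc = pauliOf (rep q) * ((pauliOf (rep q))ᴴ * pauliOf e.1) * C.enc := by
          rw [← Matrix.mul_assoc, pauliOf_mul_conjTranspose, Matrix.one_mul]
      _ = (bitSign z * c₀) • (X q * pauliOf b) := by
          rw [hz, Matrix.mul_smul, Matrix.smul_mul, Matrix.mul_assoc, add_comm, hc₀,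
            Matrix.mul_smul, smul_smul, ← Matrix.mul_assoc]
  have hc1 : star c * c = 1 := by
    have h1 : (Complex.I ^ t' • pauliOf e.1 * C.enc)ᴴ * (Complex.I ^ t' • pauliOf e.1 * C.enc) =
        1 := by
      have h2 := pauliGroup_conjTranspose_mul (pauliUnit_mem t' e.1)
      rw [val_pauliUnit] at h2
      rw [Matrix.conjTranspose_mul, Matrix.mul_assoc, ← Matrix.mul_assoc _ _ C.enc, h2,
        Matrix.one_mul, C.enc_isometry]
    rw [hc, Matrix.conjTranspose_smul, Matrix.conjTranspose_mul, Matrix.smul_mul, Matrix.mul_smul,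
      Matrix.mul_assoc, ← Matrix.mul_assoc _ (X q), hX, if_pos rfl, Matrix.one_mul,
      pauliOf_conjTranspose_mul, smul_smul] at h1
    simpa using congrFun (congrFun h1 0) 0
  refine ⟨1, fun s _ => if s = lab q then c • pauliOf b else 0, ?_, ?_, ?_⟩
  · rw [Finset.sum_eq_single (lab q)]
    · simp only [if_true, Fin.sum_univ_one]
      rw [Matrix.conjTranspose_smul, Matrix.smul_mul, Matrix.mul_smul, pauliOf_conjTranspose_mul,
        smul_smul, hc1, one_smul]
    · intro s _ hs
      simp [hs]
    · simp
  · intro s _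
    dsimp only
    split_ifs with hs
    · have hbw : b ∈ Submodule.span (ZMod 2) (Set.range (w s)) := by
        rw [hs, show w (lab q) = v q from lab.injective.extend_apply _ _ _]
        exact hv q ⟨e.1, e.2, hb⟩
      obtain ⟨P, hP, c', hc'⟩ := exists_pauli_mem_closure (w s) hbw
      rw [hc', smul_smul]
      exact Submodule.smul_mem _ _ (Submodule.subset_span ⟨P, hP, rfl⟩)
    · exact Submodule.zero_mem _
  · intro ψ _
    have hE : (Complex.I ^ t' • pauliXZ u u') * proj (C.enc *ᵥ ψ) *
        (Complex.I ^ t' • pauliXZ u u')ᴴ = proj ((c • (X q * pauliOf b)) *ᵥ ψ) := by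
      rw [mul_proj_mul, Matrix.mulVec_mulVec, ← hc]
      rfl
    rw [hE, hD, Finset.sum_eq_single q, Finset.sum_eq_zero (s := Finset.univ (α := Bits n)),
      Finset.sum_eq_single (lab q)]
    · simp only [if_true, Fin.sum_univ_one]
      rw [add_zero, ← conjTranspose_blockSel_mul_mul, mul_proj_mul, mul_proj_mul,
        Matrix.mulVec_mulVec, Matrix.mul_smul, Matrix.mul_assoc, ← Matrix.mul_assoc _ (X q), hX,
        if_pos rfl, Matrix.one_mul, ← Matrix.mul_smul, ← Matrix.mulVec_mulVec, ← mul_proj_mul,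
        Matrix.conjTranspose_conjTranspose]
    · intro s _ hs
      simp [hs]
    · simp
    · intro x _
      obtain ⟨Y, hY⟩ := hZ x
      have h0 : Z x * (c • (X q * pauliOf b)) = 0 := by
        rw [hY, Matrix.mul_smul, Matrix.mul_assoc Y (1 - Q), ← Matrix.mul_assoc (1 - Q) (X q),
          Matrix.sub_mul,
          hQX, Matrix.one_mul, sub_self, Matrix.zero_mul, Matrix.mul_zero, smul_zero]
      rw [mul_proj_mul, Matrix.mulVec_mulVec, h0]
      simp [proj]
    · intro q' _ hq'
      have h0 : (blockSel (Bits k) (lab q'))ᴴ * (X q')ᴴ * (c • (X q * pauliOf b)) = 0 := by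
        rw [Matrix.mul_smul, Matrix.mul_assoc, ← Matrix.mul_assoc _ (X q), hX, if_neg hq',
          Matrix.zero_mul, Matrix.mul_zero, smul_zero]
      rw [mul_proj_mul, Matrix.mulVec_mulVec, h0]
      simp [proj]
    · simp

/-! ### The number of errors of bounded weight -/

/-- The strings describing the Pauli operators of weight at most `r`. -/
noncomputable def lowWeight (n : ℕ) (r : ℝ) : Finset (PVec n) :=
  open Classical in Finset.univ.filter fun e =>
    (pauliWeight (fun x => e (Sum.inl x)) (fun x => e (Sum.inr x)) : ℝ) ≤ r

theorem mem_lowWeight {n : ℕ} {r : ℝ} {e : PVec n} : e ∈ lowWeight n r ↔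
    (pauliWeight (fun x => e (Sum.inl x)) (fun x => e (Sum.inr x)) : ℝ) ≤ r := by
  simp [lowWeight]

/-- The sum factors over qubits: each contributes 1 for the identity and `x` for each of three
nontrivial Paulis. -/
theorem sum_pow_pauliWeight (n : ℕ) (x : ℝ) :
    ∑ e : PVec n, x ^ pauliWeight (fun i => e (Sum.inl i)) (fun i => e (Sum.inr i)) =
      (1 + 3 * x) ^ n := by
  have h1 : ∑ a : ZMod 2 × ZMod 2, (if a.1 ≠ 0 ∨ a.2 ≠ 0 then x else 1) = 1 + 3 * x := by
    rw [Fintype.sum_prod_type]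
    have h2 : ∀ f : ZMod 2 → ℝ, ∑ a, f a = f 0 + f 1 := fun f => Fin.sum_univ_two f
    simp only [h2]
    simp
    ring
  rw [← h1, Fintype.sum_pow]
  refine Fintype.sum_equiv ((Equiv.sumArrowEquivProdArrow _ _ _).trans
    (Equiv.arrowProdEquivProdArrow _ _ _).symm) _ _ fun e => ?_
  rw [Finset.prod_ite]
  simp [pauliWeight]

theorem log_card_lowWeight_le {n : ℕ} {p : ℝ} (hp0 : 0 ≤ p) (hp : p ≤ 3 / 4) :
    Real.log (lowWeight n (p * n)).card ≤ n * (Real.binEntropy p + p * Real.log 3) := by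
  rcases hp0.eq_or_lt with rfl | hp0
  · have h1 : (lowWeight n (0 * n)).card ≤ 1 := by
      refine Finset.card_le_one_iff_subset_singleton.2 ⟨0, fun e he => ?_⟩
      rw [mem_lowWeight, zero_mul, Nat.cast_nonpos, pauliWeight, Finset.card_eq_zero,
        Finset.filter_eq_empty_iff] at he
      rw [Finset.mem_singleton]
      ext (i | i)
      · by_contra h
        exact he (Finset.mem_univ i) (Or.inl h)
      · by_contra h
        exact he (Finset.mem_univ i) (Or.inr h)
    simp only [Real.binEntropy_zero, zero_mul, add_zero, mul_zero] at h1 ⊢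
    exact Real.log_nonpos (by positivity) (by exact_mod_cast h1)
  have hq : 0 < 1 - p := by linarith
  -- This weight in the generating function yields the entropy exponent. It is at most 1 exactly
  -- when p ≤ 3/4, so low-weight terms are at least `x ^ (p * n)`; p = 0 was treated apart because
  -- it makes `x` vanish.
  obtain ⟨x, hx⟩ : ∃ x, x = p / (3 * (1 - p)) := ⟨_, rfl⟩
  have hx0 : 0 < x := by rw [hx]; positivity
  have hx1 : x ≤ 1 := by rw [hx, div_le_one (by positivity)]; linarith
  have hx3 : 1 + 3 * x = (1 - p)⁻¹ := by
    rw [hx]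
    field_simp
    ring
  have h1 : (lowWeight n (p * n)).card * x ^ (p * n) ≤ ((1 - p)⁻¹) ^ n := by
    rw [← hx3, ← sum_pow_pauliWeight, ← nsmul_eq_mul]
    refine (Finset.card_nsmul_le_sum (lowWeight n (p * n)) _ _ fun e he => ?_).trans
      (Finset.sum_le_univ_sum_of_nonneg fun e => by positivity)
    rw [← Real.rpow_natCast]
    exact Real.rpow_le_rpow_of_exponent_ge hx0 hx1 (mem_lowWeight.1 he)
  have hcard : 0 < ((lowWeight n (p * n)).card : ℝ) := by
    rw [Nat.cast_pos, Finset.card_pos]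
    refine ⟨0, mem_lowWeight.2 ?_⟩
    simp [pauliWeight]
    positivity
  have h2 := Real.log_le_log (by positivity) h1
  rw [Real.log_mul hcard.ne' (by positivity), Real.log_rpow hx0, Real.log_pow, Real.log_inv, hx,
    Real.log_div hp0.ne' (by positivity), Real.log_mul (by norm_num) hq.ne'] at h2
  rw [Real.binEntropy_eq_negMulLog_add_negMulLog_one_sub, Real.negMulLog, Real.negMulLog]
  linarith

/-! ### List codes at the Gilbert–Varshamov rate -/

/-- A surviving tuple of differences would make 2^(LJ) at most the number of (L+1)-tuples of
low-weight errors, which the hypothesis excludes. -/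
theorem exists_isListCode {n L J : ℕ} {p : ℝ} (hp0 : 0 ≤ p) (hp : p ≤ 3 / 4) (hJ : J ≤ n)
    (h : (L + 1) * (n * (Real.binEntropy p + p * Real.log 3)) < L * J * Real.log 2) :
    ∃ C : StabilizerCode n (n - J), IsListCode C (p * n) L := by
  classical
  let T : Finset (Fin L → PVec n) := (Fintype.piFinset fun _ : Fin (L + 1) =>
    lowWeight n (p * n)).image fun e i => e i.succ + e 0
  obtain ⟨C, hC⟩ := StabilizerCode.exists_few T J hJ
  refine ⟨C, isListCode_of_not_actsIndependently C _ fun e he hind => ?_⟩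
  have hT : T.card ≤ (lowWeight n (p * n)).card ^ (L + 1) := by
    refine Finset.card_image_le.trans ?_
    rw [Fintype.card_piFinset_const]
  have hmem : 0 < (T.filter C.ActsIndependently).card := by
    refine Finset.card_pos.2 ⟨_, Finset.mem_filter.2 ⟨?_, hind⟩⟩
    exact Finset.mem_image.2 ⟨e, Fintype.mem_piFinset.2 fun i => mem_lowWeight.2 (he i), rfl⟩
  have h1 : 2 ^ (L * J) ≤ (lowWeight n (p * n)).card ^ (L + 1) :=
    ((Nat.le_mul_of_pos_right _ hmem).trans hC).trans hT
  have h2 : ((2 : ℝ) ^ (L * J)) ≤ ((lowWeight n (p * n)).card : ℝ) ^ (L + 1) := by exact_mod_cast h1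
  have h3 := Real.log_le_log (by positivity) h2
  rw [Real.log_pow, Real.log_pow] at h3
  push_cast at h3
  have h4 := mul_le_mul_of_nonneg_left (log_card_lowWeight_le (n := n) hp0 hp)
    (by positivity : (0 : ℝ) ≤ L + 1)
  linarith

theorem le_three_quarters_of_rate {p : ℝ} (hp0 : 0 ≤ p) (hp1 : p ≤ 1)
    (h : Real.binEntropy p + p * Real.log 3 < Real.log 2) : p ≤ 3 / 4 := by
  by_contra! hp
  have h1 := Real.binEntropy_nonneg hp0 hp1
  -- From 2^4 ≤ 3^3: beyond p = 3/4 the term p log 3 alone would already reach log 2.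
  have h2 : 4 * Real.log 2 ≤ 3 * Real.log 3 := by
    have := Real.log_le_log (by norm_num) (show (2 : ℝ) ^ 4 ≤ 3 ^ 3 by norm_num)
    rw [Real.log_pow, Real.log_pow] at this
    exact_mod_cast this
  have h3 := mul_le_mul_of_nonneg_right hp.le (Real.log_nonneg (by norm_num : (1 : ℝ) ≤ 3))
  linarith

/-! ### Rates -/

theorem tendsto_rate (R : ℝ) (K : ℕ) :
    Filter.Tendsto (fun n : ℕ => (n * R - K) / n) Filter.atTop (nhds R) := by
  have h1 : Filter.Tendsto (fun n : ℕ => R - (K : ℝ) / n) Filter.atTop (nhds (R - 0)) :=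
    tendsto_const_nhds.sub (tendsto_const_div_atTop_nhds_zero_nat (K : ℝ))
  rw [sub_zero] at h1
  refine h1.congr' ?_
  filter_upwards [Filter.eventually_gt_atTop 0] with n hn
  have : (n : ℝ) ≠ 0 := by positivity
  field_simp

/-! ### Sending zero qubits -/

theorem Channel.trace_apply {α β : Type} [Fintype α] [DecidableEq α] [Fintype β] (N : Channel α β)
    (ρ : Matrix α α ℂ) : (N.apply ρ).trace = ρ.trace := by
  rw [Channel.apply, Matrix.trace_sum]
  have h1 : ∀ i, (N.kraus i * ρ * (N.kraus i)ᴴ).trace =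
      ((N.kraus i)ᴴ * N.kraus i * ρ).trace := fun i => by
    rw [Matrix.trace_mul_comm, ← Matrix.mul_assoc]
  simp only [h1]
  rw [← Matrix.trace_sum, ← Matrix.sum_mul, N.trace_preserving, Matrix.one_mul]

theorem pureFidelity_of_unique {α : Type} [Fintype α] [Unique α] {ψ : α → ℂ} (hψ : IsUnitVec ψ)
    (ρ : Matrix α α ℂ) : pureFidelity ψ ρ = ρ.trace.re := by
  have h1 : star (ψ default) * ψ default = 1 := by
    simpa [IsUnitVec, dotProduct] using hψ
  have h2 : star ψ ⬝ᵥ (ρ *ᵥ ψ) = star (ψ default) * ψ default * ρ default default := by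
    simp [dotProduct, Matrix.mulVec]
    ring
  rw [pureFidelity, h2, h1, one_mul]
  simp [Matrix.trace]

theorem trace_proj {α : Type} [Fintype α] {ψ : α → ℂ} (hψ : IsUnitVec ψ) :
    (proj ψ).trace = 1 := by
  rw [proj, Matrix.trace_vecMulVec, dotProduct_comm]
  exact hψ

theorem sendsWithFidelity_zero_qubits {n : ℕ} (enc : Unit → Channel (Bits 0) (Bits n))
    (dec : Unit → Channel (Bits n) (Bits 0)) (p : ℝ) {f : ℝ} (hf : f ≤ 1) :
    SendsWithFidelity enc dec p f := by
  intro N _ ψ hψ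
  rw [pureFidelity_of_unique hψ]
  simpa [Channel.trace_apply, trace_proj hψ] using hf

theorem nonempty_channel (m n : ℕ) : Nonempty (Channel (Bits m) (Bits n)) := by
  obtain ⟨N, -⟩ := exists_channel_of_projector
    (fun i : Fin 0 => (i.elim0 : Matrix (Bits n) (Bits m) ℂ)) (Q := 0) (by simp) (by simp)
  exact ⟨N⟩

/-- Below the Gilbert–Varshamov rate there are list codes with `K` more encoded qubits than
needed. -/
theorem eventually_exists_isListCode {p R : ℝ} (hp0 : 0 ≤ p) (hp1 : p ≤ 1) (hR0 : 0 ≤ R)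
    (hR : R < 1 - Real.binEntropy p / Real.log 2 - p * Real.logb 2 3) :
    ∃ L : ℕ, ∀ K : ℕ, ∀ᶠ n : ℕ in Filter.atTop, ∃ (k : ℕ) (C : StabilizerCode n k),
      R * n + K ≤ k ∧ IsListCode C (p * n) L := by
  have hlog : 0 < Real.log 2 := Real.log_pos (by norm_num)
  obtain ⟨h, hh⟩ : ∃ h, h = Real.binEntropy p + p * Real.log 3 := ⟨_, rfl⟩
  have hh0 : 0 ≤ h := by
    rw [hh]
    exact add_nonneg (Real.binEntropy_nonneg hp0 hp1)
      (mul_nonneg hp0 (Real.log_nonneg (by norm_num)))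
  have hR' : h < (1 - R) * Real.log 2 := by
    have h1 : h / Real.log 2 < 1 - R := by
      rw [hh, add_div, mul_div_assoc, Real.log_div_log]
      linarith
    rwa [div_lt_iff₀ hlog] at h1
  have hp : p ≤ 3 / 4 := by
    refine le_three_quarters_of_rate hp0 hp1 ?_
    rw [← hh]
    nlinarith
  have hR1 : 0 < 1 - R := pos_of_mul_pos_left (hh0.trans_lt hR') hlog.le
  -- This `L` gives (L + 1)h < L(1 - R) log 2, a gap linear in n that absorbs `K` and rounding.
  obtain ⟨L, hL⟩ := exists_nat_gt (h / ((1 - R) * Real.log 2 - h))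
  rw [div_lt_iff₀ (by linarith)] at hL
  refine ⟨L, fun K => ?_⟩
  have hgap : 0 < L * ((1 - R) * Real.log 2) - (L + 1) * h := by linarith
  have hev : ∀ a b : ℝ, 0 < a → ∀ᶠ n : ℕ in Filter.atTop, b < a * n := fun a b ha =>
    (tendsto_natCast_atTop_atTop.const_mul_atTop ha).eventually_gt_atTop b
  filter_upwards [hev _ (L * (K + 1) * Real.log 2) hgap, hev _ K hR1] with n hn1 hn2
  -- As many generators as possible while at least Rn + K qubits stay encoded; the `K` extra ones
  -- are spent on the pseudorandom subcode.
  obtain ⟨J, hJ⟩ : ∃ J, J = ⌊(1 - R) * n - K⌋₊ := ⟨_, rfl⟩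
  have hJ1 : (J : ℝ) ≤ (1 - R) * n - K := by
    rw [hJ]
    exact Nat.floor_le (by linarith)
  have hJ2 : (1 - R) * n - K - 1 ≤ J := by
    rw [hJ]
    exact (Nat.sub_one_lt_floor _).le
  have hRn : 0 ≤ R * n := by positivity
  have hJn : J ≤ n := by
    have : (J : ℝ) ≤ n := by
      have : (0 : ℝ) ≤ K := by positivity
      linarith
    exact_mod_cast this
  obtain ⟨C, hC⟩ := exists_isListCode (L := L) hp0 hp hJn (by
    rw [← hh]
    have := mul_le_mul_of_nonneg_left hJ2 (by positivity : 0 ≤ L * Real.log 2)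
    linarith)
  refine ⟨n - J, C, ?_, hC⟩
  rw [Nat.cast_sub hJn]
  linarith

/-! ### The main theorem -/

theorem theorem2 :
    (∃ c : ℝ, 0 < c ∧
      ∀ (n k L : ℕ) (p ε η : ℝ) (C : StabilizerCode n k),
        IsListCode C (p * n) L → 0 < ε → ε < 1 / 2 → 0 < η → η ≤ 1 / 2 →
        numGenerators L ε ≤ k →
        (∀ A : SetFamily k (numGenerators L ε), (∀ j, IsBiased η (A j)) →
          Nonempty (Subcodes C A) ∧
          ∀ S : Subcodes C A,
            ∃ dec : KeyOf A → Channel (Bits n) (Bits (k - numGenerators L ε)),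
              SendsWithFidelity (fun κ => (S.code _ le_rfl κ).encode) dec p (1 - ε)) ∧
        (∃ A : SetFamily k (numGenerators L ε), (∀ j, IsBiased η (A j)) ∧
          (keyBits (KeyOf A) : ℝ) <
            c * (numGenerators L ε * Real.logb 2 ((n : ℝ) ^ 2 / η)))) ∧
    (∀ (R ε : ℝ) (L : ℕ), 0 < ε → ε < 1 / 2 →
      Filter.Tendsto (fun n : ℕ => (n * R - numGenerators L ε) / n) Filter.atTop (nhds R)) ∧
    (∀ p R ε : ℝ, 0 ≤ p → p ≤ 1 →
      R < 1 - Real.binEntropy p / Real.log 2 - p * Real.logb 2 3 → 0 < ε → ε < 1 / 2 →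
      ∃ c : ℝ, 0 < c ∧ ∀ᶠ n : ℕ in Filter.atTop,
        ∃ (m : ℕ) (Key : Type) (_ : Fintype Key) (_ : Nonempty Key)
          (enc : Key → Channel (Bits m) (Bits n)) (dec : Key → Channel (Bits n) (Bits m)),
          R * n ≤ m ∧ (keyBits Key : ℝ) ≤ c * Real.logb 2 n ∧
          SendsWithFidelity enc dec p (1 - ε)) := by
  refine ⟨⟨4, by norm_num, fun n k L p ε η C hC hε0 hε hη0 hη hK => ⟨fun A hA =>
    ⟨nonempty_subcodes C A hK, exists_decoder hC hη hA hK (four_pow_mul_le hε0)⟩, ?_⟩⟩,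
    fun R ε L _ _ => tendsto_rate R _, fun p R ε hp0 hp1 hR hε0 hε => ?_⟩
  · have h3 := three_le_numGenerators (L := L) hε0 hε
    exact exists_biased_family C.le (h3.trans (hK.trans C.le)) (by omega) hη0 hη
  -- A negative rate is met by sending no qubits with a trivial key.
  rcases lt_or_ge R 0 with hR0 | hR0
  · refine ⟨1, one_pos, ?_⟩
    filter_upwards [Filter.eventually_ge_atTop 1] with n hn
    have hn' : (1 : ℝ) ≤ n := by exact_mod_cast hn
    refine ⟨0, Unit, inferInstance, inferInstance, fun _ => (nonempty_channel 0 n).some,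
      fun _ => (nonempty_channel n 0).some, ?_, ?_,
      sendsWithFidelity_zero_qubits _ _ p (by linarith)⟩
    · rw [Nat.cast_zero]
      exact mul_nonpos_of_nonpos_of_nonneg hR0.le (by positivity)
    · simpa [keyBits] using Real.logb_nonneg (b := 2) (by norm_num) hn'
  · obtain ⟨L, hL⟩ := eventually_exists_isListCode hp0 hp1 hR0 hR
    have h3 := three_le_numGenerators (L := L) hε0 hε
    obtain ⟨K, hKdef⟩ : ∃ K, K = numGenerators L ε := ⟨_, rfl⟩
    rw [← hKdef] at h3
    -- 12 = 4 · 3: the factor 4 of the key-length bound with η = 1/2, and log (2n²) ≤ 3 log n.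
    refine ⟨12 * K, by positivity, ?_⟩
    filter_upwards [hL K, Filter.eventually_ge_atTop 3] with n hn hn3
    obtain ⟨k, C, hk, hC⟩ := hn
    have hn' : (3 : ℝ) ≤ n := by exact_mod_cast hn3
    have hKk : K ≤ k := by
      have : (K : ℝ) ≤ k := by
        have : 0 ≤ R * n := by positivity
        linarith
      exact_mod_cast this
    obtain ⟨A, hA, hbits⟩ := exists_biased_family (K := K) (η := 1 / 2) C.le hn3 (by omega)
      (by norm_num) le_rfl
    obtain ⟨S⟩ := nonempty_subcodes C A hKk
    obtain ⟨dec, hdec⟩ := exists_decoder (ε := ε) hC le_rfl hA hKk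
      (by rw [hKdef]; exact four_pow_mul_le hε0) S
    refine ⟨k - K, KeyOf A, inferInstance, nonempty_keyOf hA le_rfl hKk, _, dec, ?_, ?_, hdec⟩
    · rw [Nat.cast_sub hKk]
      linarith
    · refine hbits.le.trans ?_
      have h1 : Real.logb 2 ((n : ℝ) ^ 2 / (1 / 2)) ≤ 3 * Real.logb 2 n := by
        rw [← Real.logb_rpow_eq_mul_logb_of_pos (by positivity)]
        refine Real.logb_le_logb_of_le (by norm_num) (by positivity) ?_
        have : (n : ℝ) ^ (3 : ℝ) = n ^ 2 * n := by
          rw [show (3 : ℝ) = (3 : ℕ) by norm_num, Real.rpow_natCast]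
          ring
        rw [this, div_le_iff₀ (by norm_num)]
        nlinarith [sq_nonneg (n : ℝ)]
      have h2 := mul_le_mul_of_nonneg_left h1 (by positivity : (0 : ℝ) ≤ K)
      linarith
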